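/- **Monotonicity formula.** Let $n\ge 2$, let $B_r\subset\mathbb R^n$ be the open ball of radius $r$ centred at $0$, and for a (Lebesgue) measurable $E\subset\mathbb R^n$ and an open $\Omega$ let $$P(E;\Omega)=\sup\Big\{\Big|\int_E \operatorname{div} g\Big| : g\in C^1_c(\Omega;\mathbb R^n),\ |g|\le 1\Big\}.$$ For $\delta\in(0,\pi/2]$ put $\Lambda^\delta=\{x : \cos\delta\,|x_{n-1}|+\sin\delta\, x_n\le 0\}$. Let $\Phi:\mathbb R^n\to\mathbb R^n$ be a $C^{1,1}$ diffeomorphism (that is, $\Phi$ and $\Phi^{-1}$ are $C^1$ with locally Lipschitz derivatives). A measurable set $E\subset\mathbb R^n$ is a *minimizer of the $\delta$-thin obstacle problem in $B_1$* (for $\Phi$) if $P(E;B_1)<\infty$, $\Phi(\Lambda^\delta)\cap B_1\subset E$, and $P(E;B_1)\le P(F;B_1)$ for every measurable $F$ with $\Phi(\Lambda^\delta)\cap B_1\subset F$ and $E\setminus K=F\setminus K$ for some compact $K\subset B_1$. Write $\partial E$ for the set of points $x$ with $0<|E\cap B_r(x)|<|B_r(x)|$ for all $r>0$, write $\partial\mathcal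 O=\Phi(\{x_{n-1}=x_n=0\})$, and set $$\mathcal A_E(r)=\frac{P(E;\Phi(B_r))}{r^{n-1}},\qquad r>0 .$$ Let $E$ be a minimizer of the $\delta$-thin obstacle problem in $B_1$ with $0\in\partial E\cap\partial\mathcal O$. (a) If $\Phi=\mathrm{id}$, then $\mathcal A_E$ is nondecreasing on $(0,1)$; in particular it is differentiable at almost every $r\in(0,1)$, with $\mathcal A_E'(r)\ge 0$ wherever the derivative exists. Moreover, $\mathcal A_E$ is constant on $(0,1)$ if and only if $E$ is a cone in $B_1$, i.e. there is a set $\mathcal C$ with $t\,\mathcal C=\mathcal C$ for all $t>0$ such that $E\cap B_1=\mathcal C\cap B_1$ up to a null set. (b) There are constants $\eta_0\in(0,1)$ and $C>0$, depending only on $n$ (and not on $\delta$, $\Phi$, $E$), such that the following holds for every $\eta\in(0,\eta_0]$. If $\Phi(0)=0$, $D\Phi(0)=\mathrm{id}$ and $[\Phi]_{C^{1,1}(B_1)}\le\eta$ (i.e. $|D\Phi(x)-D\Phi(y)|\le\eta|x-y|$ in operator norm for $x,y\in B_1$), then $r\mapsto\mathcal A_E(r)+C\eta\, r$ is nondecreasing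 on the set of those $r\in(0,1)$ for which $\Phi(B_r)\subset B_1$ (an interval which contains $(0,1/2]$). In particular, for almost every such $r$ the derivative $\mathcal A_E'(r)$ exists, and, wherever it exists, $\mathcal A_E'(r)\ge -C\eta$. -/

import Mathlib

open MeasureTheory Set Filter
open scoped ENNReal Pointwise

/-- The Euclidean space of dimension `n`. -/
abbrev Euc (n : ℕ) : Type := EuclideanSpace ℝ (Fin n)

/-- The open ball of radius `r` centred at the origin. -/
abbrev oBall (n : ℕ) (r : ℝ) : Set (Euc n) := Metric.ball (0 : Euc n) r

/-- The divergence of a vector field. -/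
noncomputable def divergence {n : ℕ} (g : Euc n → Euc n) (x : Euc n) : ℝ :=
  ∑ i : Fin n, (fderiv ℝ g x (EuclideanSpace.single i 1)) i

/-- The relative perimeter `P(E; Ω)`: the supremum of `|∫_E div g|` over the `C¹` vector fields `g`
with compact support in `Ω` and with `|g| ≤ 1`. -/
noncomputable def perimeter {n : ℕ} (E Ω : Set (Euc n)) : ℝ≥0∞ :=
  ⨆ (g : Euc n → Euc n) (_ : ContDiff ℝ 1 g) (_ : HasCompactSupport g) (_ : tsupport g ⊆ Ω)
    (_ : ∀ x, ‖g x‖ ≤ 1), ENNReal.ofReal |∫ x in E, divergence g x|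

/-- The boundary of `E`, in the measure theoretic sense: the points all of whose neighbourhoods
meet both `E` and its complement in positive measure. -/
def essBoundary {n : ℕ} (E : Set (Euc n)) : Set (Euc n) :=
  {x | ∀ r : ℝ, 0 < r →
    0 < volume (E ∩ Metric.ball x r) ∧ volume (E ∩ Metric.ball x r) < volume (Metric.ball x r)}

/-- The coordinate `x_{n-1}` (the last but one). -/
def coordPen {n : ℕ} (hn : 2 ≤ n) (x : Euc n) : ℝ := x ⟨n - 2, by omega⟩

/-- The coordinate `x_n` (the last one). -/
def coordLast {n : ℕ} (hn : 2 ≤ n) (x : Euc n) : ℝ := x ⟨n - 1, by omega⟩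

/-- `e_ω · x`, where `e_ω = sin ω e_{n-1} + cos ω e_n`. -/
noncomputable def eDot {n : ℕ} (hn : 2 ≤ n) (ω : ℝ) (x : Euc n) : ℝ :=
  Real.sin ω * coordPen hn x + Real.cos ω * coordLast hn x

/-- The wedge `Λ_{γ,θ}`. -/
def wedge {n : ℕ} (hn : 2 ≤ n) (γ θ : ℝ) : Set (Euc n) :=
  {x | eDot hn (γ + θ) x ≤ 0 ∧ eDot hn (γ - θ) x ≤ 0}

/-- The sharp wedge `Λ^δ = Λ_{0, π/2 - δ}`. -/
noncomputable def sharpWedge {n : ℕ} (hn : 2 ≤ n) (δ : ℝ) : Set (Euc n) :=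
  wedge hn 0 (Real.pi / 2 - δ)

/-- The edge `∂𝒪 = Φ({x_{n-1} = x_n = 0})` of the thin obstacle `𝒪 = Φ({x_{n-1} = 0, x_n ≤ 0})`. -/
def obstacleEdge {n : ℕ} (hn : 2 ≤ n) (Φ : Euc n → Euc n) : Set (Euc n) :=
  Φ '' {x | coordPen hn x = 0 ∧ coordLast hn x = 0}

/-- `Φ` is a `C^{1,1}` diffeomorphism of the whole space. -/
def IsC11Diffeo {n : ℕ} (Φ : Euc n → Euc n) : Prop :=
  ∃ Ψ : Euc n → Euc n, Function.LeftInverse Ψ Φ ∧ Function.RightInverse Ψ Φ ∧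
    ContDiff ℝ 1 Φ ∧ ContDiff ℝ 1 Ψ ∧
    LocallyLipschitz (fderiv ℝ Φ) ∧ LocallyLipschitz (fderiv ℝ Ψ)

/-- `E` is a minimizer of the `δ`-thin obstacle problem in the unit ball: it is a set of finite
perimeter there, it contains the obstacle `Φ(Λ^δ)` in the unit ball, and its perimeter does not
exceed that of any compact perturbation of it inside the unit ball that contains the obstacle. -/
structure IsThinObstacleMinimizer {n : ℕ} (hn : 2 ≤ n) (Φ : Euc n → Euc n) (δ : ℝ)
    (E : Set (Euc n)) : Prop where
  measurable : NullMeasurableSet E volume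
  finite_perimeter : perimeter E (oBall n 1) < ⊤
  obstacle_subset : Φ '' sharpWedge hn δ ∩ oBall n 1 ⊆ E
  perimeter_le : ∀ F : Set (Euc n), NullMeasurableSet F volume →
    (∃ K : Set (Euc n), IsCompact K ∧ K ⊆ oBall n 1 ∧ E \ K = F \ K) →
    Φ '' sharpWedge hn δ ∩ oBall n 1 ⊆ F →
    perimeter E (oBall n 1) ≤ perimeter F (oBall n 1)

/-- The normalized perimeter `A_E(r) = P(E; Φ(B_r)) / r^{n-1}`. -/
noncomputable def normPerimeter {n : ℕ} (Φ : Euc n → Euc n) (E : Set (Euc n)) (r : ℝ) : ℝ :=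
  (perimeter E (Φ '' oBall n r)).toReal / r ^ (n - 1)

/-- `E` is a cone in `Ω`: up to a null set it coincides there with a set `C` such that
`t C = C` for all `t > 0`. -/
def IsConeIn {n : ℕ} (E Ω : Set (Euc n)) : Prop :=
  ∃ C : Set (Euc n), (∀ t : ℝ, 0 < t → t • C = C) ∧
    (E ∩ Ω : Set (Euc n)) =ᵐ[volume] (C ∩ Ω : Set (Euc n))

open scoped Topology ContDiff

/-! The wedge is a cone, so a minimizer may be compared with its images under `Φ ∘ T ∘ Φ⁻¹`, where T
x = (1 - t f(|x|²)) x is a radial contraction with f ≥ 0, f' ≤ 0. For Φ = id the classical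
derivative of the perimeter at t = 0 is -∫ ((n-1) f + 2 f' (|x|² - (x·ν)²)), with ν the unit normal.
Minimality makes it nonnegative, and since f' ≤ 0 dropping (x·ν)² only enlarges it. Taking f(σ)
close to max(σ, a)^(-(n-1)/2) - b^(-(n-1)/2) for σ < b, and 0 beyond, turns the inequality into
monotonicity of r^(1-n) P(E; B_r) between the radii √a and √b.

No normal vector is used. The perimeter is extended to a measure μ with ∫_E div g ≤ ∫ |g| dμ
(`IsPerimeterMeasure.integral_divergence_le`). A test field for the deformed set pulls back to a
field on E with a continuous weak divergence (`IsC1Inverse.hasWeakDivergence_pullField`). A bound on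
the pulled back field that is uniform over |g| ≤ 1 (`norm_pullField_radial_le`) replaces the
computation with ν and gives `IsThinObstacleMinimizer.integral_firstVariation_nonneg`.

When DΦ is η-Lipschitz with DΦ(0) = id, the coefficients n-1 and 2 change by O(ηR) on the ball of
radius R, so the exponent n-1 is replaced by some m with n-1-m = O(ηR). This costs a factor
exp(O(η(s₂-s₁))) between comparable radii, which the bound P(E; Φ(B_s)) ≤ C s^(n-1)
(`exists_density_bound`) turns into the additive term Cηr.

Rigidity: if the normalized perimeter is constant, the radial distribution of μ is explicit and the
first variation integral vanishes. Hence the discarded term (x·ν)² must vanish too. Quantitatively,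
it leaves room to add a small multiple of h(x) x to the pulled back field of a nearly optimal g at
second order cost, so ∫_E div(h x) = 0 for every h. Thus 1_E has no radial derivative in the ball,
and E is a cone up to a null set. The converse is scaling. -/

/-- `C¹` vector fields with compact support in `Ω`. -/
structure IsTestField {n : ℕ} (Ω : Set (Euc n)) (g : Euc n → Euc n) : Prop where
  contDiff : ContDiff ℝ 1 g
  hasCompactSupport : HasCompactSupport g
  tsupport_subset : tsupport g ⊆ Ω

/-! ### Divergence and integration by parts -/

section Divergence

variable {n : ℕ}

lemma linearMap_apply_eq_sum {F : Type*} [NormedAddCommGroup F] [NormedSpace ℝ F]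
    (l : Euc n →L[ℝ] F) (v : Euc n) :
    l v = ∑ i : Fin n, v i • l (EuclideanSpace.single i 1) := by
  conv_lhs => rw [← (EuclideanSpace.basisFun (Fin n) ℝ).sum_repr v]
  simp [map_sum]

lemma divergence_add {g h : Euc n → Euc n} {x : Euc n} (hg : DifferentiableAt ℝ g x)
    (hh : DifferentiableAt ℝ h x) :
    divergence (fun y => g y + h y) x = divergence g x + divergence h x := by
  simp only [divergence, fderiv_fun_add hg hh, ← Finset.sum_add_distrib]
  rfl

lemma divergence_const_smul (c : ℝ) {g : Euc n → Euc n} {x : Euc n}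
    (hg : DifferentiableAt ℝ g x) :
    divergence (fun y => c • g y) x = c * divergence g x := by
  simp only [divergence, fderiv_fun_const_smul hg, Finset.mul_sum]
  rfl

lemma divergence_smul {u : Euc n → ℝ} {g : Euc n → Euc n} {x : Euc n}
    (hu : DifferentiableAt ℝ u x) (hg : DifferentiableAt ℝ g x) :
    divergence (fun y => u y • g y) x = u x * divergence g x + fderiv ℝ u x (g x) := by
  rw [linearMap_apply_eq_sum (fderiv ℝ u x)]
  simp only [divergence, fderiv_fun_smul hu hg, Finset.mul_sum, ← Finset.sum_add_distrib]
  refine Finset.sum_congr rfl fun i _ => ?_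
  simp [mul_comm]

lemma continuous_divergence {g : Euc n → Euc n} (hg : ContDiff ℝ 1 g) :
    Continuous (divergence g) := by
  have := hg.continuous_fderiv one_ne_zero
  unfold divergence
  fun_prop

lemma divergence_eq_zero_of_notMem_tsupport {g : Euc n → Euc n} {x : Euc n}
    (hx : x ∉ tsupport g) : divergence g x = 0 := by
  have h : fderiv ℝ g x = 0 := by
    by_contra h
    exact hx (support_fderiv_subset ℝ h)
  simp [divergence, h]

lemma hasCompactSupport_divergence {g : Euc n → Euc n} (hg : HasCompactSupport g) :
    HasCompactSupport (divergence g) :=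
  HasCompactSupport.intro hg fun _ => divergence_eq_zero_of_notMem_tsupport

lemma integrable_divergence {g : Euc n → Euc n} (hg : ContDiff ℝ 1 g)
    (hc : HasCompactSupport g) : Integrable (divergence g) :=
  (continuous_divergence hg).integrable_of_hasCompactSupport (hasCompactSupport_divergence hc)

lemma integral_divergence_eq_zero {g : Euc n → Euc n} (hg : ContDiff ℝ 1 g)
    (hc : HasCompactSupport g) : ∫ x, divergence g x = 0 := by
  have hcd := hg.continuous_fderiv one_ne_zero
  have hcs : HasCompactSupport (fderiv ℝ g) := hc.fderiv ℝ
  have hint : ∀ i : Fin n, Integrable fun x => (fderiv ℝ g x (EuclideanSpace.single i 1)) i := by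
    intro i
    refine Continuous.integrable_of_hasCompactSupport (by fun_prop) ?_
    exact hcs.comp_left (g := fun l : Euc n →L[ℝ] Euc n => (l (EuclideanSpace.single i 1)) i)
      (by simp)
  unfold divergence
  rw [integral_finsetSum _ fun i _ => hint i]
  refine Finset.sum_eq_zero fun i _ => ?_
  have hd : ∀ x, fderiv ℝ (fun y => g y i) x (EuclideanSpace.single i 1)
      = (fderiv ℝ g x (EuclideanSpace.single i 1)) i := by
    intro x
    have h1 : HasFDerivAt (fun y => g y i)
        ((EuclideanSpace.proj i : Euc n →L[ℝ] ℝ).comp (fderiv ℝ g x)) x :=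
      (EuclideanSpace.proj i : Euc n →L[ℝ] ℝ).hasFDerivAt.comp x
        ((hg.differentiable one_ne_zero x).hasFDerivAt)
    rw [h1.fderiv]
    rfl
  have hgi : Integrable fun x => g x i := by
    refine Continuous.integrable_of_hasCompactSupport (by have := hg.continuous; fun_prop) ?_
    exact hc.comp_left (g := fun v : Euc n => v i) (by simp)
  -- Integration by parts against the constant function 1, whose derivative vanishes.
  have key := integral_mul_fderiv_eq_neg_fderiv_mul_of_integrable (μ := (volume : Measure (Euc n)))
    (f := fun _ => (1 : ℝ)) (g := fun y => g y i) (v := EuclideanSpace.single i 1)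
    (by simp) (by simp only [hd, one_mul]; exact hint i) (by simpa using hgi)
    (by intro x _; exact differentiableAt_const _)
    (by
      intro x _
      exact (EuclideanSpace.proj i : Euc n →L[ℝ] ℝ).differentiableAt.comp x
        (hg.differentiable one_ne_zero x))
  simpa [hd] using key

lemma integral_mul_divergence {u : Euc n → ℝ} {g : Euc n → Euc n} (hu : ContDiff ℝ 1 u)
    (hg : ContDiff ℝ 1 g) (hc : HasCompactSupport g) :
    ∫ x, u x * divergence g x = - ∫ x, fderiv ℝ u x (g x) := by
  have h := integral_divergence_eq_zero (hu.smul hg) (hc.smul_left (f := u))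
  have hcu := hu.continuous
  have hcf := hu.continuous_fderiv one_ne_zero
  have hcg := hg.continuous
  have h1 : Integrable fun x => u x * divergence g x :=
    (hcu.mul (continuous_divergence hg)).integrable_of_hasCompactSupport
      ((hasCompactSupport_divergence hc).mul_left)
  have h2 : Integrable fun x => fderiv ℝ u x (g x) := by
    refine (hcf.clm_apply hcg).integrable_of_hasCompactSupport ?_
    refine HasCompactSupport.intro hc fun x hx => ?_
    rw [image_eq_zero_of_notMem_tsupport hx, map_zero]
  have h3 : ∀ x, divergence (fun y => u y • g y) x = u x * divergence g x + fderiv ℝ u x (g x) :=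
    fun x => divergence_smul (hu.differentiable one_ne_zero x) (hg.differentiable one_ne_zero x)
  have h4 : ∫ x, divergence (fun y => u y • g y) x = 0 := h
  simp only [h3] at h4
  rw [integral_add h1 h2] at h4
  linarith

end Divergence

namespace IsTestField

variable {n : ℕ} {Ω Ω' : Set (Euc n)} {g h : Euc n → Euc n}

lemma mono (hg : IsTestField Ω g) (hΩ : Ω ⊆ Ω') : IsTestField Ω' g :=
  ⟨hg.1, hg.2, hg.3.trans hΩ⟩

lemma continuous (hg : IsTestField Ω g) : Continuous g := hg.contDiff.continuous

lemma differentiableAt (hg : IsTestField Ω g) (x : Euc n) : DifferentiableAt ℝ g x :=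
  hg.contDiff.differentiable one_ne_zero x

lemma eq_zero (hg : IsTestField Ω g) {x : Euc n} (hx : x ∉ Ω) : g x = 0 :=
  image_eq_zero_of_notMem_tsupport fun h => hx (hg.tsupport_subset h)

lemma integrable_divergence (hg : IsTestField Ω g) : Integrable (divergence g) :=
  _root_.integrable_divergence hg.contDiff hg.hasCompactSupport

lemma zero : IsTestField Ω (fun _ => (0 : Euc n)) :=
  ⟨contDiff_const, HasCompactSupport.zero, by
    have h0 : (fun _ => (0 : Euc n)) = (0 : Euc n → Euc n) := rfl
    rw [h0, tsupport_zero]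
    exact empty_subset _⟩

lemma add (hg : IsTestField Ω g) (hh : IsTestField Ω h) : IsTestField Ω fun x => g x + h x :=
  ⟨hg.1.add hh.1, hg.2.add hh.2,
    (tsupport_add g h).trans (union_subset hg.3 hh.3)⟩

lemma smul (hg : IsTestField Ω g) {u : Euc n → ℝ} (hu : ContDiff ℝ 1 u) :
    IsTestField Ω fun x => u x • g x :=
  ⟨hu.smul hg.1, hg.2.smul_left (f := u),
    (tsupport_smul_subset_right u g).trans hg.3⟩

lemma integral_add (hg : IsTestField Ω g) (hh : IsTestField Ω' h) (E : Set (Euc n)) :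
    ∫ x in E, divergence (fun y => g y + h y) x
      = (∫ x in E, divergence g x) + ∫ x in E, divergence h x := by
  rw [← MeasureTheory.integral_add hg.integrable_divergence.integrableOn
    hh.integrable_divergence.integrableOn]
  simp only [divergence_add (hg.differentiableAt _) (hh.differentiableAt _)]

lemma integral_const_smul (hg : IsTestField Ω g) (c : ℝ) (E : Set (Euc n)) :
    ∫ x in E, divergence (fun y => c • g y) x = c * ∫ x in E, divergence g x := by
  rw [← integral_const_mul]
  simp only [divergence_const_smul c (hg.differentiableAt _)]

end IsTestField

/-! ### The perimeter as a set function and its extension to a Borel measure -/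

section Perimeter

variable {n : ℕ} {E Ω Ω' : Set (Euc n)}

lemma le_perimeter {g : Euc n → Euc n} (hg : IsTestField Ω g) (h1 : ∀ x, ‖g x‖ ≤ 1) :
    ENNReal.ofReal |∫ x in E, divergence g x| ≤ perimeter E Ω :=
  le_iSup_of_le g <| le_iSup_of_le hg.1 <| le_iSup_of_le hg.2 <| le_iSup_of_le hg.3 <|
    le_iSup_of_le h1 le_rfl

lemma perimeter_le_of_abs {c : ℝ≥0∞} (h : ∀ g, IsTestField Ω g → (∀ x, ‖g x‖ ≤ 1) →
    ENNReal.ofReal |∫ x in E, divergence g x| ≤ c) : perimeter E Ω ≤ c :=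
  iSup_le fun g => iSup_le fun h1 => iSup_le fun h2 => iSup_le fun h3 => iSup_le fun h4 =>
    h g ⟨h1, h2, h3⟩ h4

/-- Replacing g by -g makes the absolute value in the definition superfluous. -/
lemma perimeter_le {c : ℝ≥0∞} (h : ∀ g, IsTestField Ω g → (∀ x, ‖g x‖ ≤ 1) →
    ENNReal.ofReal (∫ x in E, divergence g x) ≤ c) : perimeter E Ω ≤ c := by
  refine perimeter_le_of_abs fun g hg h1 => ?_
  rcases le_total 0 (∫ x in E, divergence g x) with h0 | h0
  · rw [abs_of_nonneg h0]
    exact h g hg h1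
  · rw [abs_of_nonpos h0]
    have := h _ (hg.smul (u := fun _ => -1) contDiff_const) (by simpa using h1)
    rwa [hg.integral_const_smul, neg_one_mul] at this

lemma exists_testField_lt {c : ℝ≥0∞} (h : c < perimeter E Ω) :
    ∃ g, IsTestField Ω g ∧ (∀ x, ‖g x‖ ≤ 1) ∧ c < ENNReal.ofReal (∫ x in E, divergence g x) := by
  by_contra! hc
  exact absurd (perimeter_le hc) (not_le.2 h)

lemma perimeter_mono (h : Ω ⊆ Ω') : perimeter E Ω ≤ perimeter E Ω' :=
  perimeter_le_of_abs fun _ hg h1 => le_perimeter (hg.mono h) h1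

lemma perimeter_congr {F : Set (Euc n)} (h : (E ∩ Ω : Set (Euc n)) =ᵐ[volume] (F ∩ Ω : Set (Euc n)))
    (hΩ : MeasurableSet Ω) : perimeter E Ω = perimeter F Ω := by
  have key : ∀ g, IsTestField Ω g → ∀ A : Set (Euc n), ∫ x in A, divergence g x
      = ∫ x in A ∩ Ω, divergence g x := by
    intro g hg A
    rw [inter_comm, ← Measure.restrict_restrict hΩ]
    refine (setIntegral_eq_integral_of_forall_compl_eq_zero fun x hx => ?_).symm
    exact divergence_eq_zero_of_notMem_tsupport fun h => hx (hg.3 h)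
  have key2 : ∀ g, IsTestField Ω g → ∫ x in E, divergence g x = ∫ x in F, divergence g x := by
    intro g hg
    rw [key g hg E, key g hg F, setIntegral_congr_set h]
  refine le_antisymm ?_ ?_
  · refine perimeter_le_of_abs fun g hg h1 => ?_
    rw [key2 g hg]
    exact le_perimeter hg h1
  · refine perimeter_le_of_abs fun g hg h1 => ?_
    rw [← key2 g hg]
    exact le_perimeter hg h1

/-- A `C¹` Urysohn function. -/
lemma exists_contDiff_cutoff {K U : Set (Euc n)} (hK : IsClosed K) (hU : IsOpen U) (hKU : K ⊆ U) :
    ∃ χ : Euc n → ℝ, ContDiff ℝ 1 χ ∧ (∀ᶠ x in 𝓝ˢ K, χ x = 1) ∧ tsupport χ ⊆ U ∧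
      ∀ x, χ x ∈ Icc (0 : ℝ) 1 := by
  obtain ⟨f, h0, h1, h2⟩ := exists_contMDiffMap_zero_one_nhds_of_isClosed
    (modelWithCornersSelf ℝ (Euc n)) (n := 1) hU.isClosed_compl hK
    (disjoint_left.2 fun x hx hx' => hx (hKU hx'))
  refine ⟨f, f.contMDiff.contDiff, h1, fun x hx => ?_, h2⟩
  by_contra hxU
  have := (Filter.eventually_iff.1 h0)
  rw [mem_nhdsSet_iff_forall] at this
  exact (notMem_tsupport_iff_eventuallyEq.2 (this x hxU)) hx

/-- A partition of unity splits a test field as χ g + (1 - χ) g, with one summand supported in each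
open set. -/
lemma perimeter_union_le {U V : Set (Euc n)} (hU : IsOpen U) (hV : IsOpen V) :
    perimeter E (U ∪ V) ≤ perimeter E U + perimeter E V := by
  refine perimeter_le fun g hg h1 => ?_
  -- Taking χ = 1 near the part of the support outside V forces the support of (1 - χ) g into V.
  have hcl : IsClosed (tsupport g \ V) := (isClosed_tsupport g).sdiff hV
  obtain ⟨χ, hχ, hχ1, hχU, hχ01⟩ := exists_contDiff_cutoff hcl hU fun x hx =>
    (hg.3 hx.1).resolve_right hx.2
  have hA : IsTestField U fun x => χ x • g x :=
    ⟨hχ.smul hg.1, hg.2.smul_left (f := χ), (tsupport_smul_subset_left χ g).trans hχU⟩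
  have hB : IsTestField V fun x => (1 - χ x) • g x := by
    refine ⟨(contDiff_const.sub hχ).smul hg.1, hg.2.smul_left (f := fun x => 1 - χ x),
      fun x hx => ?_⟩
    by_contra hxV
    have hxg : x ∈ tsupport g := tsupport_smul_subset_right (fun x => 1 - χ x) g hx
    rw [Filter.eventually_iff, mem_nhdsSet_iff_forall] at hχ1
    refine (notMem_tsupport_iff_eventuallyEq.2 ?_) hx
    filter_upwards [hχ1 x ⟨hxg, hxV⟩] with y hy
    have hy' : χ y = 1 := hy
    simp [hy']
  have hsum : ∀ x, g x = χ x • g x + (1 - χ x) • g x := fun x => by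
    rw [← add_smul]; simp
  have hbd : ∀ c ∈ Icc (0 : ℝ) 1, ∀ x, ‖c • g x‖ ≤ 1 := by
    intro c hc x
    rw [norm_smul, Real.norm_of_nonneg hc.1]
    exact mul_le_one₀ hc.2 (norm_nonneg _) (h1 x)
  have heq : ∫ x in E, divergence g x = (∫ x in E, divergence (fun x => χ x • g x) x)
      + ∫ x in E, divergence (fun x => (1 - χ x) • g x) x := by
    rw [← hA.integral_add hB]
    congr 1
    exact congrArg (fun G : Euc n → Euc n => fun x => divergence G x) (funext hsum)
  rw [heq]
  refine (ENNReal.ofReal_add_le).trans (add_le_add ?_ ?_)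
  · exact (ENNReal.ofReal_le_ofReal (le_abs_self _)).trans
      (le_perimeter hA fun x => hbd _ (hχ01 x) x)
  · exact (ENNReal.ofReal_le_ofReal (le_abs_self _)).trans
      (le_perimeter hB fun x => hbd _ ⟨by linarith [(hχ01 x).2], by linarith [(hχ01 x).1]⟩ x)

/-- Test fields with disjoint supports can be added without violating the bound by 1; a field with
negative integral is simply left out. -/
lemma perimeter_add_le_of_disjoint {U V : Set (Euc n)} (hd : Disjoint U V) :
    perimeter E U + perimeter E V ≤ perimeter E (U ∪ V) := by
  have key : ∀ g h, IsTestField U g → (∀ x, ‖g x‖ ≤ 1) → IsTestField V h → (∀ x, ‖h x‖ ≤ 1) →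
      ENNReal.ofReal (∫ x in E, divergence g x) + ENNReal.ofReal (∫ x in E, divergence h x)
        ≤ perimeter E (U ∪ V) := by
    intro g h hg hg1 hh hh1
    rcases le_total (∫ x in E, divergence g x) 0 with h0 | h0
    · rw [ENNReal.ofReal_of_nonpos h0, zero_add]
      exact (ENNReal.ofReal_le_ofReal (le_abs_self _)).trans
        (le_perimeter (hh.mono subset_union_right) hh1)
    rcases le_total (∫ x in E, divergence h x) 0 with h0' | h0'
    · rw [ENNReal.ofReal_of_nonpos h0', add_zero]
      exact (ENNReal.ofReal_le_ofReal (le_abs_self _)).trans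
        (le_perimeter (hg.mono subset_union_left) hg1)
    rw [← ENNReal.ofReal_add h0 h0', ← hg.integral_add hh]
    refine (ENNReal.ofReal_le_ofReal (le_abs_self _)).trans
      (le_perimeter ((hg.mono subset_union_left).add (hh.mono subset_union_right)) fun x => ?_)
    by_cases hx : x ∈ U
    · rw [hh.eq_zero fun hx' => disjoint_left.1 hd hx hx', add_zero]
      exact hg1 x
    · rw [hg.eq_zero hx, zero_add]
      exact hh1 x
  -- The two suprema are taken one at a time: the summand that stays fixed is moved across by
  -- subtraction, which requires it to be finite.
  have key2 : ∀ g, IsTestField U g → (∀ x, ‖g x‖ ≤ 1) →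
      ENNReal.ofReal (∫ x in E, divergence g x) + perimeter E V ≤ perimeter E (U ∪ V) := by
    intro g hg hg1
    have h1 : perimeter E V ≤ perimeter E (U ∪ V) - ENNReal.ofReal (∫ x in E, divergence g x) :=
      perimeter_le fun h hh hh1 =>
        ENNReal.le_sub_of_add_le_left ENNReal.ofReal_ne_top (key g h hg hg1 hh hh1)
    refine (add_le_add_right h1 _).trans (add_tsub_cancel_of_le ?_).le
    exact (ENNReal.ofReal_le_ofReal (le_abs_self _)).trans
        (le_perimeter (hg.mono subset_union_left) hg1)
  by_cases hV : perimeter E V = ⊤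
  · have : perimeter E (U ∪ V) = ⊤ := top_le_iff.1 (hV ▸ perimeter_mono subset_union_right)
    rw [this]
    exact le_top
  · have h1 : perimeter E U ≤ perimeter E (U ∪ V) - perimeter E V :=
      perimeter_le fun g hg hg1 => ENNReal.le_sub_of_add_le_right hV (key2 g hg hg1)
    exact (add_le_add_left h1 _).trans
      (tsub_add_cancel_of_le (perimeter_mono subset_union_right)).le

/-- The infimum of the relative perimeters of `E` in the open neighbourhoods of `K`, inside `Ω`. -/
noncomputable def outerPerimeter {n : ℕ} (E Ω K : Set (Euc n)) : ℝ≥0∞ :=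
  ⨅ (U : Set (Euc n)) (_ : IsOpen U) (_ : K ⊆ U), perimeter E (U ∩ Ω)

lemma outerPerimeter_le {K U : Set (Euc n)} (hU : IsOpen U) (hK : K ⊆ U) :
    outerPerimeter E Ω K ≤ perimeter E (U ∩ Ω) :=
  iInf_le_of_le U <| iInf_le_of_le hU <| iInf_le_of_le hK le_rfl

lemma le_outerPerimeter {K : Set (Euc n)} {c : ℝ≥0∞}
    (h : ∀ U, IsOpen U → K ⊆ U → c ≤ perimeter E (U ∩ Ω)) : c ≤ outerPerimeter E Ω K :=
  le_iInf fun U => le_iInf fun hU => le_iInf fun hK => h U hU hK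

lemma outerPerimeter_le_perimeter (K : Set (Euc n)) : outerPerimeter E Ω K ≤ perimeter E Ω :=
  (outerPerimeter_le isOpen_univ (subset_univ K)).trans (perimeter_mono inter_subset_right)

lemma outerPerimeter_mono {K L : Set (Euc n)} (h : K ⊆ L) :
    outerPerimeter E Ω K ≤ outerPerimeter E Ω L :=
  le_outerPerimeter fun _ hU hL => outerPerimeter_le hU (h.trans hL)

lemma outerPerimeter_union_le (hΩ : IsOpen Ω) (K L : Set (Euc n)) :
    outerPerimeter E Ω (K ∪ L) ≤ outerPerimeter E Ω K + outerPerimeter E Ω L := by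
  conv_rhs => unfold outerPerimeter
  simp only [ENNReal.iInf_add, ENNReal.add_iInf]
  refine le_iInf fun V => le_iInf fun hV => le_iInf fun hLV => le_iInf fun U => le_iInf fun hU =>
    le_iInf fun hKU => ?_
  refine (outerPerimeter_le (hU.union hV) (union_subset_union hKU hLV)).trans ?_
  rw [union_inter_distrib_right]
  exact perimeter_union_le (hU.inter hΩ) (hV.inter hΩ)

lemma outerPerimeter_union_of_disjoint {K L : Set (Euc n)} (hK : IsCompact K)
    (hL : IsCompact L) (hd : Disjoint K L) :
    outerPerimeter E Ω K + outerPerimeter E Ω L ≤ outerPerimeter E Ω (K ∪ L) := by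
  refine le_outerPerimeter fun U hU hKL => ?_
  obtain ⟨V, W, hV, hW, hKV, hLW, hVW⟩ := SeparatedNhds.of_isCompact_isCompact hK hL hd
  have h1 := perimeter_add_le_of_disjoint (E := E) (U := V ∩ U ∩ Ω) (V := W ∩ U ∩ Ω)
    (hVW.mono (fun x hx => hx.1.1) (fun x hx => hx.1.1))
  refine (add_le_add (outerPerimeter_le (hV.inter hU) (subset_inter hKV fun x hx => hKL (.inl hx)))
    (outerPerimeter_le (hW.inter hU) (subset_inter hLW fun x hx => hKL (.inr hx)))).trans
    (h1.trans (perimeter_mono ?_))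
  rintro x (hx | hx)
  exacts [⟨hx.1.2, hx.2⟩, ⟨hx.1.2, hx.2⟩]

/-- The relative perimeter extends from the open sets to a Borel measure. -/
theorem exists_perimeterMeasure (hΩ : IsOpen Ω) (hfin : perimeter E Ω ≠ ⊤) :
    ∃ μ : Measure (Euc n), ∀ U, IsOpen U → μ U = perimeter E (U ∩ Ω) := by
  have hne : ∀ K, outerPerimeter E Ω K ≠ ⊤ := fun K =>
    ((outerPerimeter_le_perimeter K).trans_lt hfin.lt_top).ne
  -- On compact sets the outer values are additive for disjoint pairs and subadditive, so they form
  -- a content.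
  let ν : Content (Euc n) :=
    { toFun := fun K => (outerPerimeter E Ω K).toNNReal
      mono' := fun K L h => ENNReal.toNNReal_mono (hne _) (outerPerimeter_mono h)
      sup_disjoint' := fun K L hd _ _ => by
        rw [← ENNReal.toNNReal_add (hne _) (hne _), TopologicalSpace.Compacts.coe_sup,
          le_antisymm (outerPerimeter_union_le hΩ K L)
            (outerPerimeter_union_of_disjoint K.isCompact L.isCompact hd)]
      sup_le' := fun K L => by
        rw [← ENNReal.toNNReal_add (hne _) (hne _), TopologicalSpace.Compacts.coe_sup]
        exact ENNReal.toNNReal_mono (ENNReal.add_ne_top.2 ⟨hne _, hne _⟩)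
          (outerPerimeter_union_le hΩ K L) }
  have hν : ∀ K : TopologicalSpace.Compacts (Euc n), (ν K : ℝ≥0∞) = outerPerimeter E Ω K :=
    fun K => ENNReal.coe_toNNReal (hne _)
  refine ⟨ν.measure, fun U hU => ?_⟩
  rw [Content.measure_apply _ hU.measurableSet, Content.outerMeasure_of_isOpen _ _ hU,
    Content.innerContent]
  refine le_antisymm (iSup_le fun K => iSup_le fun hK => ?_) (perimeter_le fun g hg h1 => ?_)
  · rw [hν]
    exact outerPerimeter_le hU hK
  -- The support of a test field is the compact set to use: the field remains admissible in every
  -- neighbourhood of it.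
  · refine le_iSup_of_le ⟨tsupport g, hg.2⟩ (le_iSup_of_le (fun x hx => (hg.3 hx).1) ?_)
    rw [hν]
    refine le_outerPerimeter fun V _ hKV => ?_
    exact (ENNReal.ofReal_le_ofReal (le_abs_self _)).trans
      (le_perimeter ⟨hg.1, hg.2, fun x hx => ⟨hKV hx, (hg.3 hx).2⟩⟩ h1)

end Perimeter

/-! ### A smooth radial truncation of vectors -/

section SoftThreshold

/-- A convex `C¹` regularization of the positive part. -/
noncomputable def softPos (u : ℝ) : ℝ := max u 0 ^ 2 / (1 + max u 0)

lemma softPos_of_nonpos {u : ℝ} (hu : u ≤ 0) : softPos u = 0 := by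
  simp [softPos, max_eq_right hu]

lemma softPos_of_nonneg {u : ℝ} (hu : 0 ≤ u) : softPos u = u ^ 2 / (1 + u) := by
  simp [softPos, max_eq_left hu]

lemma continuous_softPos : Continuous softPos := by
  unfold softPos
  refine Continuous.div (by fun_prop) (by fun_prop) fun u => ?_
  positivity

lemma hasDerivAt_softPos (u : ℝ) : HasDerivAt softPos (1 - 1 / (1 + max u 0) ^ 2) u := by
  have hne : ∀ y : ℝ, y ≠ 0 → HasDerivAt softPos (1 - 1 / (1 + max y 0) ^ 2) y := by
    intro y hy
    rcases lt_or_gt_of_ne hy with h | h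
    · rw [max_eq_right h.le]
      have : softPos =ᶠ[𝓝 y] fun _ => 0 := by
        filter_upwards [Iio_mem_nhds h] with z hz
        exact softPos_of_nonpos (le_of_lt hz)
      simpa using (hasDerivAt_const y (0 : ℝ)).congr_of_eventuallyEq this
    · rw [max_eq_left h.le]
      have : softPos =ᶠ[𝓝 y] fun z => z ^ 2 / (1 + z) := by
        filter_upwards [Ioi_mem_nhds h] with z hz
        exact softPos_of_nonneg (le_of_lt hz)
      have h1 : (1 + y) ≠ 0 := by positivity
      have hd := ((hasDerivAt_pow 2 y).div ((hasDerivAt_id y).const_add 1) h1)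
      refine (hd.congr_of_eventuallyEq this).congr_deriv ?_
      simp only [id]
      field_simp
      ring
  have hc : Continuous fun y : ℝ => 1 - 1 / (1 + max y 0) ^ 2 := by
    refine continuous_const.sub (Continuous.div continuous_const (by fun_prop) fun y => ?_)
    positivity
  by_cases hu : u = 0
  · subst hu
    exact hasDerivAt_of_hasDerivAt_of_ne (fun y hy => hne y hy) continuous_softPos.continuousAt
      hc.continuousAt
  · exact hne u hu

lemma contDiff_softPos : ContDiff ℝ 1 softPos := by
  rw [contDiff_one_iff_deriv]
  refine ⟨fun u => (hasDerivAt_softPos u).differentiableAt, ?_⟩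
  rw [funext fun u => (hasDerivAt_softPos u).deriv]
  refine continuous_const.sub (Continuous.div continuous_const (by fun_prop) fun y => ?_)
  positivity

lemma monotone_softPos : Monotone softPos := by
  refine monotone_of_deriv_nonneg (fun u => (hasDerivAt_softPos u).differentiableAt) fun u => ?_
  rw [(hasDerivAt_softPos u).deriv, sub_nonneg, div_le_one (by positivity)]
  have : 0 ≤ max u 0 := le_max_right _ _
  nlinarith

lemma softPos_sub_le (u : ℝ) : softPos u - softPos (u - 1) ≤ 1 := by
  have hmono : Monotone fun u => u - softPos u := by
    refine monotone_of_deriv_nonneg (fun u =>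
      ((hasDerivAt_id u).sub (hasDerivAt_softPos u)).differentiableAt) fun u => ?_
    have : deriv (fun u => u - softPos u) u = _ := ((hasDerivAt_id u).sub (hasDerivAt_softPos u)).deriv
    rw [this]
    have : 0 ≤ 1 / (1 + max u 0) ^ 2 := by positivity
    linarith
  have := hmono (show u - 1 ≤ u by linarith)
  simp only at this
  linarith

lemma softPos_le {u : ℝ} (hu : 0 ≤ u) : softPos u ≤ u := by
  rw [softPos_of_nonneg hu, div_le_iff₀ (by positivity)]
  nlinarith

lemma sub_one_le_softPos (u : ℝ) : u - 1 ≤ softPos u := by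
  rcases le_total u 0 with hu | hu
  · rw [softPos_of_nonpos hu]
    linarith
  · rw [softPos_of_nonneg hu, le_div_iff₀ (by positivity)]
    nlinarith

variable {V : Type*} [NormedAddCommGroup V] [InnerProductSpace ℝ V]

/-- The radial soft thresholding at level `k`. -/
noncomputable def softThreshold (k : ℝ) (v : V) : V := (softPos (‖v‖ - k) / ‖v‖) • v

lemma softThreshold_eq_zero {k : ℝ} {v : V} (h : ‖v‖ ≤ k) : softThreshold k v = 0 := by
  simp [softThreshold, softPos_of_nonpos (sub_nonpos.2 h)]

lemma contDiff_softThreshold {k : ℝ} (hk : 0 < k) : ContDiff ℝ 1 (softThreshold k : V → V) := by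
  rw [contDiff_iff_contDiffAt]
  intro v
  by_cases hv : v = 0
  · subst hv
    refine (contDiffAt_const (c := (0 : V))).congr_of_eventuallyEq ?_
    filter_upwards [Metric.ball_mem_nhds (0 : V) hk] with w hw
    exact softThreshold_eq_zero (le_of_lt (by simpa using hw))
  · have h1 : ContDiffAt ℝ 1 (fun w : V => ‖w‖) v := contDiffAt_norm ℝ hv
    exact ((contDiff_softPos.contDiffAt.comp v (h1.sub contDiffAt_const)).div h1
      (norm_ne_zero_iff.2 hv)).smul contDiffAt_id

/-- Differences of consecutive thresholds are the layers of a C¹ layer cake decomposition. The bound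
holds because `softPos` is nondecreasing with slope at most 1. -/
lemma norm_softThreshold_sub_le (k : ℝ) (v : V) :
    ‖softThreshold k v - softThreshold (k + 1) v‖ ≤ 1 := by
  by_cases hv : v = 0
  · simp [hv, softThreshold]
  rw [softThreshold, softThreshold, ← sub_smul, norm_smul, ← sub_div, norm_div, norm_norm,
    div_mul_cancel₀ _ (norm_ne_zero_iff.2 hv), Real.norm_eq_abs, abs_le]
  have h1 := softPos_sub_le (‖v‖ - k)
  have h2 := monotone_softPos (show ‖v‖ - (k + 1) ≤ ‖v‖ - k by linarith)
  rw [show ‖v‖ - k - 1 = ‖v‖ - (k + 1) by ring] at h1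
  exact ⟨by linarith, h1⟩

lemma norm_sub_softThreshold_le (v : V) : ‖v - softThreshold 1 v‖ ≤ 2 := by
  by_cases hv : v = 0
  · simp [hv, softThreshold]
  have hv' : ‖v‖ ≠ 0 := norm_ne_zero_iff.2 hv
  have : v - softThreshold 1 v = ((‖v‖ - softPos (‖v‖ - 1)) / ‖v‖) • v := by
    rw [softThreshold, sub_div, div_self hv', sub_smul, one_smul]
  rw [this, norm_smul, norm_div, norm_norm, div_mul_cancel₀ _ hv', Real.norm_eq_abs, abs_le]
  have h1 := sub_one_le_softPos (‖v‖ - 1)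
  have h2 : softPos (‖v‖ - 1) ≤ ‖v‖ :=
    (monotone_softPos (show ‖v‖ - 1 ≤ ‖v‖ by linarith)).trans (softPos_le (norm_nonneg v))
  exact ⟨by linarith, by linarith⟩

end SoftThreshold

/-! ### The total variation inequality for the perimeter measure -/

section PerimeterMeasure

variable {n : ℕ} {E Ω : Set (Euc n)} {μ : Measure (Euc n)}

/-- `μ` is the perimeter measure of `E` in `Ω`. -/
structure IsPerimeterMeasure (E Ω : Set (Euc n)) (μ : Measure (Euc n)) : Prop where
  isOpen : IsOpen Ω
  measure_eq : ∀ U, IsOpen U → μ U = perimeter E (U ∩ Ω)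
  ne_top : μ univ ≠ ⊤

namespace IsPerimeterMeasure

lemma isFiniteMeasure (h : IsPerimeterMeasure E Ω μ) : IsFiniteMeasure μ := ⟨h.ne_top.lt_top⟩

lemma measure_univ (h : IsPerimeterMeasure E Ω μ) : μ univ = perimeter E Ω := by
  rw [h.measure_eq _ isOpen_univ, univ_inter]

lemma integral_le_measureReal (h : IsPerimeterMeasure E Ω μ) {U : Set (Euc n)} (hU : IsOpen U)
    {g : Euc n → Euc n} (hg : IsTestField (U ∩ Ω) g) (h1 : ∀ x, ‖g x‖ ≤ 1) :
    ∫ x in E, divergence g x ≤ μ.real U := by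
  have := h.isFiniteMeasure
  refine (le_abs_self _).trans ?_
  rw [Measure.real, ← ENNReal.ofReal_le_iff_le_toReal (measure_ne_top _ _), h.measure_eq U hU]
  exact le_perimeter hg h1

lemma integral_le_mul (h : IsPerimeterMeasure E Ω μ) {g : Euc n → Euc n} (hg : IsTestField Ω g)
    {c : ℝ} (hc : 0 < c) (h1 : ∀ x, ‖g x‖ ≤ c) :
    ∫ x in E, divergence g x ≤ c * μ.real univ := by
  have h2 := h.integral_le_measureReal isOpen_univ (g := fun x => c⁻¹ • g x)
    (by rw [univ_inter]; exact hg.smul contDiff_const) (fun x => by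
      rw [norm_smul, norm_inv, Real.norm_of_nonneg hc.le, inv_mul_le_iff₀ hc, mul_one]
      exact h1 x)
  rw [hg.integral_const_smul, inv_mul_le_iff₀ hc] at h2
  exact h2

/-- Layer cake: each layer of g has norm at most 1 and support in {|g| > k}, so it contributes at
most μ{|g| > k}. The sum over k is at most ∫ ⌈|g|⌉ dμ, hence at most ∫ (|g| + 1) dμ. The part of g
below the first threshold adds 2 μ(univ). -/
lemma integral_divergence_le_aux (h : IsPerimeterMeasure E Ω μ) {g : Euc n → Euc n}
    (hg : IsTestField Ω g) :
    ∫ x in E, divergence g x ≤ ∫ x, ‖g x‖ ∂μ + 3 * μ.real univ := by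
  have := h.isFiniteMeasure
  have hp : ∀ k : ℝ, 0 < k → IsTestField Ω fun x => softThreshold k (g x) := fun k hk =>
    ⟨(contDiff_softThreshold (V := Euc n) hk).comp hg.1, hg.2.comp_left (g := softThreshold k) (by simp [softThreshold]),
      (closure_mono fun x hx => by
        contrapose! hx
        simp [Function.notMem_support.1 hx, softThreshold]).trans hg.3⟩
  -- The shift to level k + 1 keeps thresholds positive, where the truncation is C¹, and puts the
  -- closed support of a layer inside the open set {k < |g|}.
  set l : ℕ → ℝ := fun k => ∫ x in E, divergence (fun x => softThreshold (k + 1 : ℝ) (g x)) x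
    with hl
  have hstep : ∀ k : ℕ, l k - l (k + 1) ≤ μ.real {x | (k : ℝ) < ‖g x‖} := by
    intro k
    have hP1 := hp (k + 1) (by positivity)
    have hP2 := hp ((k + 1 : ℕ) + 1) (by positivity)
    have hsub : IsTestField Ω fun x => softThreshold (k + 1 : ℝ) (g x)
        + (-1 : ℝ) • softThreshold ((k + 1 : ℕ) + 1 : ℝ) (g x) :=
      hP1.add (hP2.smul contDiff_const)
    have heq : l k - l (k + 1) = ∫ x in E, divergence (fun x => softThreshold (k + 1 : ℝ) (g x)
        + (-1 : ℝ) • softThreshold ((k + 1 : ℕ) + 1 : ℝ) (g x)) x := by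
      rw [hP1.integral_add (hP2.smul contDiff_const), hP2.integral_const_smul]
      simp only [hl]
      ring
    rw [heq]
    refine h.integral_le_measureReal (isOpen_lt continuous_const hg.continuous.norm)
      ⟨hsub.1, hsub.2, fun x hx => ⟨?_, hsub.3 hx⟩⟩ fun x => ?_
    · have hcl : IsClosed {x | (k + 1 : ℝ) ≤ ‖g x‖} := isClosed_le continuous_const
        hg.continuous.norm
      have : x ∈ {x | (k + 1 : ℝ) ≤ ‖g x‖} := by
        refine closure_minimal (fun y hy => ?_) hcl hx
        by_contra hlt
        rw [mem_ofPred_eq, not_le] at hlt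
        refine hy ?_
        simp only
        rw [softThreshold_eq_zero hlt.le, softThreshold_eq_zero, smul_zero, add_zero]
        push_cast
        linarith
      simp only [mem_ofPred_eq] at this ⊢
      linarith
    · have := norm_softThreshold_sub_le (k + 1 : ℝ) (g x)
      rw [sub_eq_add_neg] at this
      simpa using this
  obtain ⟨M, hM⟩ := hg.2.exists_bound_of_continuous hg.continuous
  obtain ⟨N, hN⟩ := exists_nat_ge M
  have hlN : l N = 0 := by
    have : (fun x => softThreshold (N + 1 : ℝ) (g x)) = fun _ => 0 := by
      funext x
      exact softThreshold_eq_zero (by linarith [hM x])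
    simp only [hl, this]
    simp [divergence]
  have hl0 : l 0 ≤ ∫ x, ‖g x‖ ∂μ + μ.real univ := by
    have h1 : l 0 = ∑ k ∈ Finset.range N, (l k - l (k + 1)) := by
      rw [Finset.sum_range_sub', hlN, sub_zero]
    have hmeas : ∀ k : ℕ, MeasurableSet {x | (k : ℝ) < ‖g x‖} := fun k =>
      (isOpen_lt continuous_const hg.continuous.norm).measurableSet
    have hgi : Integrable (fun x => ‖g x‖) μ :=
      (hg.continuous.integrable_of_hasCompactSupport hg.2).norm
    have h2 : ∑ k ∈ Finset.range N, μ.real {x | (k : ℝ) < ‖g x‖}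
        = ∫ x, ∑ k ∈ Finset.range N, {x | (k : ℝ) < ‖g x‖}.indicator (fun _ => (1 : ℝ)) x ∂μ := by
      rw [integral_finsetSum _ fun k _ => (integrable_const (1 : ℝ)).indicator (hmeas k)]
      refine Finset.sum_congr rfl fun k _ => ?_
      rw [integral_indicator (hmeas k)]
      simp
    rw [h1]
    refine (Finset.sum_le_sum fun k _ => hstep k).trans ?_
    rw [h2]
    have h3 : ∫ x, ‖g x‖ ∂μ + μ.real univ = ∫ x, (‖g x‖ + 1) ∂μ := by
      rw [MeasureTheory.integral_add hgi (integrable_const _)]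
      simp
    rw [h3]
    refine integral_mono (integrable_finsetSum _ fun k _ =>
      (integrable_const (1 : ℝ)).indicator (hmeas k)) (hgi.add (integrable_const _)) fun x => ?_
    have h4 : ∑ k ∈ Finset.range N, {x | (k : ℝ) < ‖g x‖}.indicator (fun _ => (1 : ℝ)) x
        = ((Finset.range N).filter fun k : ℕ => (k : ℝ) < ‖g x‖).card := by
      simp [indicator_apply]
    have h5 : ((Finset.range N).filter fun k : ℕ => (k : ℝ) < ‖g x‖) ⊆
        Finset.range ⌈‖g x‖⌉₊ := by
      intro k hk
      rw [Finset.mem_filter] at hk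
      exact Finset.mem_range.2 (Nat.lt_ceil.2 hk.2)
    have h6 := Finset.card_le_card h5
    rw [Finset.card_range] at h6
    simp only
    rw [h4]
    exact (Nat.cast_le.2 h6).trans (Nat.ceil_lt_add_one (norm_nonneg _)).le
  have hrem : ∫ x in E, divergence (fun x => g x + (-1 : ℝ) • softThreshold (1 : ℝ) (g x)) x
      ≤ 2 * μ.real univ :=
    h.integral_le_mul (hg.add ((hp 1 one_pos).smul contDiff_const)) two_pos fun x => by
      have := norm_sub_softThreshold_le (g x)
      rw [sub_eq_add_neg] at this
      simpa using this
  rw [hg.integral_add ((hp 1 one_pos).smul contDiff_const),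
    (hp 1 one_pos).integral_const_smul] at hrem
  have : l 0 = ∫ x in E, divergence (fun x => softThreshold (1 : ℝ) (g x)) x := by simp [hl]
  linarith

/-- The error 3 μ(univ) does not depend on the size of the field: apply the preceding estimate to c
g, divide by c and let c → ∞. -/
theorem integral_divergence_le (h : IsPerimeterMeasure E Ω μ) {g : Euc n → Euc n}
    (hg : IsTestField Ω g) : ∫ x in E, divergence g x ≤ ∫ x, ‖g x‖ ∂μ := by
  have key : ∀ c : ℝ, 0 < c →
      ∫ x in E, divergence g x ≤ ∫ x, ‖g x‖ ∂μ + 3 * μ.real univ * c⁻¹ := by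
    intro c hc
    have h1 := h.integral_divergence_le_aux (hg.smul (u := fun _ => c) contDiff_const)
    rw [hg.integral_const_smul] at h1
    simp only [norm_smul, Real.norm_of_nonneg hc.le, integral_const_mul] at h1
    have : c * (∫ x in E, divergence g x) ≤ c * (∫ x, ‖g x‖ ∂μ + 3 * μ.real univ * c⁻¹) := by
      refine h1.trans (le_of_eq ?_)
      field_simp
    exact le_of_mul_le_mul_left this hc
  refine ge_of_tendsto (x := atTop) (f := fun c : ℝ => ∫ x, ‖g x‖ ∂μ + 3 * μ.real univ * c⁻¹) ?_
    ((eventually_gt_atTop 0).mono key)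
  simpa using (tendsto_inv_atTop_zero.const_mul (3 * μ.real univ)).const_add (∫ x, ‖g x‖ ∂μ)

end IsPerimeterMeasure

theorem exists_isPerimeterMeasure (hΩ : IsOpen Ω) (hfin : perimeter E Ω ≠ ⊤) :
    ∃ μ, IsPerimeterMeasure E Ω μ := by
  obtain ⟨μ, hμ⟩ := exists_perimeterMeasure hΩ hfin
  refine ⟨μ, hΩ, hμ, ?_⟩
  rwa [hμ _ isOpen_univ, univ_inter]

end PerimeterMeasure

/-! ### Continuous fields with a continuous weak divergence -/

section WeakDivergence

variable {n : ℕ} {E Ω : Set (Euc n)} {μ : Measure (Euc n)}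

/-- `G` is a continuous vector field with compact support in `Ω` whose distributional divergence
is the continuous function `H` with compact support. -/
structure HasWeakDivergence (Ω : Set (Euc n)) (G : Euc n → Euc n) (H : Euc n → ℝ) : Prop where
  continuous_field : Continuous G
  continuous_div : Continuous H
  hasCompactSupport_field : HasCompactSupport G
  hasCompactSupport_div : HasCompactSupport H
  tsupport_subset : tsupport G ⊆ Ω
  integral_eq : ∀ ϕ : Euc n → ℝ, ContDiff ℝ 1 ϕ → HasCompactSupport ϕ →
    ∫ x, ϕ x * H x = - ∫ x, fderiv ℝ ϕ x (G x)

lemma IsTestField.hasWeakDivergence {g : Euc n → Euc n} (hg : IsTestField Ω g) :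
    HasWeakDivergence Ω g (divergence g) :=
  ⟨hg.continuous, continuous_divergence hg.1, hg.2, hasCompactSupport_divergence hg.2, hg.3,
    fun _ hϕ _ => integral_mul_divergence hϕ hg.1 hg.2⟩

lemma HasWeakDivergence.add {G G' : Euc n → Euc n} {H H' : Euc n → ℝ}
    (h : HasWeakDivergence Ω G H) (h' : HasWeakDivergence Ω G' H') :
    HasWeakDivergence Ω (fun x => G x + G' x) (fun x => H x + H' x) := by
  refine ⟨h.1.add h'.1, h.2.add h'.2, h.3.add h'.3, h.4.add h'.4,
    (tsupport_add G G').trans (union_subset h.5 h'.5), fun ϕ hϕ hc => ?_⟩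
  have hf := hϕ.continuous_fderiv one_ne_zero
  have i1 : Integrable fun x => ϕ x * H x :=
    (hϕ.continuous.mul h.2).integrable_of_hasCompactSupport hc.mul_right
  have i2 : Integrable fun x => ϕ x * H' x :=
    (hϕ.continuous.mul h'.2).integrable_of_hasCompactSupport hc.mul_right
  have hcs : ∀ G'' : Euc n → Euc n, HasCompactSupport fun x => fderiv ℝ ϕ x (G'' x) := fun G'' =>
    HasCompactSupport.intro (hc.fderiv ℝ) fun x hx => by
      rw [image_eq_zero_of_notMem_tsupport hx]
      rfl
  have i3 : Integrable fun x => fderiv ℝ ϕ x (G x) :=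
    (hf.clm_apply h.1).integrable_of_hasCompactSupport (hcs G)
  have i4 : Integrable fun x => fderiv ℝ ϕ x (G' x) :=
    (hf.clm_apply h'.1).integrable_of_hasCompactSupport (hcs G')
  simp only [mul_add, map_add]
  rw [integral_add i1 i2, integral_add i3 i4, h.6 ϕ hϕ hc, h'.6 ϕ hϕ hc, neg_add]

/-- The trace of an endomorphism as a continuous linear functional. -/
noncomputable def traceCLM (n : ℕ) : (Euc n →L[ℝ] Euc n) →L[ℝ] ℝ :=
  ∑ i : Fin n, (EuclideanSpace.proj i : Euc n →L[ℝ] ℝ).comp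
    (ContinuousLinearMap.apply ℝ (Euc n) (EuclideanSpace.single i (1 : ℝ)))

lemma traceCLM_apply (l : Euc n →L[ℝ] Euc n) :
    traceCLM n l = ∑ i : Fin n, (l (EuclideanSpace.single i 1)) i := by
  simp [traceCLM]

lemma divergence_eq_traceCLM (g : Euc n → Euc n) (x : Euc n) :
    divergence g x = traceCLM n (fderiv ℝ g x) := (traceCLM_apply _).symm

lemma traceCLM_smulRight (l : Euc n →L[ℝ] ℝ) (v : Euc n) :
    traceCLM n (l.smulRight v) = l v := by
  rw [traceCLM_apply, linearMap_apply_eq_sum l v]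
  simp [mul_comm]

-- The derivative falls on ϕ, and the defining identity of the weak divergence is then tested with t
-- ↦ ϕ(x - t).
open scoped Convolution in
lemma divergence_convolution {ϕ : Euc n → ℝ} (hϕ : ContDiff ℝ 1 ϕ) (hc : HasCompactSupport ϕ)
    {G : Euc n → Euc n} {H : Euc n → ℝ} (h : HasWeakDivergence Ω G H) (x : Euc n) :
    divergence (ϕ ⋆[ContinuousLinearMap.lsmul ℝ ℝ, volume] G) x
      = (ϕ ⋆[ContinuousLinearMap.lsmul ℝ ℝ, volume] H) x := by
  have hd := hc.hasFDerivAt_convolution_left (ContinuousLinearMap.lsmul ℝ ℝ)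
    hϕ (h.1.locallyIntegrable (μ := (volume : Measure (Euc n)))) x
  have hf := hϕ.continuous_fderiv one_ne_zero
  rw [divergence_eq_traceCLM, hd.fderiv, convolution_eq_swap, convolution_eq_swap]
  have hpre : ∀ (l : Euc n →L[ℝ] ℝ) (v : Euc n),
      (((ContinuousLinearMap.lsmul ℝ ℝ : ℝ →L[ℝ] Euc n →L[ℝ] Euc n).precompL (Euc n)) l) v
        = l.smulRight v := by
    intro l v
    ext w
    simp [ContinuousLinearMap.precompL_apply]
  simp only [hpre]
  have hcont : Continuous fun t => (fderiv ℝ ϕ (x - t)).smulRight (G t) :=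
    (ContinuousLinearMap.smulRightL ℝ (Euc n) (Euc n)).continuous₂.comp
      ((hf.comp (continuous_const.sub continuous_id)).prodMk h.1)
  have hint : Integrable fun t => (fderiv ℝ ϕ (x - t)).smulRight (G t) :=
    hcont.integrable_of_hasCompactSupport (HasCompactSupport.intro h.3 fun t ht => by
      rw [image_eq_zero_of_notMem_tsupport ht]
      ext w
      simp)
  rw [← (traceCLM n).integral_comp_comm hint]
  simp only [traceCLM_smulRight]
  have hψ : ContDiff ℝ 1 fun t => ϕ (x - t) := hϕ.comp (contDiff_const.sub contDiff_id)
  have hψc : HasCompactSupport fun t => ϕ (x - t) :=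
    hc.comp_homeomorph (Homeomorph.subLeft x)
  have key := h.6 _ hψ hψc
  have hder : ∀ t v, fderiv ℝ (fun t => ϕ (x - t)) t v = - fderiv ℝ ϕ (x - t) v := by
    intro t v
    have h1 : HasFDerivAt (fun t => ϕ (x - t)) ((fderiv ℝ ϕ (x - t)).comp
        (-ContinuousLinearMap.id ℝ (Euc n))) t :=
      (hϕ.differentiable one_ne_zero (x - t)).hasFDerivAt.comp t ((hasFDerivAt_id t).const_sub x)
    rw [h1.fderiv]
    simp
  simp only [hder, integral_neg, neg_neg] at key
  simp only [ContinuousLinearMap.lsmul_apply, smul_eq_mul]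
  exact key.symm

-- Pulled back fields are only continuous, so they are mollified: field and divergence converge
-- uniformly, with supports in fixed compact sets.
open scoped Convolution in
theorem HasWeakDivergence.integral_le {G : Euc n → Euc n} {H : Euc n → ℝ}
    (h : HasWeakDivergence Ω G H) (hμ : IsPerimeterMeasure E Ω μ) :
    ∫ x in E, H x ≤ ∫ x, ‖G x‖ ∂μ := by
  have := hμ.isFiniteMeasure
  set K := Metric.cthickening 1 (tsupport H) with hK
  have hKc : IsCompact K := h.4.cthickening
  set C := μ.real univ + volume.real K with hC
  have key : ∀ ε : ℝ, 0 < ε → ∫ x in E, H x ≤ ∫ x, ‖G x‖ ∂μ + C * ε := by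
    intro ε hε
    obtain ⟨δ₁, hδ₁, hG⟩ := Metric.uniformContinuous_iff.1
      (h.1.uniformContinuous_of_tendsto_cocompact h.3.is_zero_at_infty) ε hε
    obtain ⟨δ₂, hδ₂, hH⟩ := Metric.uniformContinuous_iff.1
      (h.2.uniformContinuous_of_tendsto_cocompact h.4.is_zero_at_infty) ε hε
    obtain ⟨δ₃, hδ₃, hsub⟩ := h.3.isCompact.exists_cthickening_subset_open hμ.isOpen h.5
    -- δ₁ and δ₂ control the errors in G and H, δ₃ keeps the mollified support inside Ω, and 1 keeps
    -- the support of H' inside the fixed set K.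
    set δ := min (min δ₁ δ₂) (min δ₃ 1) with hδ
    have hδ0 : 0 < δ := by positivity
    let φ : ContDiffBump (0 : Euc n) := ⟨δ / 2, δ, by positivity, by linarith⟩
    set ϕ := φ.normed volume with hϕdef
    have hϕ : ContDiff ℝ 1 ϕ := φ.contDiff_normed
    have hϕc : HasCompactSupport ϕ := φ.hasCompactSupport_normed
    have hsupp : Function.support ϕ = Metric.ball 0 δ := φ.support_normed_eq
    set G' : Euc n → Euc n := ϕ ⋆[ContinuousLinearMap.lsmul ℝ ℝ, volume] G with hG'
    set H' : Euc n → ℝ := ϕ ⋆[ContinuousLinearMap.lsmul ℝ ℝ, volume] H with hH'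
    have hclose : ∀ x, dist (G' x) (G x) ≤ ε := fun x =>
      φ.dist_normed_convolution_le h.1.aestronglyMeasurable fun y hy =>
        (hG (lt_of_lt_of_le hy ((min_le_left _ _).trans (min_le_left _ _)))).le
    have hclose' : ∀ x, dist (H' x) (H x) ≤ ε := fun x =>
      φ.dist_normed_convolution_le h.2.aestronglyMeasurable fun y hy =>
        (hH (lt_of_lt_of_le hy ((min_le_left _ _).trans (min_le_right _ _)))).le
    have hsuppF : ∀ {F : Type} [NormedAddCommGroup F] [NormedSpace ℝ F] (f : Euc n → F),
        Function.support (ϕ ⋆[ContinuousLinearMap.lsmul ℝ ℝ, volume] f)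
          ⊆ Metric.cthickening δ (tsupport f) := by
      intro F _ _ f x hx
      obtain ⟨a, ha, b, hb, rfl⟩ := support_convolution_subset (ContinuousLinearMap.lsmul ℝ ℝ) hx
      rw [hsupp] at ha
      refine Metric.mem_cthickening_of_dist_le _ b _ _ (subset_tsupport f hb) ?_
      rw [dist_eq_norm, add_sub_cancel_right]
      exact (mem_ball_zero_iff.1 ha).le
    have htsF : tsupport G' ⊆ Metric.cthickening δ (tsupport G) :=
      closure_minimal (hsuppF G) Metric.isClosed_cthickening
    have hfield : IsTestField Ω G' :=
      ⟨hϕc.contDiff_convolution_left _ hϕ h.1.locallyIntegrable,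
        h.3.cthickening.of_isClosed_subset (isClosed_tsupport _) htsF,
        htsF.trans ((Metric.cthickening_mono
          ((min_le_right _ _).trans (min_le_left _ _)) _).trans hsub)⟩
    have hdiv : ∀ x, divergence G' x = H' x := divergence_convolution hϕ hϕc h
    have h1 := hμ.integral_divergence_le hfield
    have i1 : Integrable (fun x => ‖G x‖) μ :=
      (h.1.integrable_of_hasCompactSupport h.3).norm
    have h2 : ∫ x, ‖G' x‖ ∂μ ≤ ∫ x, ‖G x‖ ∂μ + μ.real univ * ε := by
      have : ∫ x, ‖G x‖ ∂μ + μ.real univ * ε = ∫ x, (‖G x‖ + ε) ∂μ := by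
        rw [integral_add i1 (integrable_const _)]
        simp
      rw [this]
      refine integral_mono (hfield.continuous.integrable_of_hasCompactSupport hfield.2).norm
        (i1.add (integrable_const _)) fun x => ?_
      have h3 := norm_sub_norm_le (G' x) (G x)
      have h4 := hclose x
      rw [dist_eq_norm] at h4
      simp only
      linarith
    have hH'c : Continuous H' := by
      rw [show H' = divergence G' from (funext hdiv).symm]
      exact continuous_divergence hfield.1
    have hH'K : ∀ x, x ∉ K → H' x = 0 := by
      intro x hx
      by_contra h0
      exact hx (Metric.cthickening_mono ((min_le_right _ _).trans (min_le_right _ _)) _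
        (hsuppF H h0))
    have hHK : ∀ x, x ∉ K → H x = 0 := fun x hx =>
      image_eq_zero_of_notMem_tsupport fun h0 => hx (Metric.self_subset_cthickening _ h0)
    have i2 : Integrable H := h.2.integrable_of_hasCompactSupport h.4
    have i3 : Integrable H' := hH'c.integrable_of_hasCompactSupport
      (HasCompactSupport.intro hKc hH'K)
    have h5 : ∫ x in E, H x ≤ (∫ x in E, H' x) + volume.real K * ε := by
      have hKm : MeasurableSet K := hKc.isClosed.measurableSet
      have i4 : Integrable (K.indicator fun _ => ε) :=
        (integrable_indicator_iff hKm).2 (integrableOn_const hKc.measure_lt_top.ne)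
      have h6 : ∫ x in E, (H x - H' x) ≤ ∫ x, K.indicator (fun _ => ε) x := by
        refine (setIntegral_mono (i2.sub i3).integrableOn i4.integrableOn fun x => ?_).trans
          (setIntegral_le_integral i4 (ae_of_all _ fun x => indicator_nonneg (fun _ _ => hε.le) x))
        change H x - H' x ≤ _
        by_cases hx : x ∈ K
        · rw [indicator_of_mem hx]
          have := hclose' x
          rw [Real.dist_eq, abs_le] at this
          linarith [this.1]
        · rw [indicator_of_notMem hx, hHK x hx, hH'K x hx, sub_zero]
      rw [integral_sub i2.integrableOn i3.integrableOn, integral_indicator hKm] at h6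
      simp only [integral_const, measureReal_restrict_apply MeasurableSet.univ, univ_inter,
        smul_eq_mul] at h6
      linarith
    simp only [hdiv] at h1
    rw [hC]
    linarith
  refine ge_of_tendsto (x := 𝓝[>] (0 : ℝ)) (f := fun ε => ∫ x, ‖G x‖ ∂μ + C * ε) ?_
    (eventually_mem_nhdsWithin.mono key)
  have : Tendsto (fun ε : ℝ => ∫ x, ‖G x‖ ∂μ + C * ε) (𝓝 0) (𝓝 (∫ x, ‖G x‖ ∂μ + C * 0)) :=
    Continuous.tendsto (by fun_prop) 0
  simpa using this.mono_left nhdsWithin_le_nhds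

end WeakDivergence

/-! ### Change of variables and the Piola transform -/

section ChangeOfVariables

variable {n : ℕ} {E Ω : Set (Euc n)}

/-- `S` is a `C¹` diffeomorphism of the space with inverse `S'`. -/
structure IsC1Inverse (S S' : Euc n → Euc n) : Prop where
  left_inv : Function.LeftInverse S' S
  right_inv : Function.RightInverse S' S
  contDiff : ContDiff ℝ 1 S
  contDiff_inv : ContDiff ℝ 1 S'

namespace IsC1Inverse

variable {S S' T T' : Euc n → Euc n}

lemma symm (h : IsC1Inverse S S') : IsC1Inverse S' S := ⟨h.2, h.1, h.4, h.3⟩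

lemma comp (h : IsC1Inverse S S') (h' : IsC1Inverse T T') :
    IsC1Inverse (S ∘ T) (T' ∘ S') :=
  ⟨fun x => by simp [h.1 _, h'.1 x], fun x => by simp [h'.2 _, h.2 x], h.3.comp h'.3,
    h'.4.comp h.4⟩

lemma hasFDerivAt (h : IsC1Inverse S S') (x : Euc n) : HasFDerivAt S (fderiv ℝ S x) x :=
  (h.3.differentiable one_ne_zero x).hasFDerivAt

lemma fderiv_inv_apply (h : IsC1Inverse S S') (x v : Euc n) :
    fderiv ℝ S' (S x) (fderiv ℝ S x v) = v := by
  have h1 : HasFDerivAt (S' ∘ S) ((fderiv ℝ S' (S x)).comp (fderiv ℝ S x)) x :=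
    (h.symm.hasFDerivAt (S x)).comp x (h.hasFDerivAt x)
  have h2 : S' ∘ S = id := funext h.1
  rw [h2] at h1
  exact congrArg (fun l : Euc n →L[ℝ] Euc n => l v) (h1.unique (hasFDerivAt_id x))

lemma fderiv_apply_inv (h : IsC1Inverse S S') (x v : Euc n) :
    fderiv ℝ S x (fderiv ℝ S' (S x) v) = v := by
  have := h.symm.fderiv_inv_apply (S x) v
  rwa [h.1 x] at this

lemma range_eq (h : IsC1Inverse S S') : S '' univ = univ := by
  rw [image_univ]
  exact h.2.surjective.range_eq

lemma integral_comp (h : IsC1Inverse S S') (f : Euc n → ℝ) :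
    ∫ y, f y = ∫ x, |(fderiv ℝ S x).det| * f (S x) := by
  have := integral_image_eq_integral_abs_det_fderiv_smul (volume : Measure (Euc n))
    MeasurableSet.univ (fun x _ => (h.hasFDerivAt x).hasFDerivWithinAt)
    h.1.injective.injOn f
  rwa [h.range_eq, setIntegral_univ, setIntegral_univ] at this

lemma nullMeasurableSet_image (h : IsC1Inverse S S') (hE : NullMeasurableSet E volume) :
    NullMeasurableSet (S '' E) volume := by
  obtain ⟨A, hAE, hA, hae⟩ := hE.exists_measurable_subset_ae_eq
  have h1 : S '' E = S '' A ∪ S '' (E \ A) := by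
    rw [← image_union, union_sdiff_cancel hAE]
  have h2 : volume (E \ A) = 0 := ae_le_set.1 hae.symm.le
  have h3 : volume (S '' (E \ A)) = 0 :=
    addHaar_image_eq_zero_of_differentiableOn_of_addHaar_eq_zero _
      (h.3.differentiable one_ne_zero).differentiableOn h2
  have h4 : MeasurableSet (S '' A) := by
    have : S '' A = S' ⁻¹' A := by
      rw [image_eq_preimage_of_inverse h.1 h.2]
    rw [this]
    exact h.4.continuous.measurable hA
  rw [h1]
  exact h4.nullMeasurableSet.union (NullMeasurableSet.of_null h3)

lemma setIntegral_image (h : IsC1Inverse S S') (hE : NullMeasurableSet E volume)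
    (f : Euc n → ℝ) :
    ∫ y in S '' E, f y = ∫ x in E, |(fderiv ℝ S x).det| * f (S x) := by
  rw [← integral_indicator₀ (h.nullMeasurableSet_image hE), ← integral_indicator₀ hE,
    h.integral_comp]
  congr 1
  funext x
  by_cases hx : x ∈ E
  · rw [indicator_of_mem hx, indicator_of_mem (mem_image_of_mem S hx)]
  · rw [indicator_of_notMem hx, indicator_of_notMem, mul_zero]
    rwa [h.1.injective.mem_set_image]

lemma continuous_det (h : IsC1Inverse S S') : Continuous fun x => (fderiv ℝ S x).det :=
  ContinuousLinearMap.continuous_det.comp (h.3.continuous_fderiv one_ne_zero)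

lemma hasCompactSupport_comp (h : IsC1Inverse S S') {F : Type*} [Zero F] {f : Euc n → F}
    (hf : HasCompactSupport f) : HasCompactSupport (f ∘ S) :=
  hf.comp_homeomorph ⟨⟨S, S', h.1, h.2⟩, h.3.continuous, h.4.continuous⟩

/-- The pull back of a vector field: if `g` is `C¹`, then its distributional divergence is
`|det DS| (div g) ∘ S`. -/
noncomputable def _root_.pullField (S S' g : Euc n → Euc n) (x : Euc n) : Euc n :=
  |(fderiv ℝ S x).det| • fderiv ℝ S' (S x) (g (S x))

/-- The Piola identity. Its pointwise proof needs second derivatives of S; the weak form needs only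
a change of variables and integration by parts against ϕ ∘ S'. -/
lemma hasWeakDivergence_pullField (h : IsC1Inverse S S') {g : Euc n → Euc n}
    (hg : IsTestField (S '' Ω) g) :
    HasWeakDivergence Ω (pullField S S' g) fun x => |(fderiv ℝ S x).det| * divergence g (S x) := by
  have hcd := h.continuous_det
  have hS := h.3.continuous
  have hd' := h.4.continuous_fderiv one_ne_zero
  have hts : ∀ x, S x ∉ tsupport g → pullField S S' g x = 0 := fun x hx => by
    rw [pullField, image_eq_zero_of_notMem_tsupport hx, map_zero, smul_zero]
  have hsub : tsupport (pullField S S' g) ⊆ S ⁻¹' tsupport g :=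
    closure_minimal (fun x hx => by
      by_contra hx'
      exact hx (hts x hx')) ((isClosed_tsupport g).preimage hS)
  have hpc : IsCompact (S ⁻¹' tsupport g) := by
    rw [← image_eq_preimage_of_inverse h.2 h.1]
    exact hg.2.isCompact.image h.4.continuous
  refine ⟨hcd.abs.smul ((hd'.comp hS).clm_apply (hg.continuous.comp hS)),
    hcd.abs.mul ((continuous_divergence hg.1).comp hS),
    hpc.of_isClosed_subset (isClosed_tsupport _) hsub,
    (h.hasCompactSupport_comp (hasCompactSupport_divergence hg.2)).mul_left,
    fun x hx => ?_, fun ϕ hϕ hc => ?_⟩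
  · obtain ⟨y, hy, hyx⟩ := hg.3 (hsub hx)
    rwa [← h.1.injective hyx]
  · have h1 := h.integral_comp fun y => ϕ (S' y) * divergence g y
    have h2 := h.integral_comp fun y => fderiv ℝ (ϕ ∘ S') y (g y)
    have h3 := integral_mul_divergence (hϕ.comp h.4) hg.1 hg.2
    have h4 : ∀ x, fderiv ℝ (ϕ ∘ S') (S x) (g (S x))
        = fderiv ℝ ϕ x (fderiv ℝ S' (S x) (g (S x))) := by
      intro x
      have hϕ' : HasFDerivAt ϕ (fderiv ℝ ϕ x) (S' (S x)) := by
        rw [h.1 x]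
        exact (hϕ.differentiable one_ne_zero x).hasFDerivAt
      rw [(hϕ'.comp (S x) (h.symm.hasFDerivAt (S x))).fderiv]
      rfl
    simp only [h.1 _] at h1
    simp only [h4] at h2
    simp only [Function.comp_apply] at h3
    simp only [pullField, map_smul, smul_eq_mul]
    rw [← h2, ← h3, h1]
    congr 1
    funext x
    ring

end IsC1Inverse

end ChangeOfVariables

/-! ### Cofactors of rank one updates -/

section LinearAlgebra

variable {n : ℕ}

/-- The image of the unit ball has relative volume |det l| and lies in a ball of radius ‖l‖. -/
lemma abs_det_le_norm_pow (l : Euc n →L[ℝ] Euc n) : |l.det| ≤ ‖l‖ ^ n := by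
  have h1 : volume (l '' Metric.ball 0 1) = ENNReal.ofReal |l.det| * volume (Metric.ball (0 : Euc n) 1) :=
    Measure.addHaar_image_continuousLinearMap volume l _
  have h2 : l '' Metric.ball 0 1 ⊆ Metric.closedBall 0 ‖l‖ := by
    rintro _ ⟨x, hx, rfl⟩
    rw [mem_closedBall_zero_iff]
    exact (l.le_opNorm x).trans (mul_le_of_le_one_right (norm_nonneg _)
      (mem_ball_zero_iff.1 hx).le)
  have h3 := measure_mono (μ := volume) h2
  rw [h1, Measure.addHaar_closedBall _ _ (norm_nonneg _), finrank_euclideanSpace_fin,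
    ENNReal.mul_le_mul_iff_left (Metric.measure_ball_pos _ _ one_pos).ne'
      measure_ball_lt_top.ne] at h3
  exact (ENNReal.ofReal_le_ofReal_iff (by positivity)).1 h3

/-- The endomorphism `a + c x ⊗ x`. -/
noncomputable def rankOneUpdate (a c : ℝ) (x : Euc n) : Euc n →L[ℝ] Euc n :=
  a • ContinuousLinearMap.id ℝ (Euc n) + c • (innerSL ℝ x).smulRight x

lemma rankOneUpdate_apply (a c : ℝ) (x v : Euc n) :
    rankOneUpdate a c x v = a • v + (c * inner ℝ x v) • x := by
  simp [rankOneUpdate, mul_smul]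

lemma det_rankOneUpdate (hn : 1 ≤ n) {a : ℝ} (ha : a ≠ 0) (c : ℝ) (x : Euc n) :
    (rankOneUpdate a c x).det = a ^ (n - 1) * (a + c * ‖x‖ ^ 2) := by
  have h : ((rankOneUpdate a c x : Euc n →L[ℝ] Euc n) : Euc n →ₗ[ℝ] Euc n)
      = a • LinearMap.transvection ((innerSL ℝ x : Euc n →L[ℝ] ℝ) : Euc n →ₗ[ℝ] ℝ) ((c / a) • x) := by
    ext1 v
    simp only [ContinuousLinearMap.coe_coe, rankOneUpdate_apply, LinearMap.smul_apply,
      LinearMap.transvection.apply, innerSL_apply_apply, smul_add, smul_smul]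
    congr 2
    field_simp
  rw [ContinuousLinearMap.det, h, LinearMap.det_smul, LinearMap.transvection.det,
    finrank_euclideanSpace_fin]
  simp only [ContinuousLinearMap.coe_coe, innerSL_apply_apply, inner_smul_right,
    real_inner_self_eq_norm_sq]
  obtain ⟨m, rfl⟩ := Nat.exists_eq_add_of_le' hn
  rw [Nat.add_sub_cancel, pow_succ]
  field_simp

/-- The last term plays the role of (x·ν)². It is discarded for monotonicity and exploited in
`norm_cofactor_add_sq_le` for rigidity. -/
lemma norm_smul_sub_inner_smul_sq (b c : ℝ) (x z : Euc n) :
    ‖b • z - (c * inner ℝ x z) • x‖ ^ 2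
      = b ^ 2 * ‖z‖ ^ 2 - c * (2 * b - c * ‖x‖ ^ 2) * inner ℝ x z ^ 2 := by
  rw [norm_sub_sq_real, norm_smul, norm_smul, inner_smul_left, inner_smul_right,
    real_inner_comm x z, mul_pow, mul_pow, Real.norm_eq_abs, Real.norm_eq_abs, sq_abs, sq_abs]
  simp only [conj_trivial]
  ring

lemma norm_smul_sub_inner_smul_le {b c : ℝ} (hc : 0 ≤ c) (hb : 0 ≤ b) (x z : Euc n)
    (hcb : c * ‖x‖ ^ 2 ≤ b) : ‖b • z - (c * inner ℝ x z) • x‖ ≤ b * ‖z‖ := by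
  refine abs_le_of_sq_le_sq' ?_ (by positivity) |>.2
  rw [norm_smul_sub_inner_smul_sq, mul_pow]
  have : 0 ≤ c * (2 * b - c * ‖x‖ ^ 2) * inner ℝ x z ^ 2 := by
    have h1 : 0 ≤ 2 * b - c * ‖x‖ ^ 2 := by linarith
    positivity
  linarith

/-- The cofactor action of a rank one update. -/
lemma smul_inverse_rankOneUpdate (hn : 2 ≤ n) {a c : ℝ} (x : Euc n)
    {Di : Euc n →L[ℝ] Euc n} (hDi : ∀ v, rankOneUpdate a c x (Di v) = v) (w : Euc n) :
    (a ^ (n - 1) * (a + c * ‖x‖ ^ 2)) • Di w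
      = a ^ (n - 2) • ((a + c * ‖x‖ ^ 2) • w - (c * inner ℝ x w) • x) := by
  have h := hDi w
  rw [rankOneUpdate_apply] at h
  set v := Di w
  have hin : inner ℝ x w = (a + c * ‖x‖ ^ 2) * inner ℝ x v := by
    rw [← h, inner_add_right, inner_smul_right, inner_smul_right, real_inner_self_eq_norm_sq]
    ring
  obtain ⟨m, rfl⟩ := Nat.exists_eq_add_of_le' hn
  rw [show m + 2 - 1 = m + 1 by omega, Nat.add_sub_cancel, hin, ← h, pow_succ]
  simp only [smul_sub, smul_add, smul_smul]
  rw [add_sub_assoc, ← sub_smul]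
  have : a ^ m * ((a + c * ‖x‖ ^ 2) * (c * inner ℝ x v))
      - a ^ m * (c * ((a + c * ‖x‖ ^ 2) * inner ℝ x v)) = 0 := by ring
  rw [this, zero_smul, add_zero]
  congr 1
  ring

/-- Bound for the cofactor matrix of a rank one update conjugated by almost orthogonal maps. -/
lemma norm_cofactor_conj_le (hn : 2 ≤ n) {a c θ ε : ℝ} (ha : 0 < a) (hc : 0 ≤ c)
    (hθ : 0 ≤ θ) (hθ1 : θ ≤ 1 / 2) (hε : 0 ≤ ε) (x : Euc n)
    {B Bi B' Bi' Di : Euc n →L[ℝ] Euc n} (hDi : ∀ v, rankOneUpdate a c x (Di v) = v)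
    (hB : ∀ v, B (Bi v) = v) (hB2 : ∀ v, Bi (B v) = v) (hB' : ∀ v, B' (Bi' v) = v)
    (hB1 : ‖B - ContinuousLinearMap.id ℝ (Euc n)‖ ≤ θ)
    (hB'1 : ‖B' - ContinuousLinearMap.id ℝ (Euc n)‖ ≤ θ)
    (hBB : ‖B' - B‖ ≤ ε) {g : Euc n} (hg : ‖g‖ ≤ 1) :
    ‖|((B'.comp (rankOneUpdate a c x)).comp Bi).det| • B (Di (Bi' g))‖
      ≤ (1 + 2 * ε) ^ (n + 1) * a ^ (n - 2)
        * (a + c * ‖x‖ ^ 2 + 4 * θ * (c * ‖x‖ ^ 2)) := by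
  -- As θ ≤ 1/2, the inverse of a map within θ of the identity has norm at most 2.
  have hinv : ∀ L Li : Euc n →L[ℝ] Euc n, (∀ v, L (Li v) = v) →
      ‖L - ContinuousLinearMap.id ℝ (Euc n)‖ ≤ θ → ∀ v, ‖Li v‖ ≤ 2 * ‖v‖ := by
    intro L Li hL hL1 v
    have h1 : Li v = v - (L - ContinuousLinearMap.id ℝ (Euc n)) (Li v) := by
      simp [hL]
    have h2 : ‖Li v‖ ≤ ‖v‖ + θ * ‖Li v‖ := by
      conv_lhs => rw [h1]
      exact (norm_sub_le _ _).trans (add_le_add_right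
        (ContinuousLinearMap.le_of_opNorm_le _ hL1 _) _)
    nlinarith [norm_nonneg (Li v), norm_nonneg v]
  have hBi := hinv B Bi hB hB1
  have hBi' := hinv B' Bi' hB' hB'1
  set b := a + c * ‖x‖ ^ 2 with hb
  have hv0 : 0 ≤ c * ‖x‖ ^ 2 := by positivity
  have hb0 : 0 < b := by positivity
  have hdet : |((B'.comp (rankOneUpdate a c x)).comp Bi).det|
      = |(B'.comp Bi).det| * (a ^ (n - 1) * b) := by
    have hd := det_rankOneUpdate (by omega : 1 ≤ n) ha.ne' c x
    simp only [ContinuousLinearMap.det, ContinuousLinearMap.toLinearMap_comp, LinearMap.det_comp] at hd ⊢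
    rw [hd, mul_right_comm, abs_mul, abs_of_nonneg (show 0 ≤ a ^ (n - 1) * (a + c * ‖x‖ ^ 2) by
      positivity)]
  -- If B and B' were equal, z would be g. Their difference costs 2ε here, and the same amount in
  -- the norm of B' ∘ B⁻¹.
  set z := B (Bi' g) with hz
  have hz1 : ‖z‖ ≤ 1 + 2 * ε := by
    have h1 : z = g - (B' - B) (Bi' g) := by simp [hz, hB']
    rw [h1]
    refine (norm_sub_le _ _).trans (add_le_add hg ?_)
    refine (ContinuousLinearMap.le_of_opNorm_le _ hBB _).trans ?_
    nlinarith [hBi' g]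
  have hnorm : ‖B'.comp Bi‖ ≤ 1 + 2 * ε := by
    refine ContinuousLinearMap.opNorm_le_bound _ (by positivity) fun v => ?_
    have h1 : (B'.comp Bi) v = v + (B' - B) (Bi v) := by simp [hB]
    rw [h1]
    refine (norm_add_le _ _).trans ?_
    have := ContinuousLinearMap.le_of_opNorm_le _ hBB (Bi v)
    nlinarith [hBi v]
  have hw : Bi' g = Bi z := (hB2 _).symm
  have hcof : (a ^ (n - 1) * b) • B (Di (Bi' g))
      = a ^ (n - 2) • (b • z - (c * inner ℝ x (Bi z)) • B x) := by
    rw [← map_smul, ← map_smul, map_smul Di, smul_inverse_rankOneUpdate hn x hDi, map_smul,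
      map_sub, map_smul, map_smul, ← hw]
  rw [hdet, mul_smul, hcof, norm_smul, norm_smul, Real.norm_of_nonneg (abs_nonneg _),
    Real.norm_of_nonneg (by positivity : (0 : ℝ) ≤ a ^ (n - 2))]
  have hBx : ‖B x - x‖ ≤ θ * ‖x‖ := ContinuousLinearMap.le_of_opNorm_le _ hB1 x
  have hBz : ‖Bi z - z‖ ≤ 2 * θ * ‖z‖ := by
    have h1 : Bi z - z = - Bi ((B - ContinuousLinearMap.id ℝ (Euc n)) z) := by
      simp [hB2]
    rw [h1, norm_neg]
    refine (hBi _).trans ?_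
    have := ContinuousLinearMap.le_of_opNorm_le _ hB1 z
    linarith
  -- Replacing `Bi z` by z costs 2θ · 3/2 = 3θ, and replacing `B x` by x costs θ; together 4θ.
  have hmain : ‖b • z - (c * inner ℝ x (Bi z)) • B x‖ ≤ (b + 4 * θ * (c * ‖x‖ ^ 2)) * ‖z‖ := by
    have h1 : b • z - (c * inner ℝ x (Bi z)) • B x = (b • z - (c * inner ℝ x z) • x)
        - (c * inner ℝ x (Bi z - z)) • B x - (c * inner ℝ x z) • (B x - x) := by
      rw [inner_sub_right]
      module
    have h2 := norm_smul_sub_inner_smul_le hc hb0.le x z (by linarith)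
    have h3 : ‖(c * inner ℝ x (Bi z - z)) • B x‖ ≤ c * (‖x‖ * (2 * θ * ‖z‖)) * (3 / 2 * ‖x‖) := by
      rw [norm_smul, norm_mul, Real.norm_of_nonneg hc]
      have h4 : ‖B x‖ ≤ 3 / 2 * ‖x‖ := by
        have := norm_add_le (B x - x) x
        rw [sub_add_cancel] at this
        nlinarith [norm_nonneg x]
      have h5 := (norm_inner_le_norm (𝕜 := ℝ) x (Bi z - z)).trans
        (mul_le_mul_of_nonneg_left hBz (norm_nonneg x))
      gcongr
    have h6 : ‖(c * inner ℝ x z) • (B x - x)‖ ≤ c * (‖x‖ * ‖z‖) * (θ * ‖x‖) := by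
      rw [norm_smul, norm_mul, Real.norm_of_nonneg hc]
      have h5 := norm_inner_le_norm (𝕜 := ℝ) x z
      gcongr
    rw [h1]
    refine (norm_sub_le _ _).trans ((add_le_add ((norm_sub_le _ _).trans (add_le_add h2 h3)) h6).trans
      (le_of_eq ?_))
    ring
  -- The determinant of `B'.comp Bi` contributes n powers of 1 + 2ε, and the norm of z one more.
  calc |(B'.comp Bi).det| * (a ^ (n - 2) * ‖b • z - (c * inner ℝ x (Bi z)) • B x‖)
      ≤ (1 + 2 * ε) ^ n * (a ^ (n - 2) * ((b + 4 * θ * (c * ‖x‖ ^ 2)) * (1 + 2 * ε))) := by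
        have h1 := (abs_det_le_norm_pow (B'.comp Bi)).trans
          (pow_le_pow_left₀ (norm_nonneg _) hnorm n)
        have h2 : ‖b • z - (c * inner ℝ x (Bi z)) • B x‖
            ≤ (b + 4 * θ * (c * ‖x‖ ^ 2)) * (1 + 2 * ε) := hmain.trans (by gcongr)
        gcongr
    _ = _ := by ring

end LinearAlgebra

/-! ### Radial deformations -/

section RadialMap

variable {n : ℕ}

/-- A perturbation of the identity by a strict contraction is a homeomorphism; its derivative is
invertible by the Neumann series, so the inverse is C¹. -/
lemma exists_isC1Inverse_add {Y : Euc n → Euc n} (hY : ContDiff ℝ 1 Y) {c : NNReal}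
    (hL : LipschitzWith c Y) (hc : c < 1) : ∃ S', IsC1Inverse (fun x => x + Y x) S' := by
  have happ : ApproximatesLinearOn (fun x => x + Y x)
      ((ContinuousLinearEquiv.refl ℝ (Euc n) : Euc n ≃L[ℝ] Euc n) : Euc n →L[ℝ] Euc n) univ c := by
    intro x _ y _
    have : x + Y x - (y + Y y) - ((ContinuousLinearEquiv.refl ℝ (Euc n) : Euc n ≃L[ℝ] Euc n) :
        Euc n →L[ℝ] Euc n) (x - y) = Y x - Y y := by
      simp only [ContinuousLinearEquiv.coe_refl, ContinuousLinearMap.id_apply]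
      abel
    rw [this]
    exact hL.norm_sub_le x y
  have hN : Subsingleton (Euc n) ∨ c < ‖((ContinuousLinearEquiv.refl ℝ (Euc n)).symm :
      Euc n →L[ℝ] Euc n)‖₊⁻¹ := by
    rcases subsingleton_or_nontrivial (Euc n) with h | h
    · exact Or.inl h
    · right
      have : ‖((ContinuousLinearEquiv.refl ℝ (Euc n)).symm : Euc n →L[ℝ] Euc n)‖₊ = 1 := by
        rw [← NNReal.coe_inj]
        exact ContinuousLinearMap.norm_id
      rw [this, inv_one]
      exact hc
  let e := happ.toHomeomorph _ hN
  have hdY : ∀ x, ‖fderiv ℝ Y x‖ ≤ c := fun x => norm_fderiv_le_of_lipschitz ℝ hL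
  have hlt : ∀ x, ‖-fderiv ℝ Y x‖ < 1 := fun x => by
    rw [norm_neg]
    exact (hdY x).trans_lt (by exact_mod_cast hc)
  have hd : ∀ x, HasFDerivAt e ((ContinuousLinearEquiv.unitsEquiv ℝ (Euc n)
      (Units.oneSub (-fderiv ℝ Y x) (hlt x)) : Euc n ≃L[ℝ] Euc n) : Euc n →L[ℝ] Euc n) x := by
    intro x
    have h1 : HasFDerivAt (fun x => x + Y x) (ContinuousLinearMap.id ℝ (Euc n) + fderiv ℝ Y x) x :=
      (hasFDerivAt_id x).add (hY.differentiable one_ne_zero x).hasFDerivAt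
    have h2 : ContinuousLinearMap.id ℝ (Euc n) + fderiv ℝ Y x = ((ContinuousLinearEquiv.unitsEquiv ℝ
        (Euc n) (Units.oneSub (-fderiv ℝ Y x) (hlt x)) : Euc n ≃L[ℝ] Euc n) :
          Euc n →L[ℝ] Euc n) := by
      ext1 v
      simp [ContinuousLinearEquiv.unitsEquiv_apply]
    rw [← h2]
    exact h1
  have hS : ContDiff ℝ 1 (fun x => x + Y x) := contDiff_id.add hY
  exact ⟨e.symm, e.symm_apply_apply, e.apply_symm_apply, hS, e.contDiff_symm hd hS⟩

/-- The radial deformation `x ↦ (1 - t f(|x|²)) x`. -/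
noncomputable def radialMap (f : ℝ → ℝ) (t : ℝ) (x : Euc n) : Euc n :=
  x + (-t) • (f (‖x‖ ^ 2) • x)

lemma radialMap_eq_smul (f : ℝ → ℝ) (t : ℝ) (x : Euc n) :
    radialMap f t x = (1 - t * f (‖x‖ ^ 2)) • x := by
  rw [radialMap]
  module

variable {f : ℝ → ℝ}

lemma hasFDerivAt_comp_normSq (hf : ContDiff ℝ 1 f) (x : Euc n) :
    HasFDerivAt (fun x : Euc n => f (‖x‖ ^ 2)) ((2 * deriv f (‖x‖ ^ 2)) • innerSL ℝ x) x := by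
  have h1 := (hf.differentiable one_ne_zero (‖x‖ ^ 2)).hasDerivAt.comp_hasFDerivAt x
    (hasStrictFDerivAt_norm_sq x).hasFDerivAt
  refine h1.congr_fderiv ?_
  ext v
  simp
  ring

lemma contDiff_comp_normSq (hf : ContDiff ℝ 1 f) :
    ContDiff ℝ 1 (fun x : Euc n => f (‖x‖ ^ 2)) := hf.comp (contDiff_norm_sq ℝ)

lemma fderiv_radialMap (hf : ContDiff ℝ 1 f) (t : ℝ) (x : Euc n) :
    fderiv ℝ (radialMap f t) x
      = rankOneUpdate (1 - t * f (‖x‖ ^ 2)) (-2 * t * deriv f (‖x‖ ^ 2)) x := by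
  have h1 : HasFDerivAt (radialMap f t) _ x := (hasFDerivAt_id x).add
    (((hasFDerivAt_comp_normSq hf x).smul (hasFDerivAt_id x)).const_smul (-t))
  rw [h1.fderiv]
  ext1 v
  rw [rankOneUpdate_apply]
  simp only [add_apply, smul_apply,
    ContinuousLinearMap.smulRight_apply, ContinuousLinearMap.id_apply, innerSL_apply_apply, id,
    smul_eq_mul]
  module

lemma exists_isC1Inverse_radialMap (hf : ContDiff ℝ 1 f) {R : ℝ}
    (hfR : ∀ σ, R ^ 2 ≤ σ → f σ = 0) :
    ∃ t₀ : ℝ, 0 < t₀ ∧ ∀ t, 0 ≤ t → t ≤ t₀ → ∃ T', IsC1Inverse (radialMap f t : Euc n → Euc n) T' := by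
  have hX : ContDiff ℝ 1 fun x : Euc n => f (‖x‖ ^ 2) • x := (contDiff_comp_normSq hf).smul contDiff_id
  have hXc : HasCompactSupport fun x : Euc n => f (‖x‖ ^ 2) • x := by
    refine HasCompactSupport.intro (isCompact_closedBall (0 : Euc n) |R|) fun x hx => ?_
    rw [mem_closedBall_zero_iff, not_le] at hx
    rw [hfR _ (by rw [← sq_abs R]; gcongr), zero_smul]
  obtain ⟨K, hK⟩ := hX.lipschitzWith_of_hasCompactSupport hXc one_ne_zero
  -- With K a Lipschitz constant of the field f(|x|²) x, this choice ensures tK < 1.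
  refine ⟨1 / (K + 1), by positivity, fun t ht0 ht => ?_⟩
  refine exists_isC1Inverse_add (c := ‖-t‖₊ * K) (hX.const_smul (-t))
    ((lipschitzWith_smul (-t)).comp hK) ?_
  rw [← NNReal.coe_lt_coe]
  push_cast
  rw [norm_neg, Real.norm_of_nonneg ht0]
  rw [le_div_iff₀ (by positivity)] at ht
  rcases ht0.eq_or_lt with h | h
  · rw [← h, zero_mul]
    exact one_pos
  · linarith

end RadialMap

/-! ### Deformed sets as competitors -/

section Comparison

variable {n : ℕ} {hn : 2 ≤ n} {E : Set (Euc n)} {μ : Measure (Euc n)} {Φ Ψ S S' : Euc n → Euc n}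
  {δ : ℝ}

lemma eDot_smul (α c : ℝ) (x : Euc n) : eDot hn α (c • x) = c * eDot hn α x := by
  simp only [eDot, coordPen, coordLast, PiLp.smul_apply, smul_eq_mul]
  ring

lemma smul_mem_sharpWedge {c : ℝ} (hc : 0 < c) {x : Euc n} (hx : x ∈ sharpWedge hn δ) :
    c • x ∈ sharpWedge hn δ := by
  obtain ⟨h1, h2⟩ := hx
  refine ⟨?_, ?_⟩
  · rw [eDot_smul]
    exact mul_nonpos_of_nonneg_of_nonpos hc.le h1
  · rw [eDot_smul]
    exact mul_nonpos_of_nonneg_of_nonpos hc.le h2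

/-- By injectivity no point can enter or leave K, as points outside K are fixed. -/
lemma IsC1Inverse.image_eq_of_eqOn_compl (hS : IsC1Inverse S S') {K U : Set (Euc n)}
    (hKU : K ⊆ U) (hSK : ∀ y, y ∉ K → S y = y) : S '' U = U := by
  have hK : ∀ y, S y ∈ K ↔ y ∈ K := fun y => by
    constructor
    · intro h
      by_contra hy
      rw [hSK y hy] at h
      exact hy h
    · intro h
      by_contra hy
      have := hS.1.injective (hSK _ hy)
      rw [this] at hy
      exact hy h
  refine subset_antisymm ?_ fun y hy => ?_
  · rintro _ ⟨y, hy, rfl⟩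
    by_cases h : y ∈ K
    · exact hKU ((hK y).2 h)
    · rwa [hSK y h]
  · by_cases h : y ∈ K
    · refine ⟨S' y, hKU ((hK _).1 ?_), hS.2 y⟩
      rwa [hS.2 y]
    · exact ⟨y, hy, hSK y h⟩

lemma IsThinObstacleMinimizer.perimeter_le_image (hE : IsThinObstacleMinimizer hn Φ δ E)
    (hS : IsC1Inverse S S') {K : Set (Euc n)} (hK : IsCompact K) (hKB : K ⊆ oBall n 1)
    (hSK : ∀ y, y ∉ K → S y = y) (hW : ∀ y ∈ Φ '' sharpWedge hn δ, S' y ∈ Φ '' sharpWedge hn δ) :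
    perimeter E (oBall n 1) ≤ perimeter (S '' E) (oBall n 1) := by
  have hSB := hS.image_eq_of_eqOn_compl hKB hSK
  refine hE.perimeter_le _ (hS.nullMeasurableSet_image hE.measurable) ⟨K, hK, hKB, ?_⟩ ?_
  · ext y
    refine and_congr_left fun hy => ?_
    conv_rhs => rw [← hSK y hy]
    rw [hS.1.injective.mem_set_image]
  · rintro y ⟨hy, hyB⟩
    rw [← hSB] at hyB
    obtain ⟨x, hx, rfl⟩ := hyB
    have := hW _ hy
    rw [hS.1 x] at this
    exact mem_image_of_mem S (hE.obstacle_subset ⟨this, hx⟩)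

/-- By minimality some test field nearly realizes at least P(E) on the set S(E); the change of
variables rewrites its integral as one over E. The slack ε is needed because the supremum may not be
attained. -/
lemma IsThinObstacleMinimizer.exists_pullField (hE : IsThinObstacleMinimizer hn Φ δ E)
    (hμ : IsPerimeterMeasure E (oBall n 1) μ) (hS : IsC1Inverse S S') {K : Set (Euc n)}
    (hK : IsCompact K) (hKB : K ⊆ oBall n 1) (hSK : ∀ y, y ∉ K → S y = y)
    (hW : ∀ y ∈ Φ '' sharpWedge hn δ, S' y ∈ Φ '' sharpWedge hn δ) {ε : ℝ} (hε : 0 < ε) :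
    ∃ g, IsTestField (S '' oBall n 1) g ∧ (∀ x, ‖g x‖ ≤ 1) ∧
      μ.real univ - ε ≤ ∫ x in E, |(fderiv ℝ S x).det| * divergence g (S x) := by
  rcases le_or_gt (μ.real univ) ε with h | h
  · refine ⟨fun _ => 0, IsTestField.zero, by simp, ?_⟩
    simp [divergence]
    linarith
  · have := hμ.isFiniteMeasure
    have hlt : ENNReal.ofReal (μ.real univ - ε) < perimeter (S '' E) (oBall n 1) := by
      refine lt_of_lt_of_le ?_ (hE.perimeter_le_image hS hK hKB hSK hW)
      rw [← hμ.measure_univ, ← ofReal_measureReal (measure_ne_top _ _)]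
      exact (ENNReal.ofReal_lt_ofReal_iff (by linarith)).2 (by linarith)
    obtain ⟨g, hg, hg1, hlt⟩ := exists_testField_lt hlt
    refine ⟨g, by rwa [hS.image_eq_of_eqOn_compl hKB hSK], hg1, ?_⟩
    rw [hS.setIntegral_image hE.measurable] at hlt
    exact ((ENNReal.ofReal_lt_ofReal_iff_of_nonneg (by linarith)).1 hlt).le

/-- A pointwise bound w valid for all fields of norm at most 1 serves as the tangential Jacobian of
S maximized over all normals. -/
lemma IsThinObstacleMinimizer.measureReal_le (hE : IsThinObstacleMinimizer hn Φ δ E)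
    (hμ : IsPerimeterMeasure E (oBall n 1) μ) (hS : IsC1Inverse S S') {K : Set (Euc n)}
    (hK : IsCompact K) (hKB : K ⊆ oBall n 1) (hSK : ∀ y, y ∉ K → S y = y)
    (hW : ∀ y ∈ Φ '' sharpWedge hn δ, S' y ∈ Φ '' sharpWedge hn δ) {w : Euc n → ℝ}
    (hw : Integrable w μ)
    (hbd : ∀ g : Euc n → Euc n, (∀ x, ‖g x‖ ≤ 1) → ∀ y, ‖pullField S S' g y‖ ≤ w y) :
    μ.real univ ≤ ∫ y, w y ∂μ := by
  refine le_of_forall_pos_le_add fun ε hε => ?_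
  obtain ⟨g, hg, hg1, hle⟩ := hE.exists_pullField hμ hS hK hKB hSK hW hε
  have hweak := hS.hasWeakDivergence_pullField hg
  have h1 := hweak.integral_le hμ
  have := hμ.isFiniteMeasure
  have h2 : ∫ y, ‖pullField S S' g y‖ ∂μ ≤ ∫ y, w y ∂μ :=
    integral_mono (hweak.1.integrable_of_hasCompactSupport hweak.3).norm hw (hbd g hg1)
  linarith

end Comparison

/-! ### The first variation inequality -/

section FirstVariation

variable {n : ℕ} {hn : 2 ≤ n} {E : Set (Euc n)} {μ : Measure (Euc n)} {Φ Ψ T T' : Euc n → Euc n}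
  {δ : ℝ} {f : ℝ → ℝ}

/-- Admissible profiles of radial deformations supported in the ball of radius `R`. -/
structure IsRadialProfile (R : ℝ) (f : ℝ → ℝ) : Prop where
  contDiff : ContDiff ℝ 1 f
  deriv_nonpos : ∀ σ, deriv f σ ≤ 0
  eq_zero : ∀ σ, R ^ 2 ≤ σ → f σ = 0

namespace IsRadialProfile

variable {R : ℝ}

lemma antitone (hf : IsRadialProfile R f) : Antitone f :=
  antitone_of_deriv_nonpos (hf.1.differentiable one_ne_zero) hf.2

lemma nonneg (hf : IsRadialProfile R f) (σ : ℝ) : 0 ≤ f σ := by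
  rw [← hf.3 (max σ (R ^ 2)) (le_max_right _ _)]
  exact hf.antitone (le_max_left _ _)

lemma deriv_eq_zero (hf : IsRadialProfile R f) {σ : ℝ} (hσ : R ^ 2 < σ) : deriv f σ = 0 := by
  have : f =ᶠ[𝓝 σ] fun _ => 0 := by
    filter_upwards [Ioi_mem_nhds hσ] with τ hτ using hf.3 τ (le_of_lt hτ)
  rw [this.deriv_eq, deriv_const]

lemma continuous_deriv (hf : IsRadialProfile R f) : Continuous (deriv f) :=
  hf.1.continuous_deriv le_rfl

lemma exists_bound (hf : IsRadialProfile R f) (p q : ℝ) :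
    ∃ M, 0 < M ∧ ∀ σ, 0 ≤ σ → |p * f σ + q * (σ * deriv f σ)| ≤ M := by
  have hc : Continuous fun σ => p * f σ + q * (σ * deriv f σ) := by
    have := hf.1.continuous
    have := hf.continuous_deriv
    fun_prop
  obtain ⟨M, hM⟩ := (isCompact_Icc (a := (0 : ℝ)) (b := R ^ 2)).exists_bound_of_continuousOn
    hc.continuousOn
  refine ⟨max M 1, by positivity, fun σ hσ => ?_⟩
  rcases le_or_gt σ (R ^ 2) with h | h
  · exact (hM σ ⟨hσ, h⟩).trans (le_max_left _ _)
  · rw [hf.3 σ h.le, hf.deriv_eq_zero h]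
    simp

end IsRadialProfile

lemma pullField_conj_apply (hΦ : IsC1Inverse Φ Ψ) (hT : IsC1Inverse T T') (g : Euc n → Euc n)
    (x : Euc n) :
    pullField (Φ ∘ T ∘ Ψ) (Φ ∘ T' ∘ Ψ) g (Φ x)
      = |(((fderiv ℝ Φ (T x)).comp (fderiv ℝ T x)).comp (fderiv ℝ Ψ (Φ x))).det|
        • fderiv ℝ Φ x (fderiv ℝ T' (T x) (fderiv ℝ Ψ (Φ (T x)) (g (Φ (T x))))) := by
  have h1 : HasFDerivAt (Φ ∘ T ∘ Ψ)
      (((fderiv ℝ Φ (T x)).comp (fderiv ℝ T x)).comp (fderiv ℝ Ψ (Φ x))) (Φ x) := by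
    have h2 := (hΦ.hasFDerivAt (T x)).comp x (hT.hasFDerivAt x)
    have h3 : HasFDerivAt (Φ ∘ T) ((fderiv ℝ Φ (T x)).comp (fderiv ℝ T x)) (Ψ (Φ x)) := by
      rw [hΦ.1 x]
      exact h2
    exact h3.comp (Φ x) (hΦ.symm.hasFDerivAt (Φ x))
  have h4 : HasFDerivAt (Φ ∘ T' ∘ Ψ)
      (((fderiv ℝ Φ x).comp (fderiv ℝ T' (T x))).comp (fderiv ℝ Ψ (Φ (T x)))) (Φ (T x)) := by
    have h2 : HasFDerivAt (Φ ∘ T') ((fderiv ℝ Φ x).comp (fderiv ℝ T' (T x))) (T x) := by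
      refine HasFDerivAt.comp (T x) ?_ (hT.symm.hasFDerivAt (T x))
      rw [hT.1 x]
      exact hΦ.hasFDerivAt x
    have h3 : HasFDerivAt (Φ ∘ T') ((fderiv ℝ Φ x).comp (fderiv ℝ T' (T x))) (Ψ (Φ (T x))) := by
      rw [hΦ.1 (T x)]
      exact h2
    exact h3.comp _ (hΦ.symm.hasFDerivAt _)
  have h5 : (Φ ∘ T ∘ Ψ) (Φ x) = Φ (T x) := by simp [hΦ.1 x]
  rw [pullField, h5, h1.fderiv, h4.fderiv]
  rfl

/-- `Φ` is an almost orthogonal `C¹` diffeomorphism: `DΦ` is `η`-Lipschitz in the unit ball and is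
the identity at the origin. -/
structure IsNearIdentity (η : ℝ) (Φ Ψ : Euc n → Euc n) : Prop where
  inv : IsC1Inverse Φ Ψ
  nonneg : 0 ≤ η
  fderiv_zero : fderiv ℝ Φ 0 = ContinuousLinearMap.id ℝ (Euc n)
  lipschitz : ∀ x ∈ oBall n 1, ∀ y ∈ oBall n 1, ‖fderiv ℝ Φ x - fderiv ℝ Φ y‖ ≤ η * ‖x - y‖

lemma IsNearIdentity.norm_fderiv_sub_id_le {η : ℝ} (hΦ : IsNearIdentity η Φ Ψ) {x : Euc n}
    (hx : x ∈ oBall n 1) : ‖fderiv ℝ Φ x - ContinuousLinearMap.id ℝ (Euc n)‖ ≤ η * ‖x‖ := by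
  have := hΦ.lipschitz x hx 0 (by simp)
  rwa [hΦ.fderiv_zero, sub_zero] at this

/-- With u = t f, `norm_cofactor_conj_le` is applied for a = 1 - u, c = -2 t f', θ = ηR and ε = θu.
The exponential form makes the first order term in t visible and uniform in y. -/
lemma norm_pullField_radial_le (hn : 2 ≤ n) {η R t : ℝ} (hΦ : IsNearIdentity η Φ Ψ)
    (hR0 : 0 < R) (hR1 : R < 1) (hη : η * R ≤ 1 / 2) (hf : IsRadialProfile R f) (ht : 0 ≤ t)
    (htf : t * f 0 ≤ 1 / 2) (hT : IsC1Inverse (radialMap f t) T') {g : Euc n → Euc n}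
    (hg : ∀ x, ‖g x‖ ≤ 1) (y : Euc n) :
    ‖pullField (Φ ∘ radialMap f t ∘ Ψ) (Φ ∘ T' ∘ Ψ) g y‖
      ≤ Real.exp (t * ((-(n - 1 - 2 * (n + 1) * (η * R))) * f (‖Ψ y‖ ^ 2)
        + (-(2 * (1 + 4 * (η * R)))) * (‖Ψ y‖ ^ 2 * deriv f (‖Ψ y‖ ^ 2)))) := by
  obtain ⟨x, rfl⟩ : ∃ x, y = Φ x := ⟨Ψ y, (hΦ.inv.2 y).symm⟩
  rw [pullField_conj_apply hΦ.inv hT, hΦ.inv.1 x]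
  have hDi : ∀ v, fderiv ℝ (radialMap f t) x (fderiv ℝ T' (radialMap f t x) v) = v := fun v =>
    hT.fderiv_apply_inv x v
  have hfx0 := hf.nonneg (‖x‖ ^ 2)
  have hfx1 : f (‖x‖ ^ 2) ≤ f 0 := hf.antitone (by positivity)
  have hdx := hf.2 (‖x‖ ^ 2)
  set u := t * f (‖x‖ ^ 2) with hu
  have hu0 : 0 ≤ u := by positivity
  have hu1 : u ≤ 1 / 2 := (mul_le_mul_of_nonneg_left hfx1 ht).trans htf
  rw [fderiv_radialMap hf.1] at hDi ⊢
  rw [← hu] at hDi ⊢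
  rcases le_or_gt ‖x‖ R with hx | hx
  · set θ := η * R with hθ
    have hθ0 : 0 ≤ θ := mul_nonneg hΦ.nonneg hR0.le
    have hTx : ‖radialMap f t x‖ ≤ ‖x‖ := by
      rw [radialMap_eq_smul, norm_smul, ← hu, Real.norm_of_nonneg (by linarith)]
      exact mul_le_of_le_one_left (norm_nonneg _) (by linarith)
    have hxB : x ∈ oBall n 1 := mem_ball_zero_iff.2 (hx.trans_lt hR1)
    have hTB : radialMap f t x ∈ oBall n 1 := mem_ball_zero_iff.2 ((hTx.trans hx).trans_lt hR1)
    have hθx : ∀ z : Euc n, ‖z‖ ≤ R → z ∈ oBall n 1 →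
        ‖fderiv ℝ Φ z - ContinuousLinearMap.id ℝ (Euc n)‖ ≤ θ := fun z hz hzB =>
      (hΦ.norm_fderiv_sub_id_le hzB).trans (mul_le_mul_of_nonneg_left hz hΦ.nonneg)
    have hBB : ‖fderiv ℝ Φ (radialMap f t x) - fderiv ℝ Φ x‖ ≤ θ * u := by
      refine (hΦ.lipschitz _ hTB _ hxB).trans ?_
      rw [show radialMap f t x - x = (-u) • x by rw [radialMap_eq_smul, hu]; module, norm_smul,
        norm_neg, Real.norm_of_nonneg hu0, hθ]
      have := hΦ.nonneg
      calc η * (u * ‖x‖) ≤ η * (u * R) := by gcongr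
        _ = η * R * u := by ring
    have hc : 0 ≤ -2 * t * deriv f (‖x‖ ^ 2) := by nlinarith
    have main := norm_cofactor_conj_le hn (a := 1 - u) (c := -2 * t * deriv f (‖x‖ ^ 2))
      (by linarith) hc hθ0 hη (mul_nonneg hθ0 hu0) x hDi (hΦ.inv.fderiv_apply_inv x)
      (hΦ.inv.fderiv_inv_apply x) (hΦ.inv.fderiv_apply_inv (radialMap f t x)) (hθx x hx hxB)
      (hθx _ (hTx.trans hx) hTB) hBB (hg (Φ (radialMap f t x)))
    refine main.trans ?_
    set v := -2 * t * deriv f (‖x‖ ^ 2) * ‖x‖ ^ 2 with hv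
    have hv0 : 0 ≤ v := by positivity
    -- Each factor is bounded by 1 + x ≤ exp x; the exponents add up to exactly t times the
    -- integrand of the first variation.
    have e1 : (1 + 2 * (θ * u)) ^ (n + 1) ≤ Real.exp (2 * (θ * u)) ^ (n + 1) := by
      have := Real.add_one_le_exp (2 * (θ * u))
      gcongr
      linarith
    have e2 : (1 - u) ^ (n - 2) ≤ Real.exp (-u) ^ (n - 2) :=
      pow_le_pow_left₀ (by linarith) (by linarith [Real.add_one_le_exp (-u)]) _
    have e3 : 1 - u + v + 4 * θ * v ≤ Real.exp (-u + (1 + 4 * θ) * v) := by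
      linarith [Real.add_one_le_exp (-u + (1 + 4 * θ) * v)]
    have h0 : 0 ≤ 1 - u + v + 4 * θ * v := by
      have : 0 ≤ 4 * θ * v := by positivity
      linarith
    calc _ ≤ Real.exp (2 * (θ * u)) ^ (n + 1) * Real.exp (-u) ^ (n - 2)
          * Real.exp (-u + (1 + 4 * θ) * v) := by
          have : 0 ≤ (1 - u) ^ (n - 2) := pow_nonneg (by linarith) _
          gcongr
      _ = _ := by
          rw [← Real.exp_nat_mul, ← Real.exp_nat_mul, ← Real.exp_add, ← Real.exp_add]
          congr 1
          push_cast [Nat.cast_sub hn]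
          rw [hv, hu]
          ring
  -- Outside the ball of radius R nothing is known about DΦ, but f and f' vanish there, so the two
  -- derivatives of Φ and Ψ cancel and the field is unchanged.
  · have hσ : R ^ 2 < ‖x‖ ^ 2 := by gcongr
    have hfz := hf.3 _ hσ.le
    have hdz := hf.deriv_eq_zero hσ
    have hTx : radialMap f t x = x := by
      rw [radialMap_eq_smul, hfz]
      simp
    have hu' : u = 0 := by rw [hu, hfz, mul_zero]
    rw [hdz, hTx, hu'] at hDi
    rw [hfz, hdz, hTx, hu']
    have hid : rankOneUpdate (1 - 0) (-2 * t * 0) x = ContinuousLinearMap.id ℝ (Euc n) := by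
      ext1 v
      simp [rankOneUpdate_apply]
    rw [hid] at hDi ⊢
    have hDi' : ∀ v, fderiv ℝ T' x v = v := fun v => by simpa using hDi v
    rw [hDi', hΦ.inv.fderiv_apply_inv]
    have hdet : ((fderiv ℝ Φ x).comp (ContinuousLinearMap.id ℝ (Euc n))).comp (fderiv ℝ Ψ (Φ x))
        = ContinuousLinearMap.id ℝ (Euc n) := by
      ext1 v
      simp [hΦ.inv.fderiv_apply_inv]
    rw [hdet]
    have : (ContinuousLinearMap.id ℝ (Euc n)).det = 1 := by
      simp [ContinuousLinearMap.det]
    rw [this]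
    simpa using hg _

lemma conj_radialMap_eq (hΦ : IsC1Inverse Φ Ψ) {R t : ℝ} (hf : IsRadialProfile R f) (hR0 : 0 < R)
    (y : Euc n) (hy : y ∉ Φ '' Metric.closedBall 0 R) : (Φ ∘ radialMap f t ∘ Ψ) y = y := by
  have h1 : R < ‖Ψ y‖ := by
    by_contra h
    exact hy ⟨Ψ y, mem_closedBall_zero_iff.2 (not_lt.1 h), hΦ.2 y⟩
  have : radialMap f t (Ψ y) = Ψ y := by
    rw [radialMap_eq_smul, hf.3 _ (by gcongr)]
    simp
  simp [this, hΦ.2 y]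

/-- The inverse radial map multiplies each point by a positive factor, and the wedge is a cone. -/
lemma conj_radialMap_inv_mem (hΦ : IsC1Inverse Φ Ψ) {R t : ℝ} (hf : IsRadialProfile R f)
    (ht : 0 ≤ t) (htf : t * f 0 ≤ 1 / 2) (hT : IsC1Inverse (radialMap f t) T') :
    ∀ y ∈ Φ '' sharpWedge hn δ, (Φ ∘ T' ∘ Ψ) y ∈ Φ '' sharpWedge hn δ := by
  rintro _ ⟨x, hx, rfl⟩
  refine ⟨T' x, ?_, by simp [hΦ.1 x]⟩
  have h1 := hT.2 x
  rw [radialMap_eq_smul] at h1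
  set c := 1 - t * f (‖T' x‖ ^ 2) with hc
  have hc0 : 0 < c := by
    have : t * f (‖T' x‖ ^ 2) ≤ t * f 0 := mul_le_mul_of_nonneg_left (hf.antitone (by positivity)) ht
    linarith
  have h2 : T' x = c⁻¹ • x := by
    rw [← h1, smul_smul, inv_mul_cancel₀ hc0.ne', one_smul, h1]
  rw [h2]
  exact smul_mem_sharpWedge (inv_pos.2 hc0) hx

/-- The integrand of the first variation of the perimeter along a radial field. -/
noncomputable def firstVariation (p q : ℝ) (f : ℝ → ℝ) (Ψ : Euc n → Euc n) (y : Euc n) : ℝ :=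
  (-p) * f (‖Ψ y‖ ^ 2) + (-(2 * q)) * (‖Ψ y‖ ^ 2 * deriv f (‖Ψ y‖ ^ 2))

lemma continuous_firstVariation {R p q : ℝ} (hf : IsRadialProfile R f) (hΨ : Continuous Ψ) :
    Continuous (firstVariation p q f Ψ) := by
  have := hf.1.continuous
  have := hf.continuous_deriv
  unfold firstVariation
  fun_prop

lemma exp_mul_le {L M t : ℝ} (ht : 0 ≤ t) (hL : |L| ≤ M) (htM : t * M ≤ 1) :
    Real.exp (t * L) ≤ 1 + t * L + t ^ 2 * M ^ 2 := by
  have h1 : |t * L| ≤ 1 := by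
    rw [abs_mul, abs_of_nonneg ht]
    exact (mul_le_mul_of_nonneg_left hL ht).trans htM
  have h2 := (abs_le.1 (Real.abs_exp_sub_one_sub_id_le h1)).2
  have h3 : (t * L) ^ 2 ≤ t ^ 2 * M ^ 2 := by
    rw [mul_pow]
    have : L ^ 2 ≤ M ^ 2 := by
      rw [← sq_abs L]
      gcongr
    gcongr
  linarith

lemma integral_exp_firstVariation_le [IsFiniteMeasure μ] {L : Euc n → ℝ} (hL : Continuous L)
    {M : ℝ} (hM : ∀ y, |L y| ≤ M) {t : ℝ} (ht : 0 ≤ t) (htM : t * M ≤ 1) :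
    Integrable (fun y => Real.exp (t * L y)) μ ∧
    ∫ y, Real.exp (t * L y) ∂μ ≤ μ.real univ + t * ∫ y, L y ∂μ + t ^ 2 * M ^ 2 * μ.real univ := by
  have iL : Integrable L μ :=
    Integrable.of_bound hL.aestronglyMeasurable M (ae_of_all _ hM)
  have iE : Integrable (fun y => Real.exp (t * L y)) μ := by
    refine Integrable.of_bound (Real.continuous_exp.comp (hL.const_mul t)).aestronglyMeasurable
      (Real.exp (t * M)) (ae_of_all _ fun y => ?_)
    rw [Real.norm_of_nonneg (Real.exp_nonneg _)]
    exact Real.exp_le_exp.2 (mul_le_mul_of_nonneg_left ((le_abs_self _).trans (hM y)) ht)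
  refine ⟨iE, ?_⟩
  have h1 : ∫ y, Real.exp (t * L y) ∂μ ≤ ∫ y, (1 + t * L y + t ^ 2 * M ^ 2) ∂μ :=
    integral_mono iE (((integrable_const _).add (iL.const_mul t)).add (integrable_const _))
      fun y => exp_mul_le ht (hM y) htM
  refine h1.trans (le_of_eq ?_)
  have i2 : Integrable (fun y => 1 + t * L y) μ := (integrable_const _).add (iL.const_mul t)
  rw [integral_add i2 (integrable_const _), integral_add (integrable_const _) (iL.const_mul t),
    integral_const_mul]
  simp
  ring

/-- Writing L for the integrand, minimality gives μ(univ) ≤ ∫ exp(tL) dμ ≤ μ(univ) + t ∫ L dμ + t²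
M² μ(univ). Divide by t and let t decrease to 0. -/
theorem IsThinObstacleMinimizer.integral_firstVariation_nonneg
    (hE : IsThinObstacleMinimizer hn Φ δ E) (hμ : IsPerimeterMeasure E (oBall n 1) μ) {η R : ℝ}
    (hΦ : IsNearIdentity η Φ Ψ) (hR0 : 0 < R) (hR1 : R < 1)
    (hΦR : Φ '' Metric.closedBall 0 R ⊆ oBall n 1) (hη : η * R ≤ 1 / 2)
    (hf : IsRadialProfile R f) :
    0 ≤ ∫ y, firstVariation (n - 1 - 2 * (n + 1) * (η * R)) (1 + 4 * (η * R)) f Ψ y ∂μ := by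
  have := hμ.isFiniteMeasure
  set p : ℝ := n - 1 - 2 * (n + 1) * (η * R)
  set q : ℝ := 1 + 4 * (η * R)
  obtain ⟨M, hM0, hM⟩ := hf.exists_bound (-p) (-(2 * q))
  have hL : Continuous (firstVariation p q f Ψ) := continuous_firstVariation hf hΦ.inv.4.continuous
  have hLM : ∀ y, |firstVariation p q f Ψ y| ≤ M := fun y => hM _ (by positivity)
  obtain ⟨t₀, ht₀, hinv⟩ := exists_isC1Inverse_radialMap (n := n) hf.1 hf.3
  -- The three bounds give invertibility of the radial map, tM ≤ 1 for the expansion of exp, and t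
  -- f(0) ≤ 1/2.
  set t₁ := min t₀ (min (1 / M) (1 / (2 * (f 0 + 1)))) with ht₁
  have hf0 := hf.nonneg 0
  have ht₁0 : 0 < t₁ := by positivity
  have key : ∀ t, 0 < t → t ≤ t₁ →
      0 ≤ ∫ y, firstVariation p q f Ψ y ∂μ + t * (M ^ 2 * μ.real univ) := by
    intro t ht htt
    obtain ⟨T', hT⟩ := hinv t ht.le (htt.trans (min_le_left _ _))
    have htM : t * M ≤ 1 := by
      have := htt.trans ((min_le_right _ _).trans (min_le_left _ _))
      rwa [le_div_iff₀ hM0] at this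
    have htf : t * f 0 ≤ 1 / 2 := by
      have := htt.trans ((min_le_right _ _).trans (min_le_right _ _))
      rw [le_div_iff₀ (by positivity)] at this
      nlinarith
    obtain ⟨i1, h1⟩ := integral_exp_firstVariation_le (μ := μ) hL hLM ht.le htM
    have hS : IsC1Inverse (Φ ∘ radialMap f t ∘ Ψ) (Φ ∘ T' ∘ Ψ) := hΦ.inv.comp (hT.comp hΦ.inv.symm)
    have h2 := hE.measureReal_le hμ hS ((isCompact_closedBall 0 R).image hΦ.inv.3.continuous) hΦR
      (conj_radialMap_eq hΦ.inv hf hR0) (conj_radialMap_inv_mem hΦ.inv hf ht.le htf hT) i1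
      fun g hg y => norm_pullField_radial_le hn hΦ hR0 hR1 hη hf ht.le htf hT hg y
    have h3 : 0 ≤ t * (∫ y, firstVariation p q f Ψ y ∂μ + t * (M ^ 2 * μ.real univ)) := by
      linarith
    exact nonneg_of_mul_nonneg_right h3 ht
  have hlim : Tendsto (fun t : ℝ => ∫ y, firstVariation p q f Ψ y ∂μ + t * (M ^ 2 * μ.real univ))
      (𝓝[>] 0) (𝓝 (∫ y, firstVariation p q f Ψ y ∂μ + 0 * (M ^ 2 * μ.real univ))) :=
    (Continuous.tendsto (by fun_prop) 0).mono_left nhdsWithin_le_nhds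
  rw [zero_mul, add_zero] at hlim
  refine ge_of_tendsto hlim ?_
  filter_upwards [Ioc_mem_nhdsGT ht₁0] with t ht using key t ht.1 ht.2

end FirstVariation

/-! ### The radial profile that yields monotonicity -/

section Profile

/-- A trapezoidal weight supported in `[a, b]`. -/
noncomputable def trapezoid (a b h u : ℝ) : ℝ := max 0 (min 1 (min ((u - a) / h) ((b - u) / h)))

lemma continuous_trapezoid (a b h : ℝ) : Continuous (trapezoid a b h) := by
  unfold trapezoid
  fun_prop

lemma trapezoid_nonneg (a b h u : ℝ) : 0 ≤ trapezoid a b h u := le_max_left _ _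

lemma trapezoid_le_one (a b h u : ℝ) : trapezoid a b h u ≤ 1 :=
  max_le zero_le_one (min_le_left _ _)

lemma trapezoid_eq_zero_left {a b h u : ℝ} (hh : 0 < h) (hu : u ≤ a) : trapezoid a b h u = 0 :=
  max_eq_left ((min_le_right _ _).trans ((min_le_left _ _).trans
    (div_nonpos_of_nonpos_of_nonneg (by linarith) hh.le)))

lemma trapezoid_eq_zero_right {a b h u : ℝ} (hh : 0 < h) (hu : b ≤ u) : trapezoid a b h u = 0 :=
  max_eq_left ((min_le_right _ _).trans ((min_le_right _ _).trans
    (div_nonpos_of_nonpos_of_nonneg (by linarith) hh.le)))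

lemma trapezoid_eq_one {a b h u : ℝ} (hh : 0 < h) (h1 : a + h ≤ u) (h2 : u ≤ b - h) :
    trapezoid a b h u = 1 := by
  have h3 : 1 ≤ (u - a) / h := by
    rw [le_div_iff₀ hh]
    linarith
  have h4 : 1 ≤ (b - u) / h := by
    rw [le_div_iff₀ hh]
    linarith
  rw [trapezoid, min_eq_left (le_min h3 h4), max_eq_right zero_le_one]

/-- The ideal profile is max(σ, a)^(-r) - b^(-r) for σ < b and 0 beyond. There f + σ f'/r is a^(-r)
- b^(-r) for σ < a, then -b^(-r) up to b, then 0. The trapezoid, with ramps of width h, makes f'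
continuous; the resulting errors vanish as h → 0. -/
lemma exists_radialProfile {r s a b h : ℝ} (hr : 0 < r) (ha : 0 < a) (hb : b = s ^ 2) (hh : 0 < h)
    (hab : a + h ≤ b - h) :
    ∃ f, IsRadialProfile s f ∧ ∀ σ, 0 ≤ σ →
      (Iio a).indicator (fun _ => (a + h) ^ (-r)) σ - (Iio b).indicator (fun _ => (b - h) ^ (-r)) σ
        - (a ^ (-r) - (a + h) ^ (-r)) ≤ f σ + 1 / r * (σ * deriv f σ) := by
  set k : ℝ → ℝ := fun u => r * max u a ^ (-r - 1) * trapezoid a b h u with hk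
  have hkc : Continuous k := by
    refine (continuous_const.mul ?_).mul (continuous_trapezoid a b h)
    exact (continuous_id.max continuous_const).rpow_const fun u =>
      Or.inl (lt_of_lt_of_le ha (le_max_right _ _)).ne'
  have hk0 : ∀ u, 0 ≤ k u := fun u => by
    have : 0 ≤ max u a := ha.le.trans (le_max_right _ _)
    have := trapezoid_nonneg a b h u
    positivity
  set f : ℝ → ℝ := fun σ => ∫ u in σ..b, k u with hf
  have hd : ∀ σ, HasDerivAt f (-k σ) σ := fun σ =>
    intervalIntegral.integral_hasDerivAt_left (hkc.intervalIntegrable _ _)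
      hkc.stronglyMeasurable.stronglyMeasurableAtFilter hkc.continuousAt
  have hderiv : deriv f = fun σ => -k σ := funext fun σ => (hd σ).deriv
  have hprof : IsRadialProfile s f := by
    refine ⟨?_, fun σ => ?_, fun σ hσ => ?_⟩
    · rw [contDiff_one_iff_deriv, hderiv]
      exact ⟨fun σ => (hd σ).differentiableAt, hkc.neg⟩
    · rw [hderiv]
      exact neg_nonpos.2 (hk0 σ)
    · rw [← hb] at hσ
      simp only [hf]
      rw [intervalIntegral.integral_congr (g := fun _ => 0)]
      · simp
      · intro u hu
        rw [uIcc_of_ge hσ] at hu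
        simp [hk, trapezoid_eq_zero_right hh hu.1]
  refine ⟨f, hprof, fun σ hσ => ?_⟩
  -- Only the part of the integral where the trapezoid equals 1 is kept; the rest is nonnegative.
  have hlow : ∀ τ, σ ≤ τ → a + h ≤ τ → τ ≤ b - h → τ ^ (-r) - (b - h) ^ (-r) ≤ f σ := by
    intro τ hστ hτ1 hτ2
    have hτ0 : 0 < τ := by linarith
    have h1 : ∫ u in τ..(b - h), k u = τ ^ (-r) - (b - h) ^ (-r) := by
      have : ∫ u in τ..(b - h), k u = ∫ u in τ..(b - h), r * u ^ (-r - 1) := by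
        refine intervalIntegral.integral_congr fun u hu => ?_
        rw [uIcc_of_le hτ2] at hu
        simp only [hk]
        rw [trapezoid_eq_one hh (by linarith [hu.1]) hu.2, max_eq_left (by linarith [hu.1]), mul_one]
      rw [this, intervalIntegral.integral_const_mul, integral_rpow]
      · rw [sub_add_cancel]
        field_simp
        ring
      · right
        refine ⟨by linarith, fun h0 => ?_⟩
        rw [uIcc_of_le hτ2] at h0
        linarith [h0.1]
    have h2 : f σ = (∫ u in σ..τ, k u) + ((∫ u in τ..(b - h), k u) + ∫ u in (b - h)..b, k u) := by
      rw [intervalIntegral.integral_add_adjacent_intervals (hkc.intervalIntegrable _ _)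
        (hkc.intervalIntegrable _ _), intervalIntegral.integral_add_adjacent_intervals
        (hkc.intervalIntegrable _ _) (hkc.intervalIntegrable _ _)]
    have h3 := intervalIntegral.integral_nonneg (μ := volume) hστ fun u _ => hk0 u
    have h4 := intervalIntegral.integral_nonneg (μ := volume) (show b - h ≤ b by linarith)
      fun u _ => hk0 u
    linarith
  have hanti : ∀ {x y : ℝ}, 0 < x → x ≤ y → y ^ (-r) ≤ x ^ (-r) := fun hx hxy =>
    Real.rpow_le_rpow_of_nonpos hx hxy (by linarith)
  have hQ : a ≤ σ → 1 / r * (σ * deriv f σ) = -(σ ^ (-r) * trapezoid a b h σ) := by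
    intro haσ
    have hσ0 : 0 < σ := ha.trans_le haσ
    rw [hderiv]
    simp only [hk]
    rw [max_eq_left haσ, Real.rpow_sub_one hσ0.ne']
    field_simp
  have hQle : a ≤ σ → -(σ ^ (-r)) ≤ 1 / r * (σ * deriv f σ) := by
    intro haσ
    have hσ0 : 0 < σ := ha.trans_le haσ
    rw [hQ haσ, neg_le_neg_iff]
    exact mul_le_of_le_one_right (by positivity) (trapezoid_le_one _ _ _ _)
  have hah := hanti ha (show a ≤ a + h by linarith)
  by_cases h1 : σ < a
  · have h2 : 1 / r * (σ * deriv f σ) = 0 := by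
      rw [hderiv]
      simp [hk, trapezoid_eq_zero_left hh h1.le]
    have h3 := hlow (a + h) (by linarith) le_rfl hab
    rw [indicator_of_mem (show σ ∈ Iio a from h1),
      indicator_of_mem (show σ ∈ Iio b from by simp only [mem_Iio]; linarith), h2]
    linarith
  · rw [not_lt] at h1
    rw [indicator_of_notMem (show σ ∉ Iio a from not_lt.2 h1)]
    have h2 := hQle h1
    by_cases h3 : σ < b
    · rw [indicator_of_mem (show σ ∈ Iio b from h3)]
      rcases le_total σ (a + h) with h4 | h4
      -- On the inner ramp f is at least (a+h)^(-r) - (b-h)^(-r), while σ f'/r is only known to be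
      -- at least -a^(-r); the subtracted error term pays for the gap.
      · have h5 := hlow (a + h) h4 le_rfl hab
        have h6 := hanti ha h1
        linarith
      · rcases le_total σ (b - h) with h5 | h5
        · have h6 := hlow σ le_rfl h4 h5
          linarith
        · have h6 := hanti (by linarith) h5
          have h7 := hprof.nonneg σ
          linarith
    · rw [indicator_of_notMem (show σ ∉ Iio b from h3)]
      rw [not_lt] at h3
      have h7 := hprof.nonneg σ
      rw [hQ h1, trapezoid_eq_zero_right hh h3]
      linarith

end Profile

/-! ### Monotonicity with a perturbed exponent -/

section Monotonicity

variable {n : ℕ} {hn : 2 ≤ n} {E : Set (Euc n)} {μ : Measure (Euc n)} {Φ Ψ : Euc n → Euc n}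
  {δ : ℝ}

lemma IsC1Inverse.image_oBall_eq (hΦ : IsC1Inverse Φ Ψ) {s : ℝ} (hs : 0 ≤ s) :
    Φ '' oBall n s = {y | ‖Ψ y‖ ^ 2 < s ^ 2} := by
  rw [image_eq_preimage_of_inverse hΦ.1 hΦ.2]
  ext y
  simp [oBall, sq_lt_sq₀ (norm_nonneg _) hs]

lemma IsC1Inverse.isOpen_image_oBall (hΦ : IsC1Inverse Φ Ψ) (s : ℝ) : IsOpen (Φ '' oBall n s) := by
  rw [image_eq_preimage_of_inverse hΦ.1 hΦ.2]
  exact Metric.isOpen_ball.preimage hΦ.4.continuous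

/-- With r = m/2 and p, q the two coefficients of the first variation, p = mq, so the integrand is
-p (f + σ f'/r). Integrating the profile inequality and letting h → 0 gives the claim. Powers of s²
appear because σ stands for the squared radius. -/
theorem IsThinObstacleMinimizer.measureReal_mul_rpow_le
    (hE : IsThinObstacleMinimizer hn Φ δ E) (hμ : IsPerimeterMeasure E (oBall n 1) μ)
    {η s₁ s₂ m : ℝ} (hΦ : IsNearIdentity η Φ Ψ) (hs₁ : 0 < s₁) (hs : s₁ < s₂) (hs₂ : s₂ < 1)
    (hΦs : Φ '' Metric.closedBall 0 s₂ ⊆ oBall n 1) (hη : η * s₂ ≤ 1 / 2) (hm : 0 < m)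
    (hmdef : m * (1 + 4 * (η * s₂)) = n - 1 - 2 * (n + 1) * (η * s₂)) :
    (s₁ ^ 2) ^ (-(m / 2)) * μ.real (Φ '' oBall n s₁)
      ≤ (s₂ ^ 2) ^ (-(m / 2)) * μ.real (Φ '' oBall n s₂) := by
  have := hμ.isFiniteMeasure
  set r := m / 2 with hr
  have hr0 : 0 < r := by positivity
  have hs₂0 : 0 < s₂ := hs₁.trans hs
  have hσ : s₁ ^ 2 < s₂ ^ 2 := by gcongr
  set a := s₁ ^ 2 with ha
  set b := s₂ ^ 2 with hb
  have ha0 : 0 < a := by positivity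
  have key : ∀ h, 0 < h → a + h ≤ b - h →
      (a + h) ^ (-r) * μ.real (Φ '' oBall n s₁) - (b - h) ^ (-r) * μ.real (Φ '' oBall n s₂)
        - (a ^ (-r) - (a + h) ^ (-r)) * μ.real univ ≤ 0 := by
    intro h hh hab
    obtain ⟨f, hf, hlow⟩ := exists_radialProfile hr0 ha0 hb hh hab
    have h1 := hE.integral_firstVariation_nonneg hμ hΦ hs₂0 hs₂ hΦs hη hf
    have hq0 : 0 < 1 + 4 * (η * s₂) := by
      have := mul_nonneg hΦ.nonneg hs₂0.le
      linarith
    have hL := continuous_firstVariation (p := r) (q := 1 / 2) hf hΦ.inv.4.continuous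
    obtain ⟨M, -, hM⟩ := hf.exists_bound 1 (1 / r)
    set F : Euc n → ℝ := fun y => f (‖Ψ y‖ ^ 2) + 1 / r * (‖Ψ y‖ ^ 2 * deriv f (‖Ψ y‖ ^ 2)) with hF
    have h2 : ∀ y, firstVariation (n - 1 - 2 * (n + 1) * (η * s₂)) (1 + 4 * (η * s₂)) f Ψ y
        = (-(m * (1 + 4 * (η * s₂)))) * F y := by
      intro y
      simp only [firstVariation, hF, ← hmdef, hr]
      field_simp
      ring
    simp only [h2] at h1
    rw [integral_const_mul] at h1
    have h3 : ∫ y, F y ∂μ ≤ 0 := by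
      by_contra hpos
      rw [not_le] at hpos
      have : 0 < m * (1 + 4 * (η * s₂)) * ∫ y, F y ∂μ := by positivity
      linarith
    have hFc : Continuous F := by
      have := hf.1.continuous
      have := hf.continuous_deriv
      have := hΦ.inv.4.continuous
      simp only [hF]
      fun_prop
    have iF : Integrable F μ := Integrable.of_bound hFc.aestronglyMeasurable M
      (ae_of_all _ fun y => by
        have := hM (‖Ψ y‖ ^ 2) (by positivity)
        rwa [one_mul] at this)
    have hmeas : ∀ s, MeasurableSet (Φ '' oBall n s) := fun s =>
      (hΦ.inv.isOpen_image_oBall s).measurableSet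
    have hind : ∀ s c, 0 ≤ s → ∀ y : Euc n, (Iio (s ^ 2)).indicator (fun _ => (c : ℝ)) (‖Ψ y‖ ^ 2)
        = (Φ '' oBall n s).indicator (fun _ => c) y := by
      intro s c hs0 y
      rw [hΦ.inv.image_oBall_eq hs0]
      rfl
    have hint : ∀ s c, ∫ y, (Φ '' oBall n s).indicator (fun _ => (c : ℝ)) y ∂μ
        = c * μ.real (Φ '' oBall n s) := by
      intro s c
      rw [integral_indicator (hmeas s)]
      simp [mul_comm]
    have i1 : ∀ s c, Integrable (fun y => (Φ '' oBall n s).indicator (fun _ => (c : ℝ)) y) μ :=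
      fun s c => (integrable_const c).indicator (hmeas s)
    have h4 : ∫ y, ((Φ '' oBall n s₁).indicator (fun _ => (a + h) ^ (-r)) y
        - (Φ '' oBall n s₂).indicator (fun _ => (b - h) ^ (-r)) y
        - (a ^ (-r) - (a + h) ^ (-r))) ∂μ ≤ ∫ y, F y ∂μ := by
      refine integral_mono (((i1 _ _).sub (i1 _ _)).sub (integrable_const _)) iF fun y => ?_
      have h5 := hlow (‖Ψ y‖ ^ 2) (by positivity)
      rw [ha, hb, hind _ _ hs₁.le, hind _ _ hs₂0.le] at h5
      exact h5
    have i2 : Integrable (fun y => (Φ '' oBall n s₁).indicator (fun _ => (a + h) ^ (-r)) y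
        - (Φ '' oBall n s₂).indicator (fun _ => (b - h) ^ (-r)) y) μ := (i1 _ _).sub (i1 _ _)
    rw [integral_sub i2 (integrable_const _), integral_sub (i1 _ _) (i1 _ _), hint, hint,
      integral_const, smul_eq_mul, mul_comm (μ.real univ)] at h4
    linarith
  have hlim : Tendsto (fun h : ℝ => (a + h) ^ (-r) * μ.real (Φ '' oBall n s₁)
      - (b - h) ^ (-r) * μ.real (Φ '' oBall n s₂) - (a ^ (-r) - (a + h) ^ (-r)) * μ.real univ)
      (𝓝[>] 0) (𝓝 ((a + 0) ^ (-r) * μ.real (Φ '' oBall n s₁)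
      - (b - 0) ^ (-r) * μ.real (Φ '' oBall n s₂)
      - (a ^ (-r) - (a + 0) ^ (-r)) * μ.real univ)) := by
    refine Tendsto.mono_left ?_ nhdsWithin_le_nhds
    have t1 : Tendsto (fun h : ℝ => (a + h) ^ (-r)) (𝓝 0) (𝓝 ((a + 0) ^ (-r))) :=
      (Continuous.tendsto (by fun_prop) 0 : Tendsto (fun h : ℝ => a + h) _ _).rpow_const
        (Or.inl (by linarith))
    have t2 : Tendsto (fun h : ℝ => (b - h) ^ (-r)) (𝓝 0) (𝓝 ((b - 0) ^ (-r))) :=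
      (Continuous.tendsto (by fun_prop) 0 : Tendsto (fun h : ℝ => b - h) _ _).rpow_const
        (Or.inl (by linarith))
    exact ((t1.mul_const _).sub (t2.mul_const _)).sub ((t1.const_sub _).mul_const _)
  have hfin := le_of_tendsto hlim (by
    filter_upwards [Ioc_mem_nhdsGT (show 0 < (b - a) / 2 by linarith)] with h hh
    exact key h hh.1 (by linarith [hh.2]))
  rw [add_zero, sub_zero, sub_self, zero_mul, sub_zero] at hfin
  linarith

/-- Passing from m to n-1 costs the factor (s₂/s₁)^(n-1-m), estimated by log x ≤ x - 1. The
restriction s₂ ≤ 2 s₁ bounds the remaining ratio s₂/s₁ by 2. -/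
theorem IsThinObstacleMinimizer.measureReal_div_pow_le
    (hE : IsThinObstacleMinimizer hn Φ δ E) (hμ : IsPerimeterMeasure E (oBall n 1) μ)
    {η s₁ s₂ : ℝ} (hΦ : IsNearIdentity η Φ Ψ) (hs₁ : 0 < s₁) (hs : s₁ < s₂) (hs12 : s₂ ≤ 2 * s₁)
    (hs₂ : s₂ < 1) (hΦs : Φ '' Metric.closedBall 0 s₂ ⊆ oBall n 1) (hη : η * (8 * (n + 1)) ≤ 1) :
    μ.real (Φ '' oBall n s₁) / s₁ ^ (n - 1)
      ≤ μ.real (Φ '' oBall n s₂) / s₂ ^ (n - 1) * Real.exp (12 * n * η * (s₂ - s₁)) := by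
  have hs₂0 : 0 < s₂ := hs₁.trans hs
  have hn' : (2 : ℝ) ≤ n := by exact_mod_cast hn
  have hη0 := hΦ.nonneg
  set θ := η * s₂ with hθ
  have hθ0 : 0 ≤ θ := by positivity
  have hθη : θ ≤ η := by
    rw [hθ]
    exact mul_le_of_le_one_right hη0 hs₂.le
  have hθ1 : θ * (8 * (n + 1)) ≤ 1 := (mul_le_mul_of_nonneg_right hθη (by positivity)).trans hη
  have hq0 : 0 < 1 + 4 * θ := by positivity
  have hp0 : 0 < (n : ℝ) - 1 - 2 * (n + 1) * θ := by nlinarith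
  set m := ((n : ℝ) - 1 - 2 * (n + 1) * θ) / (1 + 4 * θ) with hm
  have hm0 : 0 < m := by positivity
  have hmdef : m * (1 + 4 * θ) = n - 1 - 2 * (n + 1) * θ := by
    rw [hm]
    field_simp
  -- Multiplied by 1 + 4θ, the left side becomes 4(n-1)θ + 2(n+1)θ = (6n-2)θ.
  have hmn : (n : ℝ) - 1 - m ≤ 6 * n * θ := by
    have h1 : ((n : ℝ) - 1 - m) * (1 + 4 * θ) ≤ 6 * n * θ * (1 + 4 * θ) := by
      have : 0 ≤ 6 * n * θ * (4 * θ) := by positivity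
      nlinarith
    exact le_of_mul_le_mul_right h1 hq0
  have hmn0 : 0 ≤ (n : ℝ) - 1 - m := by
    have h1 : 0 ≤ ((n : ℝ) - 1 - m) * (1 + 4 * θ) := by nlinarith
    exact nonneg_of_mul_nonneg_left h1 hq0
  have h1 := hE.measureReal_mul_rpow_le hμ hΦ hs₁ hs hs₂ hΦs (by nlinarith) hm0 hmdef
  have hsq : ∀ s : ℝ, 0 < s → (s ^ 2) ^ (-(m / 2)) = s ^ (-m) := by
    intro s hs0
    rw [← Real.rpow_natCast s 2, ← Real.rpow_mul hs0.le]
    congr 1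
    push_cast
    ring
  rw [hsq _ hs₁, hsq _ hs₂0] at h1
  have hpow : ∀ s : ℝ, 0 < s → s ^ (-m) = s ^ ((n : ℝ) - 1 - m) / s ^ (n - 1) := by
    intro s hs0
    rw [show -m = ((n : ℝ) - 1 - m) - ((n - 1 : ℕ) : ℝ) by
      rw [Nat.cast_sub (by omega)]; push_cast; ring, Real.rpow_sub hs0, Real.rpow_natCast]
  rw [hpow _ hs₁, hpow _ hs₂0] at h1
  have hexp : s₂ ^ ((n : ℝ) - 1 - m) ≤ s₁ ^ ((n : ℝ) - 1 - m) * Real.exp (12 * n * η * (s₂ - s₁)) := by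
    have h2 : (s₂ / s₁) ^ ((n : ℝ) - 1 - m) ≤ Real.exp (12 * n * η * (s₂ - s₁)) := by
      rw [Real.rpow_def_of_pos (by positivity), Real.exp_le_exp]
      have h3 := Real.log_le_sub_one_of_pos (show 0 < s₂ / s₁ by positivity)
      have h4 : s₂ / s₁ - 1 = (s₂ - s₁) / s₁ := by field_simp
      have h5 : 0 ≤ (s₂ - s₁) / s₁ := div_nonneg (by linarith) hs₁.le
      calc Real.log (s₂ / s₁) * ((n : ℝ) - 1 - m)
          ≤ (s₂ - s₁) / s₁ * (6 * n * θ) := by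
            rw [← h4] at h5 ⊢
            exact mul_le_mul h3 hmn hmn0 h5
        _ = 6 * n * η * (s₂ - s₁) * (s₂ / s₁) := by
            rw [hθ]
            ring
        _ ≤ 6 * n * η * (s₂ - s₁) * 2 := by
            have h6 : s₂ / s₁ ≤ 2 := by rwa [div_le_iff₀ hs₁]
            have : 0 ≤ s₂ - s₁ := by linarith
            gcongr
        _ = _ := by ring
    rw [Real.div_rpow hs₂0.le hs₁.le, div_le_iff₀ (by positivity)] at h2
    linarith
  have h6 : 0 < s₁ ^ ((n : ℝ) - 1 - m) := by positivity
  have h7 : s₁ ^ ((n : ℝ) - 1 - m) * (μ.real (Φ '' oBall n s₁) / s₁ ^ (n - 1))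
      ≤ s₁ ^ ((n : ℝ) - 1 - m) * (μ.real (Φ '' oBall n s₂) / s₂ ^ (n - 1)
        * Real.exp (12 * n * η * (s₂ - s₁))) := by
    calc s₁ ^ ((n : ℝ) - 1 - m) * (μ.real (Φ '' oBall n s₁) / s₁ ^ (n - 1))
        = s₁ ^ ((n : ℝ) - 1 - m) / s₁ ^ (n - 1) * μ.real (Φ '' oBall n s₁) := by ring
      _ ≤ s₂ ^ ((n : ℝ) - 1 - m) / s₂ ^ (n - 1) * μ.real (Φ '' oBall n s₂) := h1
      _ ≤ (s₁ ^ ((n : ℝ) - 1 - m) * Real.exp (12 * n * η * (s₂ - s₁))) / s₂ ^ (n - 1)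
          * μ.real (Φ '' oBall n s₂) := by gcongr
      _ = _ := by ring
  exact le_of_mul_le_mul_left h7 h6

end Monotonicity

/-! ### Upper density bound -/

section DensityBound

lemma exists_deriv_smoothTransition_bound :
    ∃ C : ℝ, 0 < C ∧ ∀ u, |deriv Real.smoothTransition u| ≤ C := by
  have hc : Continuous (deriv Real.smoothTransition) :=
    (Real.smoothTransition.contDiff (n := 1)).continuous_deriv le_rfl
  obtain ⟨M, hM⟩ := (isCompact_Icc (a := (0 : ℝ)) (b := 1)).exists_bound_of_continuousOn
    hc.continuousOn
  refine ⟨max M 1, by positivity, fun u => ?_⟩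
  rcases lt_or_ge u 0 with h | h
  · have : Real.smoothTransition =ᶠ[𝓝 u] fun _ => 0 := by
      filter_upwards [Iio_mem_nhds h] with v hv using
        Real.smoothTransition.zero_of_nonpos (le_of_lt hv)
    rw [this.deriv_eq]
    simp
  · rcases le_or_gt u 1 with h1 | h1
    · exact (hM u ⟨h, h1⟩).trans (le_max_left _ _)
    · have : Real.smoothTransition =ᶠ[𝓝 u] fun _ => 1 := by
        filter_upwards [Ioi_mem_nhds h1] with v hv using
          Real.smoothTransition.one_of_one_le (le_of_lt hv)
      rw [this.deriv_eq]
      simp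

lemma pow_sub_pow_le_mul {s t : ℝ} (hs : 0 < s) (hst : s ≤ t) {n : ℕ} (hn : 1 ≤ n) :
    t ^ n - s ^ n ≤ n * t ^ (n - 1) * (t - s) := by
  have ht : 0 < t := hs.trans_le hst
  -- Bernoulli's inequality for s/t.
  have h1 := one_add_mul_le_pow (show (-2 : ℝ) ≤ s / t - 1 by
    have : 0 < s / t := by positivity
    linarith) n
  rw [add_sub_cancel, div_pow, le_div_iff₀ (by positivity)] at h1
  obtain ⟨m, rfl⟩ := Nat.exists_eq_add_of_le' hn
  rw [Nat.add_sub_cancel]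
  have h2 : (1 + ((m + 1 : ℕ) : ℝ) * (s / t - 1)) * t ^ (m + 1)
      = t ^ (m + 1) + (m + 1 : ℕ) * t ^ m * (s - t) := by
    rw [pow_succ]
    field_simp
  rw [h2] at h1
  linarith

variable {n : ℕ} {hn : 2 ≤ n} {E : Set (Euc n)} {μ : Measure (Euc n)} {Φ Ψ : Euc n → Euc n}
  {δ : ℝ}

lemma IsNearIdentity.norm_fderiv_le {η : ℝ} (hΦ : IsNearIdentity η Φ Ψ) (hη : η ≤ 1 / 2)
    {x : Euc n} (hx : x ∈ oBall n 1) : ‖fderiv ℝ Φ x‖ ≤ 2 := by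
  have h1 := hΦ.norm_fderiv_sub_id_le hx
  have h2 : ‖ContinuousLinearMap.id ℝ (Euc n)‖ ≤ 1 := ContinuousLinearMap.norm_id_le
  have h3 := norm_add_le (fderiv ℝ Φ x - ContinuousLinearMap.id ℝ (Euc n))
    (ContinuousLinearMap.id ℝ (Euc n))
  rw [sub_add_cancel] at h3
  have h4 : ‖x‖ < 1 := mem_ball_zero_iff.1 hx
  nlinarith [hΦ.nonneg, norm_nonneg x]

lemma IsNearIdentity.norm_fderiv_inv_le {η : ℝ} (hΦ : IsNearIdentity η Φ Ψ) (hη : η ≤ 1 / 2)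
    {x : Euc n} (hx : x ∈ oBall n 1) : ‖fderiv ℝ Ψ (Φ x)‖ ≤ 2 := by
  refine ContinuousLinearMap.opNorm_le_bound _ zero_le_two fun v => ?_
  set w := fderiv ℝ Ψ (Φ x) v with hw
  have h1 : w = v - (fderiv ℝ Φ x - ContinuousLinearMap.id ℝ (Euc n)) w := by
    simp [hw, hΦ.inv.fderiv_apply_inv]
  have h2 : ‖fderiv ℝ Φ x - ContinuousLinearMap.id ℝ (Euc n)‖ ≤ 1 / 2 := by
    refine (hΦ.norm_fderiv_sub_id_le hx).trans ?_
    have h4 : ‖x‖ < 1 := mem_ball_zero_iff.1 hx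
    nlinarith [hΦ.nonneg, norm_nonneg x]
  have h3 : ‖w‖ ≤ ‖v‖ + 1 / 2 * ‖w‖ := by
    conv_lhs => rw [h1]
    exact (norm_sub_le _ _).trans (add_le_add_right (ContinuousLinearMap.le_of_opNorm_le _ h2 _) _)
  linarith

lemma IsNearIdentity.volume_image_annulus_le {η s t : ℝ} (hΦ : IsNearIdentity η Φ Ψ)
    (hη : η ≤ 1 / 2) (hn : 2 ≤ n) (hs : 0 < s) (hst : s < t) (ht : t < 1) :
    volume (Φ '' (oBall n t \ Metric.closedBall 0 s)) ≤ ENNReal.ofReal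
      (2 ^ n * (volume.real (oBall n 1) * (n * t ^ (n - 1) * (t - s)))) := by
  have hsub : oBall n t \ Metric.closedBall 0 s ⊆ oBall n 1 :=
    sdiff_subset.trans (Metric.ball_subset_ball ht.le)
  have hmeas : MeasurableSet (oBall n t \ Metric.closedBall 0 s) :=
    measurableSet_ball.diff measurableSet_closedBall
  have h1 := addHaar_image_le_lintegral_abs_det_fderiv (volume : Measure (Euc n)) hmeas
    fun x _ => (hΦ.inv.hasFDerivAt x).hasFDerivWithinAt
  have h2 : ∫⁻ x in oBall n t \ Metric.closedBall 0 s, ENNReal.ofReal |(fderiv ℝ Φ x).det|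
      ≤ ENNReal.ofReal (2 ^ n) * volume (oBall n t \ Metric.closedBall (0 : Euc n) s) := by
    rw [← setLIntegral_const]
    refine setLIntegral_mono measurable_const fun x hx => ENNReal.ofReal_le_ofReal ?_
    exact (abs_det_le_norm_pow _).trans (pow_le_pow_left₀ (norm_nonneg _)
      (hΦ.norm_fderiv_le hη (hsub hx)) n)
  refine h1.trans (h2.trans ?_)
  rw [ENNReal.ofReal_mul (by positivity)]
  refine mul_le_mul_right ?_ _
  have hcb : Metric.closedBall (0 : Euc n) s ⊆ oBall n t := Metric.closedBall_subset_ball hst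
  rw [← ofReal_measureReal (by
    exact ((measure_mono sdiff_subset).trans_lt measure_ball_lt_top).ne),
    measureReal_sdiff hcb measurableSet_closedBall measure_ball_lt_top.ne]
  refine ENNReal.ofReal_le_ofReal ?_
  have h3 : volume.real (oBall n t) = t ^ n * volume.real (oBall n 1) := by
    rw [Measure.real, Measure.addHaar_ball_of_pos _ _ (hs.trans hst), finrank_euclideanSpace_fin,
      ENNReal.toReal_mul, ENNReal.toReal_ofReal (pow_nonneg (hs.trans hst).le _)]
    rfl
  have h4 : volume.real (Metric.closedBall (0 : Euc n) s) = s ^ n * volume.real (oBall n 1) := by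
    rw [Measure.real, Measure.addHaar_closedBall _ _ hs.le, finrank_euclideanSpace_fin,
      ENNReal.toReal_mul, ENNReal.toReal_ofReal (pow_nonneg hs.le _)]
    rfl
  rw [h3, h4, ← sub_mul, mul_comm]
  exact mul_le_mul_of_nonneg_left (pow_sub_pow_le_mul hs hst.le (by omega)) measureReal_nonneg

/-- A substitute for the divergence theorem on Φ(B_s): a cutoff χ vanishes on Φ(B_s) and equals 1
outside Φ(B_t). The field χ g sees only the perimeter outside Φ(B_s). The terms involving the
gradient of χ are bounded by the area scale t^(n-1), independently of t - s. The last term tends to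
0 as t decreases to s. -/
lemma integral_union_image_le (hn : 2 ≤ n) (hE : NullMeasurableSet E volume)
    (hμ : IsPerimeterMeasure E (oBall n 1) μ) {η s t C₀ : ℝ} (hΦ : IsNearIdentity η Φ Ψ)
    (hη : η ≤ 1 / 2) (hs : 0 < s) (hst : s < t) (ht : t < 1)
    (hC₀ : ∀ u, |deriv Real.smoothTransition u| ≤ C₀) {g : Euc n → Euc n}
    (hg : IsTestField (oBall n 1) g) (hg1 : ∀ x, ‖g x‖ ≤ 1) {D : ℝ} (hD : ∀ x, ‖divergence g x‖ ≤ D) :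
    ∫ x in E ∪ Φ '' Metric.closedBall 0 s, divergence g x
      ≤ μ.real (Φ '' oBall n s)ᶜ + 8 * C₀ * (2 ^ n * (volume.real (oBall n 1) * n)) * t ^ (n - 1)
        + D * (2 ^ n * (volume.real (oBall n 1) * (n * t ^ (n - 1) * (t - s)))) := by
  have := hμ.isFiniteMeasure
  have ht0 : 0 < t := hs.trans hst
  set A := Φ '' (oBall n t \ Metric.closedBall 0 s) with hA
  set V := 2 ^ n * (volume.real (oBall n 1) * (n * t ^ (n - 1) * (t - s))) with hV
  have hV0 : 0 ≤ V := by
    have : 0 ≤ t - s := by linarith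
    positivity
  have hAV : volume.real A ≤ V := by
    have := hΦ.volume_image_annulus_le hη hn hs hst ht
    exact ENNReal.toReal_le_of_le_ofReal hV0 this
  have hAfin : volume A ≠ ⊤ :=
    ((hΦ.volume_image_annulus_le hη hn hs hst ht).trans_lt ENNReal.ofReal_lt_top).ne
  have himg : ∀ U : Set (Euc n), Φ '' U = Ψ ⁻¹' U := fun U =>
    image_eq_preimage_of_inverse hΦ.inv.1 hΦ.inv.2 ▸ rfl
  have hAm : MeasurableSet A := by
    rw [hA, himg]
    exact hΦ.inv.4.continuous.measurable (measurableSet_ball.diff measurableSet_closedBall)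
  have hmemA : ∀ y, y ∈ A ↔ ‖Ψ y‖ < t ∧ s < ‖Ψ y‖ := fun y => by
    rw [hA, himg]
    simp [oBall]
  have hD0 : 0 ≤ D := (norm_nonneg _).trans (hD 0)
  have hC0 : 0 ≤ C₀ := (abs_nonneg _).trans (hC₀ 0)
  have hts : 0 < t ^ 2 - s ^ 2 := by nlinarith
  set θ : ℝ → ℝ := fun σ => Real.smoothTransition ((σ - s ^ 2) / (t ^ 2 - s ^ 2)) with hθ
  have hθc : ContDiff ℝ 1 θ :=
    Real.smoothTransition.contDiff.comp ((contDiff_id.sub contDiff_const).div_const _)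
  set χ : Euc n → ℝ := fun y => θ (‖Ψ y‖ ^ 2) with hχ
  have hχc : ContDiff ℝ 1 χ := (contDiff_comp_normSq hθc).comp hΦ.inv.4
  have hχ0 : ∀ y, ‖Ψ y‖ ≤ s → χ y = 0 := fun y hy => by
    refine Real.smoothTransition.zero_of_nonpos (div_nonpos_of_nonpos_of_nonneg ?_ hts.le)
    have : ‖Ψ y‖ ^ 2 ≤ s ^ 2 := by gcongr
    linarith
  have hχ1 : ∀ y, t ≤ ‖Ψ y‖ → χ y = 1 := fun y hy => by
    refine Real.smoothTransition.one_of_one_le ?_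
    rw [le_div_iff₀ hts]
    have : t ^ 2 ≤ ‖Ψ y‖ ^ 2 := by gcongr
    linarith
  have hχnn : ∀ y, 0 ≤ χ y := fun y => Real.smoothTransition.nonneg _
  have hχle : ∀ y, χ y ≤ 1 := fun y => Real.smoothTransition.le_one _
  have hderθ : ∀ σ, |deriv θ σ| ≤ C₀ / (t ^ 2 - s ^ 2) := by
    intro σ
    have h1 : HasDerivAt θ (deriv Real.smoothTransition ((σ - s ^ 2) / (t ^ 2 - s ^ 2))
        * (1 / (t ^ 2 - s ^ 2))) σ :=
      ((Real.smoothTransition.contDiff (n := 1)).differentiable one_ne_zero _).hasDerivAt.comp σ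
        (((hasDerivAt_id σ).sub_const _).div_const _)
    rw [h1.deriv, abs_mul, abs_of_pos (show 0 < 1 / (t ^ 2 - s ^ 2) by positivity), mul_one_div]
    exact div_le_div_of_nonneg_right (hC₀ _) hts.le
  have hdχ : ∀ y v, fderiv ℝ χ y v
      = 2 * deriv θ (‖Ψ y‖ ^ 2) * inner ℝ (Ψ y) (fderiv ℝ Ψ y v) := by
    intro y v
    have h1 : HasFDerivAt χ _ y := (hasFDerivAt_comp_normSq hθc (Ψ y)).comp y
      (hΦ.inv.symm.hasFDerivAt y)
    rw [h1.fderiv]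
    simp
  have hθ0 : ∀ σ, σ < s ^ 2 ∨ t ^ 2 < σ → deriv θ σ = 0 := by
    rintro σ (h | h)
    · have : θ =ᶠ[𝓝 σ] fun _ => 0 := by
        filter_upwards [Iio_mem_nhds h] with v hv
        exact Real.smoothTransition.zero_of_nonpos (div_nonpos_of_nonpos_of_nonneg
          (by linarith [mem_Iio.1 hv]) hts.le)
      rw [this.deriv_eq, deriv_const]
    · have : θ =ᶠ[𝓝 σ] fun _ => 1 := by
        filter_upwards [Ioi_mem_nhds h] with v hv
        refine Real.smoothTransition.one_of_one_le ?_
        rw [le_div_iff₀ hts]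
        linarith [mem_Ioi.1 hv]
      rw [this.deriv_eq, deriv_const]
  have hθcd : Continuous (deriv θ) := hθc.continuous_deriv le_rfl
  have hθ0' : ∀ σ, σ ≤ s ^ 2 ∨ t ^ 2 ≤ σ → deriv θ σ = 0 := by
    have hcl : IsClosed {σ | deriv θ σ = 0} := isClosed_eq hθcd continuous_const
    rintro σ (h | h)
    · exact closure_minimal (fun v (hv : v ∈ Iio (s ^ 2)) => hθ0 v (Or.inl hv)) hcl
        (by rw [closure_Iio]; exact h)
    · exact closure_minimal (fun v (hv : v ∈ Ioi (t ^ 2)) => hθ0 v (Or.inr hv)) hcl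
        (by rw [closure_Ioi]; exact h)
  -- The derivative of χ along g is 2 θ'(|Ψ|²) ⟨Ψ, DΨ g⟩, where |Ψ| < t on the annulus and |DΨ g| ≤
  -- 2.
  set B := C₀ / (t ^ 2 - s ^ 2) * (4 * t) with hB
  have hB0 : 0 ≤ B := by positivity
  have hgrad : ∀ y, |fderiv ℝ χ y (g y)| ≤ A.indicator (fun _ => B) y := by
    intro y
    rw [hdχ]
    by_cases hy : y ∈ A
    · rw [indicator_of_mem hy]
      have hy' := (hmemA y).1 hy
      obtain ⟨x, rfl⟩ : ∃ x, y = Φ x := ⟨Ψ y, (hΦ.inv.2 y).symm⟩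
      rw [hΦ.inv.1 x] at *
      have h2 := hΦ.norm_fderiv_inv_le hη (mem_ball_zero_iff.2 (hy'.1.trans ht))
      have h3 : ‖fderiv ℝ Ψ (Φ x) (g (Φ x))‖ ≤ 2 :=
        (ContinuousLinearMap.le_of_opNorm_le _ h2 _).trans (by linarith [hg1 (Φ x)])
      have h4 : |inner ℝ x (fderiv ℝ Ψ (Φ x) (g (Φ x)))| ≤ t * 2 :=
        (abs_real_inner_le_norm _ _).trans (mul_le_mul hy'.1.le h3 (norm_nonneg _) ht0.le)
      rw [abs_mul, abs_mul, abs_two]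
      calc 2 * |deriv θ (‖x‖ ^ 2)| * |inner ℝ x (fderiv ℝ Ψ (Φ x) (g (Φ x)))|
          ≤ 2 * (C₀ / (t ^ 2 - s ^ 2)) * (t * 2) := by
            have := hderθ (‖x‖ ^ 2)
            gcongr
        _ = B := by
          rw [hB]
          ring
    · rw [indicator_of_notMem hy, hθ0' _ ?_]
      · simp
      · rw [hmemA, not_and_or, not_lt, not_lt] at hy
        rcases hy with h | h
        · right
          gcongr
        · left
          gcongr
  have iA : ∀ c : ℝ, Integrable (A.indicator fun _ => c) := fun c =>
    (integrable_indicator_iff hAm).2 (integrableOn_const hAfin)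
  have hintA : ∀ c : ℝ, ∫ y, A.indicator (fun _ => c) y = c * volume.real A := fun c => by
    rw [integral_indicator hAm]
    simp [mul_comm]
  have hcont := hχc.continuous_fderiv one_ne_zero
  have igrad : Integrable fun y => fderiv ℝ χ y (g y) :=
    (hcont.clm_apply hg.continuous).integrable_of_hasCompactSupport
      (HasCompactSupport.intro hg.2 fun y hy => by
        rw [image_eq_zero_of_notMem_tsupport hy, map_zero])
  have hgradint : ∫ y, |fderiv ℝ χ y (g y)| ≤ B * V := by
    refine (integral_mono igrad.abs (iA B) hgrad).trans ?_
    rw [hintA]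
    exact mul_le_mul_of_nonneg_left hAV hB0
  -- The width t - s in the volume of the annulus cancels the same factor of t² - s².
  have hBV : B * V ≤ 4 * C₀ * (2 ^ n * (volume.real (oBall n 1) * n)) * t ^ (n - 1) := by
    have h1 : t / (t ^ 2 - s ^ 2) * (t - s) ≤ 1 := by
      rw [div_mul_eq_mul_div, div_le_one hts]
      nlinarith
    have h2 : B * V = 4 * C₀ * (2 ^ n * (volume.real (oBall n 1) * n)) * t ^ (n - 1)
        * (t / (t ^ 2 - s ^ 2) * (t - s)) := by
      rw [hB, hV]
      ring
    rw [h2]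
    exact mul_le_of_le_one_right (by positivity) h1
  have idiv := hg.integrable_divergence
  have hF : NullMeasurableSet (E ∪ Φ '' Metric.closedBall 0 s) volume := by
    refine hE.union (MeasurableSet.nullMeasurableSet ?_)
    rw [himg]
    exact hΦ.inv.4.continuous.measurable measurableSet_closedBall
  have iχ : Integrable fun y => χ y * divergence g y :=
    (hχc.continuous.mul (continuous_divergence hg.1)).integrable_of_hasCompactSupport
      (hasCompactSupport_divergence hg.2).mul_left
  -- The integrands 1_(E ∪ Φ(B_s)) div g and 1_E χ div g + (1 - χ) div g agree off the annulus; on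
  -- it D absorbs the difference.
  have hsplit : ∫ x in E ∪ Φ '' Metric.closedBall 0 s, divergence g x
      ≤ (∫ x in E, χ x * divergence g x) + (∫ x, (divergence g x - χ x * divergence g x))
        + D * V := by
    have iD := iA D
    rw [← integral_indicator₀ hF, ← integral_indicator₀ hE]
    have h1 : ∫ x, (E ∪ Φ '' Metric.closedBall 0 s).indicator (divergence g) x
        ≤ ∫ x, (E.indicator (fun x => χ x * divergence g x) x
          + (divergence g x - χ x * divergence g x) + A.indicator (fun _ => D) x) := by
      refine integral_mono (idiv.indicator₀ hF)
        (((iχ.indicator₀ hE).add (idiv.sub iχ)).add iD) fun y => ?_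
      simp only
      have hyK : y ∈ Φ '' Metric.closedBall 0 s ↔ ‖Ψ y‖ ≤ s := by
        rw [himg]
        simp
      by_cases hyA : y ∈ A
      · rw [indicator_of_mem hyA]
        have hnot : y ∉ Φ '' Metric.closedBall 0 s := by
          rw [hyK, not_le]
          exact ((hmemA y).1 hyA).2
        have hd := abs_le.1 (hD y)
        have h0 := hχnn y
        have h1 := hχle y
        by_cases hyE : y ∈ E
        · rw [indicator_of_mem (show y ∈ E ∪ Φ '' Metric.closedBall 0 s from Or.inl hyE), indicator_of_mem hyE]
          linarith
        · rw [indicator_of_notMem (by simp [hyE, hnot]), indicator_of_notMem hyE]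
          nlinarith
      · rw [indicator_of_notMem hyA]
        rw [hmemA, not_and_or, not_lt, not_lt] at hyA
        rcases hyA with h | h
        · have hnot : y ∉ Φ '' Metric.closedBall 0 s := by
            rw [hyK, not_le]
            linarith
          by_cases hyE : y ∈ E
          · rw [indicator_of_mem (show y ∈ E ∪ Φ '' Metric.closedBall 0 s from Or.inl hyE), indicator_of_mem hyE, hχ1 y h]
            linarith
          · rw [indicator_of_notMem (by simp [hyE, hnot]), indicator_of_notMem hyE, hχ1 y h]
            linarith
        · rw [indicator_of_mem (show y ∈ E ∪ Φ '' Metric.closedBall 0 s from Or.inr (hyK.2 h)), hχ0 y h]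
          by_cases hyE : y ∈ E
          · rw [indicator_of_mem hyE, hχ0 y h]
            linarith
          · rw [indicator_of_notMem hyE]
            linarith
    have i3 : Integrable (E.indicator fun x => χ x * divergence g x) :=
      iχ.indicator₀ hE
    have i4 : Integrable fun x => E.indicator (fun x => χ x * divergence g x) x
          + (divergence g x - χ x * divergence g x) := i3.add (idiv.sub iχ)
    have i5 : Integrable fun x => divergence g x - χ x * divergence g x := idiv.sub iχ
    rw [integral_add i4 iD, integral_add i3 i5, hintA] at h1
    have h2 : D * volume.real A ≤ D * V := mul_le_mul_of_nonneg_left hAV hD0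
    linarith
  have hfield : IsTestField (oBall n 1) fun y => χ y • g y := hg.smul hχc
  have h1 : ∫ x, (divergence g x - χ x * divergence g x) = ∫ x, fderiv ℝ χ x (g x) := by
    rw [integral_sub idiv iχ, integral_divergence_eq_zero hg.1 hg.2,
      integral_mul_divergence hχc hg.1 hg.2]
    ring
  have h2 : ∫ x in E, χ x * divergence g x
      = (∫ x in E, divergence (fun y => χ y • g y) x) - ∫ x in E, fderiv ℝ χ x (g x) := by
    rw [← integral_sub hfield.integrable_divergence.integrableOn igrad.integrableOn]
    congr 1
    funext x
    rw [divergence_smul (hχc.differentiable one_ne_zero x) (hg.differentiableAt x)]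
    ring
  have h3 : ∫ x in E, divergence (fun y => χ y • g y) x ≤ μ.real (Φ '' oBall n s)ᶜ := by
    refine (hμ.integral_divergence_le hfield).trans ?_
    have hm : MeasurableSet (Φ '' oBall n s)ᶜ := (hΦ.inv.isOpen_image_oBall s).measurableSet.compl
    have h4 : ∫ y, (Φ '' oBall n s)ᶜ.indicator (fun _ => (1 : ℝ)) y ∂μ
        = μ.real (Φ '' oBall n s)ᶜ := by
      rw [integral_indicator hm]
      simp
    rw [← h4]
    refine integral_mono (hfield.continuous.integrable_of_hasCompactSupport hfield.2).norm
      ((integrable_const _).indicator hm) fun y => ?_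
    simp only [norm_smul, Real.norm_of_nonneg (hχnn y)]
    by_cases hy : y ∈ Φ '' oBall n s
    · rw [hχ0, zero_mul]
      · exact indicator_nonneg (fun _ _ => zero_le_one) _
      · rw [himg] at hy
        exact (mem_ball_zero_iff.1 hy).le
    · rw [indicator_of_mem hy]
      exact mul_le_one₀ (hχle y) (norm_nonneg _) (hg1 y)
  have h5 : ∫ x, fderiv ℝ χ x (g x) ≤ ∫ y, |fderiv ℝ χ y (g y)| :=
    integral_mono igrad igrad.abs fun y => le_abs_self _
  have h6 : -∫ x in E, fderiv ℝ χ x (g x) ≤ ∫ y, |fderiv ℝ χ y (g y)| := by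
    rw [← integral_neg]
    refine (integral_mono igrad.neg.integrableOn igrad.abs.integrableOn fun y =>
      neg_le_abs _).trans ?_
    exact setIntegral_le_integral igrad.abs (ae_of_all _ fun y => abs_nonneg _)
  linarith

/-- Filling in Φ(B_s) is an admissible competitor, and its perimeter is at most μ of the complement
of Φ(B_s) plus C s^(n-1). -/
theorem exists_density_bound (n : ℕ) (hn : 2 ≤ n) : ∃ C : ℝ, 0 < C ∧
    ∀ (E : Set (Euc n)) (μ : Measure (Euc n)) (Φ Ψ : Euc n → Euc n) (δ η s : ℝ),
      IsThinObstacleMinimizer hn Φ δ E → IsPerimeterMeasure E (oBall n 1) μ →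
      IsNearIdentity η Φ Ψ → η ≤ 1 / 2 → 0 < s → s < 1 →
      Φ '' Metric.closedBall 0 s ⊆ oBall n 1 →
      μ.real (Φ '' oBall n s) ≤ C * s ^ (n - 1) := by
  obtain ⟨C₀, hC₀, hbd⟩ := exists_deriv_smoothTransition_bound
  have hω : 0 < volume.real (oBall n 1) :=
    ENNReal.toReal_pos (Metric.measure_ball_pos _ _ one_pos).ne' measure_ball_lt_top.ne
  have hn0 : (0 : ℝ) < n := by
    have : 0 < n := by omega
    exact_mod_cast this
  set C := 8 * C₀ * (2 ^ n * (volume.real (oBall n 1) * n)) with hC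
  refine ⟨C, by positivity, fun E μ Φ Ψ δ η s hE hμ hΦ hη hs0 hs1 hΦs => ?_⟩
  have := hμ.isFiniteMeasure
  have hK : IsCompact (Φ '' Metric.closedBall 0 s) :=
    (isCompact_closedBall 0 s).image hΦ.inv.3.continuous
  have hmin := hE.perimeter_le (E ∪ Φ '' Metric.closedBall 0 s)
    (hE.measurable.union hK.isClosed.measurableSet.nullMeasurableSet)
    ⟨_, hK, hΦs, by rw [union_sdiff_right]⟩
    (hE.obstacle_subset.trans subset_union_left)
  have hper : perimeter (E ∪ Φ '' Metric.closedBall 0 s) (oBall n 1)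
      ≤ ENNReal.ofReal (μ.real (Φ '' oBall n s)ᶜ + C * s ^ (n - 1)) := by
    refine perimeter_le fun g hg hg1 => ENNReal.ofReal_le_ofReal ?_
    obtain ⟨D, hD⟩ := (hasCompactSupport_divergence hg.2).exists_bound_of_continuous
      (continuous_divergence hg.1)
    -- The bound D depends on the test field, so t decreases to s while g is fixed.
    have hlim : Tendsto (fun t : ℝ => μ.real (Φ '' oBall n s)ᶜ + C * t ^ (n - 1)
        + D * (2 ^ n * (volume.real (oBall n 1) * (n * t ^ (n - 1) * (t - s))))) (𝓝[>] s)
        (𝓝 (μ.real (Φ '' oBall n s)ᶜ + C * s ^ (n - 1)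
        + D * (2 ^ n * (volume.real (oBall n 1) * (n * s ^ (n - 1) * (s - s)))))) :=
      (Continuous.tendsto (by fun_prop) s).mono_left nhdsWithin_le_nhds
    rw [sub_self, mul_zero, mul_zero, mul_zero, mul_zero, add_zero] at hlim
    refine ge_of_tendsto hlim ?_
    filter_upwards [Ioo_mem_nhdsGT hs1] with t ht
    exact integral_union_image_le hn hE.measurable hμ hΦ hη hs0 ht.1 ht.2 hbd hg hg1 hD
  have h1 := hmin.trans hper
  rw [← hμ.measure_univ, ← ofReal_measureReal (measure_ne_top _ _),
    ENNReal.ofReal_le_ofReal_iff (by positivity)] at h1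
  have h2 := measureReal_add_measureReal_compl (μ := μ) (hΦ.inv.isOpen_image_oBall s).measurableSet
  linarith

end DensityBound

/-! ### Almost monotonicity and its consequences for the derivative -/

section AlmostMonotonicity

variable {n : ℕ} {hn : 2 ≤ n} {E : Set (Euc n)} {μ : Measure (Euc n)} {Φ Ψ : Euc n → Euc n}
  {δ : ℝ}

lemma IsPerimeterMeasure.normPerimeter_eq (hμ : IsPerimeterMeasure E (oBall n 1) μ)
    (hΦ : IsC1Inverse Φ Ψ) {r : ℝ} (hr : Φ '' oBall n r ⊆ oBall n 1) :
    normPerimeter Φ E r = μ.real (Φ '' oBall n r) / r ^ (n - 1) := by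
  rw [normPerimeter, Measure.real, hμ.measure_eq _ (hΦ.isOpen_image_oBall r),
    inter_eq_self_of_subset_left hr]

/-- The radii for which the deformed ball stays inside the unit ball. -/
def admissibleRadii (Φ : Euc n → Euc n) : Set ℝ :=
  {r : ℝ | 0 < r ∧ r < 1 ∧ Φ '' oBall n r ⊆ oBall n 1}

lemma mem_admissibleRadii_of_le {r s : ℝ} (hr : r ∈ admissibleRadii Φ) (hs : 0 < s) (hsr : s ≤ r) :
    s ∈ admissibleRadii Φ :=
  ⟨hs, hsr.trans_lt hr.2.1, (image_mono (Metric.ball_subset_ball hsr)).trans hr.2.2⟩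

/-- Since A ≤ M by the density bound, the factor e^z with z = 12nη(s₂-s₁) costs at most 2Mz =
24nMη(s₂-s₁), whence the constant. -/
theorem exists_monotoneOn_normPerimeter_add (n : ℕ) (hn : 2 ≤ n) : ∃ C : ℝ, 0 < C ∧
    ∀ (E : Set (Euc n)) (Φ Ψ : Euc n → Euc n) (δ η : ℝ),
      IsThinObstacleMinimizer hn Φ δ E → IsNearIdentity η Φ Ψ → η * (8 * (n + 1)) ≤ 1 →
      MonotoneOn (fun r => normPerimeter Φ E r + C * η * r) (admissibleRadii Φ) := by
  obtain ⟨M, hM, hbd⟩ := exists_density_bound n hn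
  have hn' : (2 : ℝ) ≤ n := by exact_mod_cast hn
  refine ⟨24 * n * M, by positivity, fun E Φ Ψ δ η hE hΦ hη => ?_⟩
  obtain ⟨μ, hμ⟩ := exists_isPerimeterMeasure (E := E) (Metric.isOpen_ball (x := (0 : Euc n)) (ε := 1))
    hE.finite_perimeter.ne
  have := hμ.isFiniteMeasure
  have hη0 := hΦ.nonneg
  have hη2 : η ≤ 1 / 2 := by nlinarith
  have hηn : n * η * 8 ≤ 1 := by nlinarith
  set A : ℝ → ℝ := fun r => μ.real (Φ '' oBall n r) / r ^ (n - 1) with hA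
  have hsub : ∀ {r s : ℝ}, r ≤ s → Φ '' Metric.closedBall 0 s ⊆ oBall n 1 →
      Φ '' Metric.closedBall 0 r ⊆ oBall n 1 := fun h h' =>
    (image_mono (Metric.closedBall_subset_closedBall h)).trans h'
  have hstep : ∀ s₁ s₂ : ℝ, 0 < s₁ → s₁ < s₂ → s₂ ≤ 2 * s₁ → s₂ < 1 →
      Φ '' Metric.closedBall 0 s₂ ⊆ oBall n 1 →
      A s₁ + 24 * n * M * η * s₁ ≤ A s₂ + 24 * n * M * η * s₂ := by
    intro s₁ s₂ h1 h12 h2 hs2 hΦs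
    have h3 := hE.measureReal_div_pow_le hμ hΦ h1 h12 h2 hs2 hΦs hη
    have h0 : 0 < s₂ := h1.trans h12
    have h4 : A s₂ ≤ M := by
      rw [hA]
      simp only
      rw [div_le_iff₀ (by positivity)]
      exact hbd E μ Φ Ψ δ η s₂ hE hμ hΦ hη2 h0 hs2 hΦs
    have hA0 : 0 ≤ A s₂ := by positivity
    set z := 12 * n * η * (s₂ - s₁) with hz
    have hz0 : 0 ≤ z := by
      have : 0 ≤ s₂ - s₁ := by linarith
      positivity
    have hz1 : z ≤ 1 := by
      have : 12 * n * η * (s₂ - s₁) ≤ 12 * n * η * (1 / 2) :=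
        mul_le_mul_of_nonneg_left (by linarith) (by positivity)
      linarith
    have h5 := (abs_le.1 (Real.abs_exp_sub_one_le (x := z) (by rwa [abs_of_nonneg hz0]))).2
    rw [abs_of_nonneg hz0] at h5
    have h6 : A s₂ * Real.exp z ≤ A s₂ + M * (2 * z) := by
      have h7 : A s₂ * (Real.exp z - 1) ≤ M * (2 * z) :=
        mul_le_mul h4 h5 (by linarith [Real.one_le_exp hz0]) hM.le
      linarith
    have h8 : A s₁ ≤ A s₂ * Real.exp z := h3
    have h9 : M * (2 * z) = 24 * n * M * η * s₂ - 24 * n * M * η * s₁ := by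
      rw [hz]
      ring
    linarith
  -- The restriction s₂ ≤ 2 s₁ is removed by doubling the smaller radius; the additive errors
  -- telescope.
  have hchain : ∀ k : ℕ, ∀ s₁ s₂ : ℝ, 0 < s₁ → s₁ < s₂ → s₂ ≤ 2 ^ k * s₁ → s₂ < 1 →
      Φ '' Metric.closedBall 0 s₂ ⊆ oBall n 1 →
      A s₁ + 24 * n * M * η * s₁ ≤ A s₂ + 24 * n * M * η * s₂ := by
    intro k
    induction k with
    | zero =>
      intro s₁ s₂ h1 h12 h2
      rw [pow_zero, one_mul] at h2
      exact absurd h12 (not_lt.2 h2)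
    | succ k ih =>
      intro s₁ s₂ h1 h12 h2 hs2 hΦs
      rcases le_or_gt s₂ (2 * s₁) with h | h
      · exact hstep s₁ s₂ h1 h12 h hs2 hΦs
      · exact (hstep s₁ (2 * s₁) h1 (by linarith) le_rfl (h.trans hs2) (hsub h.le hΦs)).trans
          (ih (2 * s₁) s₂ (by linarith) h (by rw [pow_succ] at h2; linarith) hs2 hΦs)
  intro r₁ hr₁ r₂ hr₂ hr
  rcases eq_or_lt_of_le hr with rfl | hr
  · exact le_rfl
  simp only
  rw [hμ.normPerimeter_eq hΦ.inv hr₁.2.2, hμ.normPerimeter_eq hΦ.inv hr₂.2.2]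
  -- The image of the closed ball of radius r₂ may leave the unit ball, so r₂ is approached from
  -- below. Keeping the larger measure, that of Φ(B_{r₂}), in the numerator avoids any continuity of
  -- μ.
  have hlim : Tendsto (fun s : ℝ => μ.real (Φ '' oBall n r₂) / s ^ (n - 1) + 24 * n * M * η * s)
      (𝓝[<] r₂) (𝓝 (μ.real (Φ '' oBall n r₂) / r₂ ^ (n - 1) + 24 * n * M * η * r₂)) := by
    refine Tendsto.mono_left ?_ nhdsWithin_le_nhds
    refine Tendsto.add (tendsto_const_nhds.div ((continuous_pow _).tendsto _) ?_)
      ((continuous_const_mul _).tendsto _)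
    exact (pow_pos hr₂.1 _).ne'
  refine ge_of_tendsto hlim ?_
  filter_upwards [Ioo_mem_nhdsLT hr] with s hs
  obtain ⟨k, hk⟩ := pow_unbounded_of_one_lt (s / r₁) (one_lt_two (α := ℝ))
  have hcb : Φ '' Metric.closedBall 0 s ⊆ Φ '' oBall n r₂ :=
    image_mono (Metric.closedBall_subset_ball hs.2)
  have hs0 := hr₁.1.trans hs.1
  have h1 := hchain k r₁ s hr₁.1 hs.1 ((div_le_iff₀ hr₁.1).1 hk.le) (hs.2.trans hr₂.2.1)
    (hcb.trans hr₂.2.2)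
  refine h1.trans (add_le_add_left ?_ _)
  refine div_le_div_of_nonneg_right (measureReal_mono ?_) (by positivity)
  exact image_mono (Metric.ball_subset_ball hs.2.le)

/-- Monotonicity to the left of r is enough; r may be the largest admissible radius. -/
lemma nonneg_of_hasDerivAt_of_monotoneOn {f : ℝ → ℝ} {a r s : ℝ} (hs : s < r)
    (hf : MonotoneOn f (Ioc s r)) (hd : HasDerivAt f a r) : 0 ≤ a := by
  have h1 : derivWithin f (Ioc s r) r = a :=
    hd.hasDerivWithinAt.derivWithin (uniqueDiffOn_Ioc s r r ⟨hs, le_rfl⟩)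
  rw [← h1]
  exact hf.derivWithin_nonneg

/-- The admissible radii form an interval; all of them except possibly a greatest one are interior.
-/
lemma ae_differentiableAt_of_monotoneOn_admissibleRadii {f : ℝ → ℝ}
    (hf : MonotoneOn f (admissibleRadii Φ)) :
    ∀ᵐ r : ℝ, r ∈ admissibleRadii Φ → DifferentiableAt ℝ f r := by
  have h1 := hf.ae_differentiableWithinAt_of_mem
  have h2 : volume {r | IsGreatest (admissibleRadii Φ) r} = 0 :=
    Set.Subsingleton.measure_zero (fun r hr s hs => hr.unique hs) _
  filter_upwards [h1, measure_eq_zero_iff_ae_notMem.1 h2] with r hr hg hrS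
  refine (hr hrS).differentiableAt ?_
  obtain ⟨s, hs, hrs⟩ : ∃ s ∈ admissibleRadii Φ, r < s := by
    by_contra! h
    exact hg ⟨hrS, fun s hs => h s hs⟩
  filter_upwards [Ioo_mem_nhds hrS.1 hrs] with t ht
  exact mem_admissibleRadii_of_le hs ht.1 ht.2.le

/-- The conclusions of the monotonicity formula that follow from the monotonicity of
`A_E(r) + c r`. -/
lemma derivative_bounds_of_monotoneOn {c : ℝ}
    (hf : MonotoneOn (fun r => normPerimeter Φ E r + c * r) (admissibleRadii Φ)) :
    (∀ r ∈ admissibleRadii Φ, ∀ a : ℝ, HasDerivAt (normPerimeter Φ E) a r → -c ≤ a) ∧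
    ∀ᵐ r : ℝ, r ∈ admissibleRadii Φ → DifferentiableAt ℝ (normPerimeter Φ E) r := by
  refine ⟨fun r hr a ha => ?_, ?_⟩
  · have h1 : HasDerivAt (fun r => normPerimeter Φ E r + c * r) (a + c * 1) r :=
      ha.add ((hasDerivAt_id r).const_mul c)
    have h2 := nonneg_of_hasDerivAt_of_monotoneOn (half_lt_self hr.1)
      (hf.mono fun s hs => mem_admissibleRadii_of_le hr ((half_pos hr.1).trans hs.1) hs.2) h1
    linarith
  · filter_upwards [ae_differentiableAt_of_monotoneOn_admissibleRadii hf] with r hr hrS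
    have h1 := (hr hrS).sub ((differentiableAt_id (𝕜 := ℝ)).const_mul c)
    refine h1.congr_of_eventuallyEq (Eventually.of_forall fun s => ?_)
    simp

lemma isNearIdentity_id : IsNearIdentity 0 (id : Euc n → Euc n) id :=
  ⟨⟨fun _ => rfl, fun _ => rfl, contDiff_id, contDiff_id⟩, le_rfl, fderiv_id,
    fun x _ y _ => by simp⟩

lemma admissibleRadii_id : admissibleRadii (id : Euc n → Euc n) = Ioo 0 1 := by
  ext r
  simp only [admissibleRadii, image_id, mem_ofPred_eq, mem_Ioo]
  exact ⟨fun h => ⟨h.1, h.2.1⟩, fun h => ⟨h.1, h.2, Metric.ball_subset_ball h.2.le⟩⟩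

end AlmostMonotonicity

/-! ### Scaling of the perimeter and cones -/

section Scaling

variable {n : ℕ} {E Ω : Set (Euc n)}

lemma divergence_comp_smul {g : Euc n → Euc n} (hg : ContDiff ℝ 1 g) (c : ℝ) (x : Euc n) :
    divergence (fun y => g (c • y)) x = c * divergence g (c • x) := by
  have h : HasFDerivAt (fun y => g (c • y))
      ((fderiv ℝ g (c • x)).comp (c • ContinuousLinearMap.id ℝ (Euc n))) x :=
    ((hg.differentiable one_ne_zero (c • x)).hasFDerivAt).comp x ((hasFDerivAt_id x).const_smul c)
  simp only [divergence, h.fderiv, Finset.mul_sum]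
  simp

lemma IsTestField.comp_smul {g : Euc n → Euc n} {c : ℝ} (hc : 0 < c)
    (hg : IsTestField (c • Ω) g) : IsTestField Ω fun x => g (c • x) := by
  have hsupp : tsupport (fun x => g (c • x)) = (fun x => c • x) ⁻¹' tsupport g :=
    tsupport_comp_eq_preimage g (Homeomorph.smulOfNeZero c hc.ne')
  refine ⟨hg.1.comp (contDiff_const_smul c),
    hg.2.comp_homeomorph (Homeomorph.smulOfNeZero c hc.ne'), ?_⟩
  rw [hsupp]
  intro x hx
  exact (smul_mem_smul_set_iff₀ hc.ne' _ _).1 (hg.3 hx)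

lemma perimeter_smul_le (hn : 1 ≤ n) {c : ℝ} (hc : 0 < c) :
    perimeter (c • E) (c • Ω) ≤ ENNReal.ofReal (c ^ (n - 1)) * perimeter E Ω := by
  refine perimeter_le_of_abs fun g hg hg1 => ?_
  have h1 := Measure.setIntegral_comp_smul_of_pos (volume : Measure (Euc n)) (divergence g) E hc
  rw [finrank_euclideanSpace_fin, smul_eq_mul, eq_inv_mul_iff_mul_eq₀ (by positivity)] at h1
  have h2 : ∫ x in E, divergence (fun y => g (c • y)) x = c * ∫ x in E, divergence g (c • x) := by
    simp_rw [divergence_comp_smul hg.1]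
    exact integral_const_mul _ _
  have h3 : ∫ x in c • E, divergence g x
      = c ^ (n - 1) * ∫ x in E, divergence (fun y => g (c • y)) x := by
    rw [h2, ← h1, ← mul_assoc, pow_sub_one_mul (by omega)]
  rw [h3, abs_mul, abs_of_pos (by positivity), ENNReal.ofReal_mul (by positivity)]
  exact mul_le_mul_right (le_perimeter (hg.comp_smul hc) fun x => hg1 _) _

lemma perimeter_smul (hn : 1 ≤ n) {c : ℝ} (hc : 0 < c) :
    perimeter (c • E) (c • Ω) = ENNReal.ofReal (c ^ (n - 1)) * perimeter E Ω := by
  refine le_antisymm (perimeter_smul_le hn hc) ?_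
  have h1 := perimeter_smul_le (E := c • E) (Ω := c • Ω) hn (inv_pos.2 hc)
  rw [inv_smul_smul₀ hc.ne', inv_smul_smul₀ hc.ne'] at h1
  calc ENNReal.ofReal (c ^ (n - 1)) * perimeter E Ω
      ≤ ENNReal.ofReal (c ^ (n - 1))
        * (ENNReal.ofReal (c⁻¹ ^ (n - 1)) * perimeter (c • E) (c • Ω)) := by gcongr
    _ = perimeter (c • E) (c • Ω) := by
      rw [← mul_assoc, ← ENNReal.ofReal_mul (by positivity), ← mul_pow, mul_inv_cancel₀ hc.ne']
      simp

theorem IsConeIn.normPerimeter_eq (hn : 2 ≤ n) (h : IsConeIn E (oBall n 1)) {r : ℝ}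
    (hr : r ∈ Ioo (0 : ℝ) 1) : normPerimeter id E r = (perimeter E (oBall n 1)).toReal := by
  obtain ⟨C, hC, hEC⟩ := h
  have hsub : oBall n r ⊆ oBall n 1 := Metric.ball_subset_ball hr.2.le
  have h1 : perimeter E (oBall n 1) = perimeter C (oBall n 1) :=
    perimeter_congr hEC measurableSet_ball
  have h2 : perimeter E (oBall n r) = perimeter C (oBall n r) := by
    refine perimeter_congr ?_ measurableSet_ball
    have h3 := hEC.inter (EventuallyEq.refl (ae volume) (oBall n r))
    rwa [inter_assoc, inter_assoc, inter_eq_self_of_subset_right hsub] at h3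
  have h3 : r • oBall n 1 = oBall n r := by
    rw [smul_ball hr.1.ne', smul_zero, Real.norm_of_nonneg hr.1.le, mul_one]
  have h4 := perimeter_smul (E := C) (Ω := oBall n 1) (by omega) hr.1
  rw [hC r hr.1, h3] at h4
  have h0 : 0 < r ^ (n - 1) := pow_pos hr.1 _
  rw [normPerimeter, image_id, h1, h2, h4, ENNReal.toReal_mul, ENNReal.toReal_ofReal h0.le,
    mul_div_cancel_left₀ _ h0.ne']

end Scaling

/-! ### From a vanishing radial derivative to a cone -/

section ConeOfDilation

variable {n : ℕ} {E : Set (Euc n)}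

lemma divergence_id (x : Euc n) : divergence (fun x : Euc n => x) x = n := by
  have : HasFDerivAt (fun x : Euc n => x) (ContinuousLinearMap.id ℝ (Euc n)) x := hasFDerivAt_id x
  simp [divergence, this.fderiv]

lemma divergence_smul_self {h : Euc n → ℝ} (hh : ContDiff ℝ 1 h) (x : Euc n) :
    divergence (fun x => h x • x) x = n * h x + fderiv ℝ h x x := by
  rw [divergence_smul (g := fun x => x) (hh.differentiable one_ne_zero x) differentiableAt_id,
    divergence_id]
  ring

/-- If the radial derivative of `1_E` vanishes weakly in the unit ball, then the integral over `E`
of the dilations of a function supported in the ball does not depend on the factor. -/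
lemma setIntegral_dilation_eq
    (h0 : ∀ h : Euc n → ℝ, ContDiff ℝ 1 h → HasCompactSupport h → tsupport h ⊆ oBall n 1 →
      ∫ x in E, divergence (fun x => h x • x) x = 0)
    {h : Euc n → ℝ} (hh : ContDiff ℝ 1 h) (hc : HasCompactSupport h) (hs : tsupport h ⊆ oBall n 1)
    {c : ℝ} (hc1 : 1 ≤ c) : c ^ n * ∫ x in E, h (c • x) = ∫ x in E, h x := by
  have hDc : Continuous (fderiv ℝ h) := hh.continuous_fderiv one_ne_zero
  obtain ⟨M, hM⟩ := hc.exists_bound_of_continuous hh.continuous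
  obtain ⟨D, hD⟩ := (hc.fderiv (𝕜 := ℝ)).exists_bound_of_continuous hDc
  have hM0 : 0 ≤ M := (norm_nonneg _).trans (hM 0)
  have hD0 : 0 ≤ D := (norm_nonneg _).trans (hD 0)
  set F : ℝ → Euc n → ℝ := fun a x => a ^ n * h (a • x) with hF
  set F' : ℝ → Euc n → ℝ :=
    fun a x => n * a ^ (n - 1) * h (a • x) + a ^ n * fderiv ℝ h (a • x) x with hF'
  have hcomp : ∀ a : ℝ, 0 < a → HasCompactSupport fun x => h (a • x) := fun a ha =>
    hc.comp_homeomorph (Homeomorph.smulOfNeZero a ha.ne')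
  have hcompd : ∀ a : ℝ, ContDiff ℝ 1 fun x => h (a • x) := fun a =>
    hh.comp (contDiff_const_smul a)
  -- The derivative of a^n h(ax) in a is a^(n-1) div(h(ax) x). For a ≥ 1 the support of h(a·) stays
  -- in the unit ball, so the hypothesis applies.
  have hzero : ∀ a : ℝ, 1 ≤ a → ∫ x in E, F' a x = 0 := by
    intro a ha
    have ha0 : 0 < a := one_pos.trans_le ha
    have hsupp : tsupport (fun x => h (a • x)) = (fun x => a • x) ⁻¹' tsupport h :=
      tsupport_comp_eq_preimage h (Homeomorph.smulOfNeZero a ha0.ne')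
    have h1 := h0 (fun x => h (a • x)) (hcompd a) (hcomp a ha0) (by
      rw [hsupp]
      intro x hx
      have h2 := mem_ball_zero_iff.1 (hs hx)
      rw [norm_smul, Real.norm_of_nonneg ha0.le] at h2
      rw [mem_ball_zero_iff]
      nlinarith [norm_nonneg x])
    have h2 : ∀ x, F' a x = a ^ (n - 1) * divergence (fun x => h (a • x) • x) x := by
      intro x
      have hd : HasFDerivAt (fun y => h (a • y))
          ((fderiv ℝ h (a • x)).comp (a • ContinuousLinearMap.id ℝ (Euc n))) x :=
        ((hh.differentiable one_ne_zero (a • x)).hasFDerivAt).comp x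
          ((hasFDerivAt_id x).const_smul a)
      rw [divergence_smul_self (hcompd a), hd.fderiv, hF']
      rcases n with _ | m
      · have : x = 0 := Subsingleton.elim _ _
        simp [this]
      · simp
        ring
    simp_rw [h2]
    rw [integral_const_mul, h1, mul_zero]
  have hderiv : ∀ a : ℝ, 1 ≤ a → HasDerivAt (fun a => ∫ x in E, F a x) 0 a := by
    intro a ha
    have ha0 : 0 < a := one_pos.trans_le ha
    -- For b > a/2 ≥ 1/2 the function h(b·) vanishes outside the ball of radius 2, which makes the
    -- dominating function integrable.
    have key := hasDerivAt_integral_of_dominated_loc_of_deriv_le (μ := volume.restrict E)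
      (F := F) (F' := F') (x₀ := a) (s := Ioo (a / 2) (2 * a))
      (bound := (Metric.closedBall (0 : Euc n) 2).indicator
        fun _ => n * (2 * a) ^ (n - 1) * M + (2 * a) ^ n * (D * 2))
      (Ioo_mem_nhds (by linarith) (by linarith))
      (Eventually.of_forall fun b =>
        (((hcompd b).continuous.const_mul _)).aestronglyMeasurable)
      ((((hcompd a).continuous.integrable_of_hasCompactSupport
        (hcomp a ha0)).const_mul _).integrableOn)
      (Continuous.aestronglyMeasurable (by
        have := (hcompd a).continuous
        have h3 : Continuous fun x => fderiv ℝ h (a • x) x :=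
          (hDc.comp (continuous_const_smul a)).clm_apply continuous_id
        exact (this.const_mul _).add (h3.const_mul _)))
      (ae_of_all _ fun x b hb => ?_)
      (((integrable_indicator_iff measurableSet_closedBall).2
        (integrableOn_const measure_closedBall_lt_top.ne)).integrableOn)
      (ae_of_all _ fun x b hb => ?_)
    · rw [hzero a ha] at key
      exact key.2
    · have hb0 : 0 < b := by linarith [hb.1]
      by_cases hx : x ∈ Metric.closedBall (0 : Euc n) 2
      · rw [indicator_of_mem hx]
        have hx2 : ‖x‖ ≤ 2 := mem_closedBall_zero_iff.1 hx
        have hb2 : b ≤ 2 * a := hb.2.le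
        refine (norm_add_le _ _).trans (add_le_add ?_ ?_)
        · rw [norm_mul, Real.norm_of_nonneg (by positivity)]
          have := hM (b • x)
          gcongr
        · rw [norm_mul, Real.norm_of_nonneg (by positivity)]
          have h3 : ‖fderiv ℝ h (b • x) x‖ ≤ D * 2 :=
            (ContinuousLinearMap.le_opNorm _ _).trans
              (mul_le_mul (hD _) hx2 (norm_nonneg _) hD0)
          gcongr
      · rw [indicator_of_notMem hx]
        have hx2 : 2 < ‖x‖ := by
          rw [mem_closedBall_zero_iff] at hx
          exact not_le.1 hx
        have hnot : b • x ∉ tsupport h := by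
          intro hmem
          have h2 := mem_ball_zero_iff.1 (hs hmem)
          rw [norm_smul, Real.norm_of_nonneg hb0.le] at h2
          nlinarith [hb.1]
        have h4 : fderiv ℝ h (b • x) = 0 :=
          image_eq_zero_of_notMem_tsupport fun h5 => hnot (tsupport_fderiv_subset ℝ h5)
        simp [hF', image_eq_zero_of_notMem_tsupport hnot, h4]
    · have h1 : HasDerivAt (fun b : ℝ => h (b • x)) (fderiv ℝ h (b • x) x) b := by
        have h2 : HasDerivAt (fun b : ℝ => b • x) x b := by
          simpa using (hasDerivAt_id b).smul_const x
        exact ((hh.differentiable one_ne_zero (b • x)).hasFDerivAt).comp_hasDerivAt b h2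
      exact (hasDerivAt_pow n b).mul h1
  have hconst : ∫ x in E, F c x = ∫ x in E, F 1 x := by
    refine (constant_of_has_deriv_right_zero (f := fun a => ∫ x in E, F a x) (a := 1) (b := c)
      (fun a ha => (hderiv a ha.1).continuousAt.continuousWithinAt)
      (fun a ha => (hderiv a ha.1).hasDerivWithinAt)) c ⟨hc1, le_rfl⟩
  simp only [hF, one_pow, one_smul, one_mul] at hconst
  rw [← hconst, integral_const_mul]

lemma quasiMeasurePreserving_smul {s : ℝ} (hs : s ≠ 0) :
    Measure.QuasiMeasurePreserving (fun x : Euc n => s • x) volume volume := by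
  refine ⟨measurable_const_smul s, ?_⟩
  rw [Measure.map_addHaar_smul _ hs]
  exact Measure.smul_absolutelyContinuous

/-- By `setIntegral_dilation_eq` the indicators of s⁻¹E and E have the same integral against every
test function in the ball, hence agree there almost everywhere. -/
lemma ae_smul_mem_iff (hE : NullMeasurableSet E volume)
    (h0 : ∀ h : Euc n → ℝ, ContDiff ℝ 1 h → HasCompactSupport h → tsupport h ⊆ oBall n 1 →
      ∫ x in E, divergence (fun x => h x • x) x = 0) {s : ℝ} (hs0 : 0 < s) (hs1 : s ≤ 1) :
    ∀ᵐ x : Euc n, x ∈ oBall n 1 → (s • x ∈ E ↔ x ∈ E) := by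
  have hc0 : 0 < s⁻¹ := inv_pos.2 hs0
  have hcE : NullMeasurableSet (s⁻¹ • E) volume := by
    rw [← preimage_smul₀ hs0.ne']
    exact hE.preimage (quasiMeasurePreserving_smul hs0.ne')
  set f : Euc n → ℝ := fun x => (s⁻¹ • E).indicator (fun _ => 1) x - E.indicator (fun _ => 1) x
    with hf
  have hloc : ∀ {A : Set (Euc n)}, NullMeasurableSet A volume →
      LocallyIntegrable (A.indicator fun _ => (1 : ℝ)) := by
    intro A hA x
    refine ⟨Metric.ball x 1, Metric.ball_mem_nhds x one_pos, ?_⟩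
    refine (Integrable.indicator₀ ?_ (hA.mono_ac Measure.restrict_le_self.absolutelyContinuous))
    exact integrableOn_const measure_ball_lt_top.ne
  have key := Metric.isOpen_ball.ae_eq_zero_of_integral_contDiff_smul_eq_zero (U := oBall n 1)
    (f := f) (μ := volume) (((hloc hcE).sub (hloc hE)).locallyIntegrableOn _) fun h hh hc hs => by
      have hh1 : ContDiff ℝ 1 h := hh.of_le (by exact_mod_cast le_top)
      have hint : Integrable h := hh.continuous.integrable_of_hasCompactSupport hc
      have h1 := Measure.setIntegral_comp_smul_of_pos (volume : Measure (Euc n)) h E hc0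
      rw [finrank_euclideanSpace_fin, smul_eq_mul, eq_inv_mul_iff_mul_eq₀ (by positivity),
        setIntegral_dilation_eq h0 hh1 hc hs ((one_le_inv₀ hs0).2 hs1)] at h1
      have h2 : ∀ x, h x • f x = (s⁻¹ • E).indicator h x - E.indicator h x := by
        intro x
        by_cases ha : x ∈ s⁻¹ • E <;> by_cases hb : x ∈ E <;> simp [hf, ha, hb]
      simp_rw [h2]
      rw [integral_sub (hint.indicator₀ hcE) (hint.indicator₀ hE), integral_indicator₀ hcE,
        integral_indicator₀ hE, h1, sub_self]
  filter_upwards [key] with x hx hxB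
  have h3 := hx hxB
  rw [← mem_inv_smul_set_iff₀ hs0.ne']
  clear key
  by_cases ha : x ∈ s⁻¹ • E <;> by_cases hb : x ∈ E <;> simp [hf, ha, hb] at h3 ⊢

/-- The exceptional null set depends on s; Fubini exchanges the quantifiers. The cone consists of
the points x with sx in the set for almost every small s > 0, a condition invariant under every
dilation. -/
lemma isConeIn_of_ae_smul_mem_iff (hE : NullMeasurableSet E volume)
    (h : ∀ s : ℝ, 0 < s → s ≤ 1 → ∀ᵐ x : Euc n, x ∈ oBall n 1 → (s • x ∈ E ↔ x ∈ E)) :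
    IsConeIn E (oBall n 1) := by
  -- Fubini needs a genuinely measurable representative.
  obtain ⟨A, -, hA, hAE⟩ := hE.exists_measurable_superset_ae_eq
  have hAE' : ∀ᵐ x : Euc n, x ∈ A ↔ x ∈ E := hAE.mem_iff
  have h1 : ∀ s : ℝ, 0 < s → s ≤ 1 → ∀ᵐ x : Euc n, x ∈ oBall n 1 → (s • x ∈ A ↔ x ∈ A) := by
    intro s hs0 hs1
    filter_upwards [h s hs0 hs1, hAE', (quasiMeasurePreserving_smul hs0.ne').ae hAE'] with x hx h2 h3 hxB
    rw [h3, h2]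
    exact hx hxB
  have h2 : ∀ᵐ x : Euc n, ∀ᵐ s : ℝ, s ∈ Ioc (0 : ℝ) 1 → x ∈ oBall n 1 → (s • x ∈ A ↔ x ∈ A) := by
    refine (Measure.ae_ae_comm (μ := (volume : Measure ℝ)) (ν := (volume : Measure (Euc n)))
      (p := fun s x => s ∈ Ioc (0 : ℝ) 1 → x ∈ oBall n 1 → (s • x ∈ A ↔ x ∈ A)) ?_).1
      (ae_of_all _ fun s => ?_)
    · have m1 : MeasurableSet {p : ℝ × Euc n | p.1 ∈ Ioc (0 : ℝ) 1} :=
        measurable_fst measurableSet_Ioc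
      have m2 : MeasurableSet {p : ℝ × Euc n | p.2 ∈ oBall n 1} :=
        measurable_snd measurableSet_ball
      have m3 : MeasurableSet {p : ℝ × Euc n | p.1 • p.2 ∈ A} :=
        (measurable_fst.smul measurable_snd) hA
      have m4 : MeasurableSet {p : ℝ × Euc n | p.2 ∈ A} := measurable_snd hA
      exact m1.imp (m2.imp (m3.iff m4))
    · by_cases hs : s ∈ Ioc (0 : ℝ) 1
      · filter_upwards [h1 s hs.1 hs.2] with x hx _ using hx
      · exact ae_of_all _ fun x h => absurd h hs
  refine ⟨{x | ∃ ε : ℝ, 0 < ε ∧ ∀ᵐ s : ℝ, s ∈ Ioo 0 ε → s • x ∈ A}, ?_, ?_⟩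
  · have hsub : ∀ t : ℝ, 0 < t → ∀ x : Euc n, (∃ ε : ℝ, 0 < ε ∧ ∀ᵐ s : ℝ, s ∈ Ioo 0 ε → s • x ∈ A) →
        ∃ ε : ℝ, 0 < ε ∧ ∀ᵐ s : ℝ, s ∈ Ioo 0 ε → s • t • x ∈ A := by
      rintro t ht x ⟨ε, hε, hx⟩
      have hq : Measure.QuasiMeasurePreserving (fun s : ℝ => t * s) volume volume := by
        refine ⟨measurable_const_mul t, ?_⟩
        rw [Real.map_volume_mul_left ht.ne']
        exact Measure.smul_absolutelyContinuous
      refine ⟨ε / t, by positivity, ?_⟩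
      filter_upwards [hq.ae hx] with s hs hsε
      rw [smul_smul, mul_comm]
      refine hs ⟨mul_pos ht hsε.1, ?_⟩
      rw [mul_comm]
      exact (lt_div_iff₀ ht).1 hsε.2
    intro t ht
    ext x
    rw [mem_smul_set_iff_inv_smul_mem₀ ht.ne']
    refine ⟨fun hx => ?_, fun hx => hsub _ (inv_pos.2 ht) x hx⟩
    have := hsub t ht _ hx
    rwa [smul_inv_smul₀ ht.ne'] at this
  · filter_upwards [h2, hAE'] with x hx hxA
    refine propext (and_congr_left fun hxB => ?_)
    rw [← hxA]
    constructor
    · intro hxA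
      refine ⟨1, one_pos, ?_⟩
      filter_upwards [hx] with s hs hs1 using (hs ⟨hs1.1, hs1.2.le⟩ hxB).2 hxA
    · rintro ⟨ε, hε, hxε⟩
      by_contra hxA
      have h3 : ∀ᵐ s : ℝ, s ∉ Ioo (0 : ℝ) (min ε 1) := by
        filter_upwards [hx, hxε] with s hs hs' hmem
        exact hxA ((hs ⟨hmem.1, (hmem.2.trans_le (min_le_right _ _)).le⟩ hxB).1
          (hs' ⟨hmem.1, hmem.2.trans_le (min_le_left _ _)⟩))
      have h4 := measure_eq_zero_iff_ae_notMem.2 h3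
      rw [Real.volume_Ioo, sub_zero, ENNReal.ofReal_eq_zero] at h4
      exact absurd h4 (not_le.2 (lt_min hε one_pos))

end ConeOfDilation

/-! ### Radial distribution of a homogeneous perimeter measure -/

section RadialDistribution

variable {n : ℕ} {μ : Measure (Euc n)} {f : ℝ → ℝ}

/-- The density is the derivative of c x^(n-1), and half-lines form a π-system that determines a
finite measure. -/
lemma map_norm_restrict_oBall [IsFiniteMeasure μ] (hn : 2 ≤ n) {c R : ℝ} (hR1 : R < 1)
    (h : ∀ r ∈ Ioo (0 : ℝ) 1, μ.real (oBall n r) = c * r ^ (n - 1)) (hc : 0 ≤ c) :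
    (μ.restrict (oBall n R)).map norm = (volume.restrict (Ioo 0 R)).withDensity
      fun x => ENNReal.ofReal (c * ((n - 1 : ℕ) * x ^ (n - 2))) := by
  have hB : ∀ s : ℝ, s < 1 → μ (oBall n s)
      = ∫⁻ x in Ioo 0 s, ENNReal.ofReal (c * ((n - 1 : ℕ) * x ^ (n - 2))) := by
    intro s hs
    rcases le_or_gt s 0 with h0 | h0
    · rw [oBall, Metric.ball_eq_empty.2 h0, Ioo_eq_empty (not_lt.2 h0)]
      simp
    rw [← ofReal_measureReal (measure_ne_top _ _), h s ⟨h0, hs⟩]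
    have hcont : Continuous fun x : ℝ => c * ((n - 1 : ℕ) * x ^ (n - 2)) := by fun_prop
    rw [← ofReal_integral_eq_lintegral_ofReal]
    · rw [← integral_Ioc_eq_integral_Ioo, ← intervalIntegral.integral_of_le h0.le,
        intervalIntegral.integral_const_mul, intervalIntegral.integral_const_mul, integral_pow]
      obtain ⟨m, rfl⟩ := Nat.exists_eq_add_of_le' hn
      have : (m : ℝ) + 1 ≠ 0 := by positivity
      simp
      field_simp
    · exact (hcont.integrableOn_Icc (a := 0) (b := s)).mono_set Ioo_subset_Icc_self
    · filter_upwards [ae_restrict_mem measurableSet_Ioo] with x hx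
      have := hx.1
      positivity
  have hIio : ∀ a : ℝ, (μ.restrict (oBall n R)).map norm (Iio a)
      = (volume.restrict (Ioo 0 R)).withDensity
        (fun x => ENNReal.ofReal (c * ((n - 1 : ℕ) * x ^ (n - 2)))) (Iio a) := by
    intro a
    rw [Measure.map_apply measurable_norm measurableSet_Iio,
      Measure.restrict_apply (measurable_norm measurableSet_Iio), withDensity_apply _ measurableSet_Iio,
      Measure.restrict_restrict measurableSet_Iio]
    have h1 : norm ⁻¹' Iio a ∩ oBall n R = oBall n (min a R) := by
      ext x
      simp [oBall]
    have h2 : Iio a ∩ Ioo 0 R = Ioo 0 (min a R) := by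
      ext x
      simp only [mem_inter_iff, mem_Iio, mem_Ioo, lt_min_iff]
      tauto
    rw [h1, h2, hB _ ((min_le_right _ _).trans_lt hR1)]
  refine ext_of_generate_finite (range Iio) (borel_eq_generateFrom_Iio ℝ ▸
    BorelSpace.measurable_eq) isPiSystem_Iio ?_ ?_
  · rintro _ ⟨a, rfl⟩
    exact hIio a
  · have h1 : (μ.restrict (oBall n R)).map norm univ = μ (oBall n R) := by
      rw [Measure.map_apply measurable_norm MeasurableSet.univ]
      simp
    rw [h1, withDensity_apply _ MeasurableSet.univ, hB R hR1, Measure.restrict_univ]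

/-- If the measure of the balls is homogeneous, the first variation along radial fields vanishes. -/
lemma integral_firstVariation_eq_zero [IsFiniteMeasure μ] (hn : 2 ≤ n) {c R : ℝ} (hR0 : 0 < R)
    (hR1 : R < 1) (h : ∀ r ∈ Ioo (0 : ℝ) 1, μ.real (oBall n r) = c * r ^ (n - 1))
    (hf : IsRadialProfile R f) : ∫ y, firstVariation (n - 1) 1 f id y ∂μ = 0 := by
  have hc : 0 ≤ c := by
    have h1 := h (1 / 2) ⟨by norm_num, by norm_num⟩
    have h2 : 0 ≤ c * (1 / 2) ^ (n - 1) := h1 ▸ measureReal_nonneg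
    exact nonneg_of_mul_nonneg_left h2 (by positivity)
  have hfc := hf.1.continuous
  have hdc := hf.continuous_deriv
  set G : ℝ → ℝ := fun x => (-(n - 1)) * f (x ^ 2) + (-(2 * 1)) * (x ^ 2 * deriv f (x ^ 2)) with hG
  have hGc : Continuous G := by fun_prop
  have hd0 : ∀ σ, R ^ 2 ≤ σ → deriv f σ = 0 := by
    have hcl : IsClosed {σ | deriv f σ = 0} := isClosed_eq hdc continuous_const
    intro σ hσ
    exact closure_minimal (fun v (hv : v ∈ Ioi (R ^ 2)) => hf.deriv_eq_zero hv) hcl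
      (by rw [closure_Ioi]; exact hσ)
  have h1 : ∫ y, firstVariation (n - 1) 1 f id y ∂μ = ∫ y in oBall n R, G ‖y‖ ∂μ := by
    refine (setIntegral_eq_integral_of_forall_compl_eq_zero fun y hy => ?_).symm
    have hy' : R ≤ ‖y‖ := by
      rw [mem_ball_zero_iff] at hy
      exact not_lt.1 hy
    have hσ : R ^ 2 ≤ ‖y‖ ^ 2 := by gcongr
    simp only [firstVariation, id, hf.3 _ hσ, hd0 _ hσ, mul_zero, add_zero]
  rw [h1, ← integral_map measurable_norm.aemeasurable hGc.aestronglyMeasurable,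
    map_norm_restrict_oBall hn hR1 h hc, integral_withDensity_eq_integral_toReal_smul
      (by fun_prop) (ae_of_all _ fun _ => ENNReal.ofReal_lt_top)]
  -- The integrand is -c(n-1) times the derivative of x^(n-1) f(x²), which vanishes at both
  -- endpoints.
  have h2 : ∫ x in Ioo 0 R, (ENNReal.ofReal (c * ((n - 1 : ℕ) * x ^ (n - 2)))).toReal • G x
      = ∫ x in Ioo 0 R, (-(c * (n - 1 : ℕ))) * ((n - 1 : ℕ) * x ^ (n - 1 - 1) * f (x ^ 2)
        + x ^ (n - 1) * (deriv f (x ^ 2) * (2 * x))) := by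
    refine setIntegral_congr_fun measurableSet_Ioo fun x hx => ?_
    have hx0 := hx.1
    rw [ENNReal.toReal_ofReal (by positivity), smul_eq_mul, hG]
    obtain ⟨m, rfl⟩ := Nat.exists_eq_add_of_le' hn
    simp
    ring
  rw [h2, integral_const_mul, ← integral_Ioc_eq_integral_Ioo,
    ← intervalIntegral.integral_of_le hR0.le,
    intervalIntegral.integral_eq_sub_of_hasDerivAt (f := fun x => x ^ (n - 1) * f (x ^ 2))]
  · rw [hf.3 _ le_rfl, zero_pow (by omega)]
    simp
  · intro x _
    have h3 : HasDerivAt (fun x : ℝ => f (x ^ 2)) (deriv f (x ^ 2) * ((2 : ℕ) * x ^ (2 - 1))) x :=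
      (hf.1.differentiable one_ne_zero (x ^ 2)).hasDerivAt.comp x (hasDerivAt_pow 2 x)
    norm_num at h3
    exact (hasDerivAt_pow (n - 1) x).mul h3
  · exact Continuous.intervalIntegrable (by fun_prop) _ _

end RadialDistribution

/-! ### Cost of perturbing the pulled back field -/

section NearMaximizer

variable {n : ℕ} {hn : 2 ≤ n} {E : Set (Euc n)} {μ : Measure (Euc n)} {δ : ℝ} {f : ℝ → ℝ}

lemma hasDerivAt_softPos_sub (a σ : ℝ) : HasDerivAt (fun σ => softPos (a - σ))
    (-(1 - 1 / (1 + max (a - σ) 0) ^ 2)) σ := by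
  have h : HasDerivAt (fun σ => softPos (a - σ)) ((1 - 1 / (1 + max (a - σ) 0) ^ 2) * -1) σ :=
    (hasDerivAt_softPos (a - σ)).comp σ ((hasDerivAt_id σ).const_sub a)
  rwa [mul_neg_one] at h

lemma isRadialProfile_softPos (R : ℝ) : IsRadialProfile R fun σ => softPos (R ^ 2 - σ) := by
  refine ⟨contDiff_softPos.comp (contDiff_const.sub contDiff_id), fun σ => ?_,
    fun σ hσ => softPos_of_nonpos (sub_nonpos.2 hσ)⟩
  rw [(hasDerivAt_softPos_sub _ σ).deriv, neg_nonpos, sub_nonneg, div_le_one (by positivity)]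
  have : 0 ≤ max (R ^ 2 - σ) 0 := le_max_right _ _
  nlinarith

lemma deriv_softPos_sub_le {R σ u : ℝ} (hu : 0 ≤ u) (hσ : σ ≤ R ^ 2 - u) :
    deriv (fun σ => softPos (R ^ 2 - σ)) σ ≤ -(1 - 1 / (1 + u) ^ 2) := by
  rw [(hasDerivAt_softPos_sub _ σ).deriv]
  have h1 : u ≤ max (R ^ 2 - σ) 0 := (by linarith : u ≤ R ^ 2 - σ).trans (le_max_left _ _)
  have h2 : 1 / (1 + max (R ^ 2 - σ) 0) ^ 2 ≤ 1 / (1 + u) ^ 2 := by gcongr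
  linarith

/-- With u = a^(n-2) ⟨x, w⟩, adding m x creates the cross term 2amu, while the cofactor norm has a
deficit of at least 2acu². Completing the square bounds their sum by a m²/(2c) when c > 0, so by B.
-/
lemma norm_cofactor_add_sq_le (hn : 2 ≤ n) {a c m B : ℝ} (ha : 0 < a) (ha1 : a ≤ 1) (hc : 0 ≤ c)
    (hB : 0 ≤ B) (hm : m ^ 2 ≤ 2 * c * B) (x : Euc n) {Di : Euc n →L[ℝ] Euc n}
    (hDi : ∀ v, rankOneUpdate a c x (Di v) = v) {w : Euc n} (hw : ‖w‖ ≤ 1) :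
    ‖(a ^ (n - 1) * (a + c * ‖x‖ ^ 2)) • Di w + m • x‖ ^ 2
      ≤ (a ^ (n - 2) * (a + c * ‖x‖ ^ 2)) ^ 2 + m ^ 2 * ‖x‖ ^ 2 + B := by
  rw [smul_inverse_rankOneUpdate hn x hDi]
  set b := a + c * ‖x‖ ^ 2 with hb
  set s := inner ℝ x w with hs
  have hb0 : 0 < b := by positivity
  have hab : a ≤ b := by
    have : 0 ≤ c * ‖x‖ ^ 2 := by positivity
    linarith
  set u := a ^ (n - 2) * s with hu
  have h1 := norm_smul_sub_inner_smul_sq b c x w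
  have h2 : inner ℝ (a ^ (n - 2) • (b • w - (c * s) • x)) (m • x) = m * (a * u) := by
    rw [inner_smul_left, inner_smul_right, inner_sub_left, inner_smul_left, inner_smul_left,
      real_inner_self_eq_norm_sq, real_inner_comm, ← hs, hu]
    simp only [conj_trivial]
    rw [show b = a + c * ‖x‖ ^ 2 from hb]
    ring
  rw [norm_add_sq_real, h2, norm_smul, norm_smul, mul_pow, mul_pow, h1,
    Real.norm_of_nonneg (by positivity : (0 : ℝ) ≤ a ^ (n - 2)), Real.norm_eq_abs, sq_abs]
  have h3 : -(2 * c * u ^ 2) + 2 * m * u ≤ B := by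
    rcases hc.eq_or_lt with h | h
    · rw [← h] at hm ⊢
      have : m = 0 := by nlinarith
      rw [this]
      linarith
    · have h4 : 0 ≤ (2 * c * u - m) ^ 2 := sq_nonneg _
      have h5 : 2 * c * (-(2 * c * u ^ 2) + 2 * m * u) ≤ 2 * c * B := by nlinarith
      exact le_of_mul_le_mul_left h5 (by positivity)
  have h4 : a * (-(2 * c * u ^ 2) + 2 * m * u) ≤ B := by
    rcases le_total 0 (-(2 * c * u ^ 2) + 2 * m * u) with h | h
    · exact (mul_le_of_le_one_left h ha1).trans h3
    · exact (mul_nonpos_of_nonneg_of_nonpos ha.le h).trans hB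
  have h5 : (a ^ (n - 2)) ^ 2 * (b ^ 2 * ‖w‖ ^ 2) ≤ (a ^ (n - 2) * b) ^ 2 := by
    rw [mul_pow, ← mul_assoc]
    exact mul_le_of_le_one_right (by positivity) (by nlinarith [norm_nonneg w])
  have h6 : 2 * a * c * u ^ 2 ≤ (a ^ (n - 2)) ^ 2 * (c * (2 * b - c * ‖x‖ ^ 2) * s ^ 2) := by
    have h7 : (a ^ (n - 2)) ^ 2 * (c * (2 * b - c * ‖x‖ ^ 2) * s ^ 2)
        = (a + b) * (c * u ^ 2) := by
      rw [hu, hb]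
      ring
    rw [h7]
    have : 0 ≤ c * u ^ 2 := by positivity
    nlinarith
  rw [mul_sub]
  linarith

end NearMaximizer

/-! ### Constant normalized perimeter forces a cone -/

section Rigidity

variable {n : ℕ} {hn : 2 ≤ n} {E : Set (Euc n)} {μ : Measure (Euc n)} {δ : ℝ} {f h : Euc n → ℝ}
  {φ : ℝ → ℝ} {T' : Euc n → Euc n}

/-- On the support of h the profile decreases at rate at least κ, so c ≥ 2tκ and the cost
(tmH)²/(2c) is at most t m² H²/(4κ). -/
lemma norm_pullField_radial_add_le (hn : 2 ≤ n) {R t m κ H : ℝ} (hφ : IsRadialProfile R φ)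
    (ht : 0 ≤ t) (htφ : t * φ 0 ≤ 1 / 2) (hT : IsC1Inverse (radialMap φ t) T')
    {g : Euc n → Euc n} (hg : ∀ x, ‖g x‖ ≤ 1) (hκ : 0 < κ) (hH : ∀ x, |h x| ≤ H)
    (hh : ∀ x, h x ≠ 0 → ‖x‖ ≤ 1 ∧ deriv φ (‖x‖ ^ 2) ≤ -κ) (y : Euc n) :
    ‖pullField (radialMap φ t) T' g y + (t * m * h y) • y‖
      ≤ (1 + (Real.exp (2 * t * firstVariation (n - 1) 1 φ id y)
        + (t ^ 2 * m ^ 2 * H ^ 2 + t * (m ^ 2 * (H ^ 2 / (4 * κ)))))) / 2 := by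
  have hfx0 := hφ.nonneg (‖y‖ ^ 2)
  have hfx1 : φ (‖y‖ ^ 2) ≤ φ 0 := hφ.antitone (by positivity)
  have hdx := hφ.2 (‖y‖ ^ 2)
  have hu1 : t * φ (‖y‖ ^ 2) ≤ 1 / 2 := (mul_le_mul_of_nonneg_left hfx1 ht).trans htφ
  have hu0 : 0 ≤ t * φ (‖y‖ ^ 2) := by positivity
  set a := 1 - t * φ (‖y‖ ^ 2) with ha
  set c := -2 * t * deriv φ (‖y‖ ^ 2) with hc
  have ha0 : 0 < a := by linarith
  have hc0 : 0 ≤ c := by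
    have : 0 ≤ t * -deriv φ (‖y‖ ^ 2) := mul_nonneg ht (by linarith)
    linarith
  have hDi : ∀ v, rankOneUpdate a c y (fderiv ℝ T' (radialMap φ t y) v) = v := fun v => by
    have := hT.fderiv_apply_inv y v
    rwa [fderiv_radialMap hφ.1] at this
  have hH2 : h y ^ 2 ≤ H ^ 2 := sq_le_sq' (by linarith [(abs_le.1 (hH y)).1]) (abs_le.1 (hH y)).2
  have hm : (t * m * h y) ^ 2 ≤ 2 * c * (t * (m ^ 2 * (H ^ 2 / (4 * κ)))) := by
    rcases eq_or_ne (h y) 0 with h0 | h0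
    · rw [h0]
      have : 0 ≤ 2 * c * (t * (m ^ 2 * (H ^ 2 / (4 * κ)))) := by positivity
      simpa using this
    · have h1 : 2 * t * κ ≤ c := by
        have : t * κ ≤ t * -deriv φ (‖y‖ ^ 2) :=
          mul_le_mul_of_nonneg_left (by linarith [(hh y h0).2]) ht
        linarith
      calc (t * m * h y) ^ 2 = t ^ 2 * m ^ 2 * h y ^ 2 := by ring
        _ ≤ t ^ 2 * m ^ 2 * H ^ 2 := by gcongr
        _ = 2 * (2 * t * κ) * (t * (m ^ 2 * (H ^ 2 / (4 * κ)))) := by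
          field_simp
          ring
        _ ≤ 2 * c * (t * (m ^ 2 * (H ^ 2 / (4 * κ)))) := by gcongr
  have main := norm_cofactor_add_sq_le hn ha0 (by linarith) hc0 (by positivity) hm y hDi
    (hg (radialMap φ t y))
  have hpull : pullField (radialMap φ t) T' g y = (a ^ (n - 1) * (a + c * ‖y‖ ^ 2))
      • fderiv ℝ T' (radialMap φ t y) (g (radialMap φ t y)) := by
    rw [pullField, fderiv_radialMap hφ.1, det_rankOneUpdate (by omega) ha0.ne', abs_of_nonneg]
    positivity
  rw [← hpull] at main
  have h2 : (t * m * h y) ^ 2 * ‖y‖ ^ 2 ≤ t ^ 2 * m ^ 2 * H ^ 2 := by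
    rcases eq_or_ne (h y) 0 with h0 | h0
    · rw [h0]
      have : 0 ≤ t ^ 2 * m ^ 2 * H ^ 2 := by positivity
      simpa using this
    · have h3 := (hh y h0).1
      calc (t * m * h y) ^ 2 * ‖y‖ ^ 2 = t ^ 2 * m ^ 2 * h y ^ 2 * ‖y‖ ^ 2 := by ring
        _ ≤ t ^ 2 * m ^ 2 * H ^ 2 * 1 ^ 2 := by gcongr
        _ = _ := by ring
  have h3 : (a ^ (n - 2) * (a + c * ‖y‖ ^ 2)) ^ 2
      ≤ Real.exp (2 * t * firstVariation (n - 1) 1 φ id y) := by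
    have e1 : a ^ (n - 2) ≤ Real.exp (-(t * φ (‖y‖ ^ 2))) ^ (n - 2) :=
      pow_le_pow_left₀ ha0.le (by linarith [Real.add_one_le_exp (-(t * φ (‖y‖ ^ 2)))]) _
    have e2 : a + c * ‖y‖ ^ 2 ≤ Real.exp (-(t * φ (‖y‖ ^ 2)) + c * ‖y‖ ^ 2) := by
      linarith [Real.add_one_le_exp (-(t * φ (‖y‖ ^ 2)) + c * ‖y‖ ^ 2)]
    calc (a ^ (n - 2) * (a + c * ‖y‖ ^ 2)) ^ 2
        ≤ (Real.exp (-(t * φ (‖y‖ ^ 2))) ^ (n - 2)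
          * Real.exp (-(t * φ (‖y‖ ^ 2)) + c * ‖y‖ ^ 2)) ^ 2 := by gcongr
      _ = _ := by
        rw [← Real.exp_nat_mul, ← Real.exp_add, ← Real.exp_nat_mul, firstVariation]
        congr 1
        push_cast [Nat.cast_sub hn]
        rw [hc, id]
        ring
  -- The inequality N ≤ (1 + N²)/2 passes from the squared norm to the norm without loss at first
  -- order.
  set N := ‖pullField (radialMap φ t) T' g y + (t * m * h y) • y‖ with hN
  have h4 : 0 ≤ (N - 1) ^ 2 := sq_nonneg _
  linarith

/-- Since the first variation integral vanishes, pulled back near-optimal fields satisfy the total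
variation inequality with error O(t²). Adding tτ h(x) x changes the left side by tτX and costs
O(tτ²). With t = τ² this leaves X ≤ τK, and τ → 0. -/
lemma IsThinObstacleMinimizer.setIntegral_divergence_smul_self_le
    (hE : IsThinObstacleMinimizer hn id δ E) (hμ : IsPerimeterMeasure E (oBall n 1) μ) {c : ℝ}
    (hmass : ∀ r ∈ Ioo (0 : ℝ) 1, μ.real (oBall n r) = c * r ^ (n - 1))
    (hh : ContDiff ℝ 1 h) (hc : HasCompactSupport h) (hs : tsupport h ⊆ oBall n 1) :
    ∫ x in E, divergence (fun x => h x • x) x ≤ 0 := by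
  have := hμ.isFiniteMeasure
  obtain ⟨r, ⟨hr0, hr1⟩, hr⟩ := exists_pos_lt_subset_ball one_pos (isClosed_tsupport h) hs
  obtain ⟨R, hrR, hR1⟩ := exists_between hr1
  have hR0 := hr0.trans hrR
  obtain ⟨H, hH⟩ := hc.exists_bound_of_continuous hh.continuous
  have hrR2 : 0 < R ^ 2 - r ^ 2 := by nlinarith
  set φ : ℝ → ℝ := fun σ => softPos (R ^ 2 - σ) with hφd
  have hφ : IsRadialProfile R φ := isRadialProfile_softPos R
  set κ := 1 - 1 / (1 + (R ^ 2 - r ^ 2)) ^ 2 with hκd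
  have hκ : 0 < κ := by
    rw [hκd, sub_pos, div_lt_one (by positivity)]
    nlinarith
  have hhφ : ∀ x, h x ≠ 0 → ‖x‖ ≤ 1 ∧ deriv φ (‖x‖ ^ 2) ≤ -κ := by
    intro x hx
    have hxr : ‖x‖ < r := mem_ball_zero_iff.1 (hr (subset_tsupport h hx))
    refine ⟨(hxr.trans hr1).le, deriv_softPos_sub_le hrR2.le ?_⟩
    have : ‖x‖ ^ 2 ≤ r ^ 2 := by gcongr
    linarith
  obtain ⟨M, hM0, hM⟩ := hφ.exists_bound (-((n : ℝ) - 1)) (-(2 * 1))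
  have hL : Continuous (firstVariation (n - 1) 1 φ id : Euc n → ℝ) :=
    continuous_firstVariation hφ continuous_id
  have hLM : ∀ y : Euc n, |firstVariation (n - 1) 1 φ id y| ≤ M := fun y => hM _ (by positivity)
  have hL0 := integral_firstVariation_eq_zero hn hR0 hR1 hmass hφ
  obtain ⟨t₀, ht₀, hinv⟩ := exists_isC1Inverse_radialMap (n := n) hφ.1 hφ.3
  set t₁ := min (min 1 t₀) (min (1 / (2 * M)) (1 / (2 * (φ 0 + 1)))) with ht₁
  have hφ0 := hφ.nonneg 0
  have ht₁0 : 0 < t₁ := by positivity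
  have hX : IsTestField (oBall n 1) fun x => h x • x :=
    ⟨hh.smul contDiff_id, hc.smul_right, (tsupport_smul_subset_left h _).trans hs⟩
  set X := ∫ x in E, divergence (fun x => h x • x) x with hXd
  set K := 1 + (2 * M ^ 2 + (H ^ 2 + H ^ 2 / (4 * κ)) / 2) * μ.real univ with hK
  have key : ∀ τ : ℝ, 0 < τ → τ ^ 2 ≤ t₁ → X ≤ τ * K := by
    intro τ hτ htt
    set t := τ ^ 2 with ht
    have ht0 : 0 < t := by positivity
    have ht1 : t ≤ 1 := htt.trans ((min_le_left _ _).trans (min_le_left _ _))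
    obtain ⟨T', hT⟩ := hinv t ht0.le (htt.trans ((min_le_left _ _).trans (min_le_right _ _)))
    have htM : 2 * t * M ≤ 1 := by
      have := htt.trans ((min_le_right _ _).trans (min_le_left _ _))
      rw [le_div_iff₀ (by positivity)] at this
      linarith
    have htφ : t * φ 0 ≤ 1 / 2 := by
      have := htt.trans ((min_le_right _ _).trans (min_le_right _ _))
      rw [le_div_iff₀ (by positivity)] at this
      nlinarith
    have hid : IsC1Inverse (id : Euc n → Euc n) id := isNearIdentity_id.inv
    -- The near-optimality slack t² is of the same order as tτ².
    obtain ⟨g, hg, hg1, hle⟩ := hE.exists_pullField hμ hT (isCompact_closedBall 0 R)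
      (Metric.closedBall_subset_ball hR1)
      (fun y hy => conj_radialMap_eq hid hφ hR0 y (by rwa [image_id]))
      (conj_radialMap_inv_mem hid hφ ht0.le htφ hT) (ε := t ^ 2) (by positivity)
    have hY := hX.smul (u := fun _ => t * τ) contDiff_const
    have hweak := (hT.hasWeakDivergence_pullField hg).add hY.hasWeakDivergence
    have h1 := hweak.integral_le hμ
    have h2 : ∫ x in E, (|(fderiv ℝ (radialMap φ t) x).det| * divergence g (radialMap φ t x)
        + divergence (fun x => (t * τ) • h x • x) x)
        = (∫ x in E, |(fderiv ℝ (radialMap φ t) x).det| * divergence g (radialMap φ t x))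
          + t * τ * X := by
      have i1 := hT.hasWeakDivergence_pullField hg
      rw [integral_add (i1.2.integrable_of_hasCompactSupport i1.4).integrableOn
        hY.integrable_divergence.integrableOn, hX.integral_const_smul]
    obtain ⟨i2, h3⟩ := integral_exp_firstVariation_le (μ := μ) hL hLM (t := 2 * t) (by positivity) htM
    rw [hL0, mul_zero, add_zero] at h3
    set B := t ^ 2 * τ ^ 2 * H ^ 2 + t * (τ ^ 2 * (H ^ 2 / (4 * κ))) with hB
    have i3 : Integrable (fun y : Euc n =>
        (1 + (Real.exp (2 * t * firstVariation (n - 1) 1 φ id y) + B)) / 2) μ :=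
      ((integrable_const _).add (i2.add (integrable_const _))).div_const 2
    have h4 : ∫ y, ‖pullField (radialMap φ t) T' g y + (t * τ) • h y • y‖ ∂μ
        ≤ ∫ y, (1 + (Real.exp (2 * t * firstVariation (n - 1) 1 φ id y) + B)) / 2 ∂μ := by
      refine integral_mono (hweak.1.integrable_of_hasCompactSupport hweak.3).norm i3 fun y => ?_
      have := norm_pullField_radial_add_le hn (m := τ) hφ ht0.le htφ hT hg1 hκ hH hhφ y
      rwa [mul_smul] at this
    have h5 : ∫ y, (1 + (Real.exp (2 * t * firstVariation (n - 1) 1 φ id y) + B)) / 2 ∂μ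
        = (μ.real univ + (∫ y, Real.exp (2 * t * firstVariation (n - 1) 1 φ id y) ∂μ
          + B * μ.real univ)) / 2 := by
      have i4 : Integrable (fun y : Euc n =>
        Real.exp (2 * t * firstVariation (n - 1) 1 φ id y) + B) μ := i2.add (integrable_const _)
      rw [integral_div, integral_add (integrable_const _) i4, integral_add i2 (integrable_const _)]
      simp [mul_comm]
    have h6 : B ≤ t * τ ^ 2 * (H ^ 2 + H ^ 2 / (4 * κ)) := by
      have : t ^ 2 * τ ^ 2 * H ^ 2 ≤ t * 1 * τ ^ 2 * H ^ 2 := by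
        rw [sq t]
        gcongr
      rw [hB]
      linarith
    have h7 : B * μ.real univ ≤ t * τ ^ 2 * (H ^ 2 + H ^ 2 / (4 * κ)) * μ.real univ :=
      mul_le_mul_of_nonneg_right h6 measureReal_nonneg
    have h8 : t * τ * X ≤ t * τ * (τ * K) := by
      have e1 : t * τ * (τ * K) = t ^ 2 + (2 * t) ^ 2 * M ^ 2 * μ.real univ / 2
          + t * τ ^ 2 * (H ^ 2 + H ^ 2 / (4 * κ)) * μ.real univ / 2 := by
        rw [hK, ht]
        ring
      rw [e1]
      linarith
    exact le_of_mul_le_mul_left h8 (by positivity)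
  have hlim : Tendsto (fun τ : ℝ => τ * K) (𝓝[>] 0) (𝓝 (0 * K)) :=
    (Continuous.tendsto (by fun_prop) 0).mono_left nhdsWithin_le_nhds
  rw [zero_mul] at hlim
  refine ge_of_tendsto hlim ?_
  filter_upwards [Ioc_mem_nhdsGT (Real.sqrt_pos.2 ht₁0)] with τ hτ
  exact key τ hτ.1 ((Real.le_sqrt hτ.1.le ht₁0.le).1 hτ.2)

/-- The inequality for h and for -h gives equality, so the weak radial derivative of 1_E vanishes.
-/
theorem IsThinObstacleMinimizer.isConeIn (hE : IsThinObstacleMinimizer hn id δ E) {c : ℝ}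
    (hc : ∀ r ∈ Ioo (0 : ℝ) 1, normPerimeter id E r = c) : IsConeIn E (oBall n 1) := by
  obtain ⟨μ, hμ⟩ := exists_isPerimeterMeasure (E := E) (Metric.isOpen_ball (x := (0 : Euc n)) (ε := 1))
    hE.finite_perimeter.ne
  have hmass : ∀ r ∈ Ioo (0 : ℝ) 1, μ.real (oBall n r) = c * r ^ (n - 1) := by
    intro r hr
    have h1 := hc r hr
    rw [hμ.normPerimeter_eq isNearIdentity_id.inv
      (by rw [image_id]; exact Metric.ball_subset_ball hr.2.le), image_id] at h1
    rw [← h1, div_mul_cancel₀ _ (pow_pos hr.1 _).ne']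
  refine isConeIn_of_ae_smul_mem_iff hE.measurable fun s hs0 hs1 =>
    ae_smul_mem_iff hE.measurable (fun h hh hhc hhs => le_antisymm
      (hE.setIntegral_divergence_smul_self_le hμ hmass hh hhc hhs) ?_) hs0 hs1
  have h1 := hE.setIntegral_divergence_smul_self_le hμ hmass hh.neg hhc.neg
    ((tsupport_neg h).trans_subset hhs)
  have h2 : ∀ x, divergence (fun x => -h x • x) x = -divergence (fun x => h x • x) x := by
    intro x
    rw [divergence_smul_self hh, divergence_smul_self hh.neg, fderiv_fun_neg, neg_apply]
    ring
  simp_rw [h2] at h1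
  rw [integral_neg] at h1
  linarith

end Rigidity

/-! ### The monotonicity formula -/

theorem mainTheorem6 (n : ℕ) (hn : 2 ≤ n) :
    (∀ (δ : ℝ) (E : Set (Euc n)), 0 < δ → δ ≤ Real.pi / 2 →
      IsThinObstacleMinimizer hn id δ E →
      (0 : Euc n) ∈ essBoundary E ∩ obstacleEdge hn id →
        MonotoneOn (normPerimeter id E) (Set.Ioo 0 1) ∧
        (∀ r ∈ Set.Ioo (0 : ℝ) 1, ∀ a : ℝ,
          HasDerivAt (normPerimeter id E) a r → 0 ≤ a) ∧
        (∀ᵐ r : ℝ, r ∈ Set.Ioo (0 : ℝ) 1 → DifferentiableAt ℝ (normPerimeter id E) r) ∧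
        ((∃ c : ℝ, ∀ r ∈ Set.Ioo (0 : ℝ) 1, normPerimeter id E r = c) ↔
          IsConeIn E (oBall n 1))) ∧
    (∃ η₀ : ℝ, 0 < η₀ ∧ η₀ < 1 ∧ ∃ C : ℝ, 0 < C ∧
      ∀ (η δ : ℝ) (Φ : Euc n → Euc n) (E : Set (Euc n)),
        0 < η → η ≤ η₀ → 0 < δ → δ ≤ Real.pi / 2 →
        IsC11Diffeo Φ → Φ 0 = 0 → fderiv ℝ Φ 0 = ContinuousLinearMap.id ℝ (Euc n) →
        (∀ x ∈ oBall n 1, ∀ y ∈ oBall n 1, ‖fderiv ℝ Φ x - fderiv ℝ Φ y‖ ≤ η * ‖x - y‖) →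
        IsThinObstacleMinimizer hn Φ δ E →
        (0 : Euc n) ∈ essBoundary E ∩ obstacleEdge hn Φ →
          MonotoneOn (fun r => normPerimeter Φ E r + C * η * r)
            {r : ℝ | 0 < r ∧ r < 1 ∧ Φ '' oBall n r ⊆ oBall n 1} ∧
          (∀ r : ℝ, 0 < r → r < 1 → Φ '' oBall n r ⊆ oBall n 1 → ∀ a : ℝ,
            HasDerivAt (normPerimeter Φ E) a r → -(C * η) ≤ a) ∧
          (∀ᵐ r : ℝ, 0 < r → r < 1 → Φ '' oBall n r ⊆ oBall n 1 →
            DifferentiableAt ℝ (normPerimeter Φ E) r)) := by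
  obtain ⟨C, hC, hmono⟩ := exists_monotoneOn_normPerimeter_add n hn
  have hn' : (2 : ℝ) ≤ n := by exact_mod_cast hn
  -- This η₀ is the smallness that keeps the perturbed exponent m positive and the errors linear.
  refine ⟨fun δ E _ _ hE _ => ?_, 1 / (8 * (n + 1)), by positivity, ?_, C, hC,
    fun η δ Φ E hη hη₀ _ _ hΦ _ hD hL hE _ => ?_⟩
  -- The identity is the case η = 0, in which the correction Cηr disappears.
  · have h1 := hmono E id id δ 0 hE isNearIdentity_id (by simp)
    obtain ⟨h2, h3⟩ := derivative_bounds_of_monotoneOn h1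
    simp only [mul_zero, zero_mul, add_zero, neg_zero, admissibleRadii_id] at h1 h2 h3
    exact ⟨h1, h2, h3, fun ⟨c, hc⟩ => hE.isConeIn hc,
      fun h => ⟨_, fun r hr => h.normPerimeter_eq hn hr⟩⟩
  · rw [div_lt_one (by positivity)]
    linarith
  · obtain ⟨Ψ, h1, h2, h3, h4, -, -⟩ := hΦ
    have h5 := hmono E Φ Ψ δ η hE ⟨⟨h1, h2, h3, h4⟩, hη.le, hD, hL⟩
      (by rwa [← le_div_iff₀ (by positivity)])
    obtain ⟨h6, h7⟩ := derivative_bounds_of_monotoneOn h5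
    refine ⟨h5, fun r h0 h1 hr => h6 r ⟨h0, h1, hr⟩, ?_⟩
    filter_upwards [h7] with r hr h0 h1 hr'
    exact hr ⟨h0, h1, hr'⟩
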